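/- Let $(M,g)$ be a spacetime of dimension $n+1\ge 2$, i.e. a connected, Hausdorff, second countable smooth manifold with a smooth Lorentzian metric of signature $(-,+,\dots,+)$ and a time orientation. Write $p\ll q$ if there is a piecewise smooth future-directed timelike curve from $p$ to $q$, put $I^-(A)=\{p: p\ll q \text{ for some } q\in A\}$, and let $d(p,q)\in[0,\infty]$ be the Lorentzian distance (the supremum of the lengths of the piecewise smooth future-directed causal curves from $p$ to $q$, and $0$ if there are none). Assume that $(M,g)$ is timelike Cauchy complete: every sequence $(x_k)$ with $x_k\ll x_{k+1}$ for all $k$ [resp. $x_{k+1}\ll x_k$ for all $k$] for which there are $B_k\ge 0$, $B_k\to 0$, with $d(x_k,x_{k'})\le B_k$ [resp. $d(x_{k'},x_k)\le B_k$] for all $k\le k'$, converges in $M$. Let $f\in C^\infty(M)$ be a temporal function, i.e. $g(\nabla f,\nabla f)<0$ everywhere, with $\nabla f$ future-directed (so that $f$ decreases to the future), and suppose: (a) there is $\varepsilon>0$ with $|\nabla f|_g=\sqrt{|g(\nabla f,\nabla f)|}\ge\varepsilon$ on $M$; (b) $f$ solves the eikonal equation $\hat g(\hat\nabla f,\hat\nabla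 f)=-1$ for the metric $\hat g:=-g(\nabla f,\nabla f)\,g$, with $\hat g$-gradient $\hat\nabla f$, and the following curvature constraint holds for $\hat g$ and its curvature tensor $\hat R$: there are a smooth positive function $\mathfrak a:[0,\infty)\to\mathbb R$ and $t_0\ge 0$ with $\dot{\mathfrak a}(t_0)>0$, $\int_0^\infty dt/\mathfrak a(t)=\infty$, and $$\sqrt n\;\hat g\big(\hat R(\hat\nabla f,v)\hat\nabla f,w\big)\ \ge\ -\frac{\ddot{\mathfrak a}(t)}{\mathfrak a(t)}$$ for all $t\ge t_0$, all $p\in M$ with $f(p)=-t$ and all $\hat g$-unit vectors $v,w\in T_pM$ orthogonal to $\hat\nabla f(p)$. Then $f(M)=\mathbb R$, and the foliation of $M$ by the integral curves of $\nabla f$ is future omniscient: $I^-(\gamma)=M$ for every leaf $\gamma$ (the image of a maximal integral curve of $\nabla f$). If in addition $f^{-1}(0)$ is compact, then the future no-observer-horizon (NOH) condition holds: $I^-(\gamma)=M$ for every future-inextendible timelike curve $\gamma$ in $(M,g)$. -/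

import Mathlib

open Set Filter MeasureTheory
open scoped Manifold ContDiff Topology ENNReal Bundle

noncomputable section

namespace Lorentz

section Tensor

variable {E : Type*} [NormedAddCommGroup E] [NormedSpace ℝ E]
  {M : Type*} [TopologicalSpace M] [ChartedSpace E M]

variable (E M) in
/-- A field of bilinear forms on the tangent spaces of `M`. -/
abbrev TensorField : Type _ :=
  (x : M) → TangentSpace 𝓘(ℝ, E) x →L[ℝ] TangentSpace 𝓘(ℝ, E) x →L[ℝ] ℝ

/-- The gradient of `f`: the vector field with `g (∇f, v) = df v`, obtained by inverting
`v ↦ g (v, ·)` on each tangent space. -/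
def grad (g : TensorField E M) (f : M → ℝ) (x : M) : TangentSpace 𝓘(ℝ, E) x :=
  (g x).inverse (mvfderiv 𝓘(ℝ, E) f x)

/-- `g (∇f, ∇f)`. -/
def gradSq (g : TensorField E M) (f : M → ℝ) (x : M) : ℝ :=
  g x (grad g f x) (grad g f x)

/-- The conformally related metric `ĝ = -g(∇f, ∇f) g`. -/
def conformal (g : TensorField E M) (f : M → ℝ) : TensorField E M :=
  fun x => (-gradSq g f x) • g x

/-- The timelike eikonal equation `g(∇f, ∇f) = -1`. -/
def SolvesEikonal (g : TensorField E M) (f : M → ℝ) : Prop :=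
  ContMDiff 𝓘(ℝ, E) 𝓘(ℝ, ℝ) ∞ f ∧ ∀ x, gradSq g f x = -1

/-- The components of `g` in the chart at `p`, as a function of the coordinate `y ∈ E`. -/
def coordMetric (g : TensorField E M) (p : M) (y : E) : E →L[ℝ] E →L[ℝ] ℝ :=
  let B : E →L[ℝ] E →L[ℝ] ℝ := g ((extChartAt 𝓘(ℝ, E) p).symm y)
  let D : E →L[ℝ] E := mfderiv 𝓘(ℝ, E) 𝓘(ℝ, E) (extChartAt 𝓘(ℝ, E) p).symm y
  B.bilinearComp D D

/-- The Christoffel symbols `Γ(u, v)` of the Levi-Civita connection in a coordinate domain with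
metric components `G`: the vector with
`G(Γ(u, v), w) = (1/2) (∂_u G(v, w) + ∂_v G(u, w) - ∂_w G(u, v))` for all `w`. -/
def christoffel (G : E → E →L[ℝ] E →L[ℝ] ℝ) (y u v : E) : E :=
  (G y).inverse ((1 / 2 : ℝ) •
    (fderiv ℝ G y u v + fderiv ℝ G y v u - ((fderiv ℝ G y).flip u).flip v))

/-- The curvature `R(u, v)w = ∇_u ∇_v w - ∇_v ∇_u w` in coordinates (`u, v, w` are extended as
constant, hence commuting, coordinate vector fields). -/
def coordCurvature (G : E → E →L[ℝ] E →L[ℝ] ℝ) (y u v w : E) : E :=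
  fderiv ℝ (fun z => christoffel G z v w) y u - fderiv ℝ (fun z => christoffel G z u w) y v
    + christoffel G y u (christoffel G y v w) - christoffel G y v (christoffel G y u w)

/-- `⟨R(u, v)w, z⟩` at `p`, computed in the chart at `p`. -/
def curvature (g : TensorField E M) (p : M) (u v w z : TangentSpace 𝓘(ℝ, E) p) : ℝ :=
  let φ : M → E := extChartAt 𝓘(ℝ, E) p
  let c : TangentSpace 𝓘(ℝ, E) p →L[ℝ] E := mfderiv 𝓘(ℝ, E) 𝓘(ℝ, E) φ p
  coordMetric g p (φ p) (coordCurvature (coordMetric g p) (φ p) (c u) (c v) (c w)) (c z)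

/-- The curvature constraint for `(M, g)`, `dim M = n + 1`, and the vector field `∇f`: there is a
positive smooth `a : [0, ∞) → ℝ` and `t₀ ≥ 0` with `a'(t₀) > 0`, `∫₀^∞ 1/a = ∞` and
`√n ⟨R(∇f, v)∇f, w⟩ ≥ -a''(t)/a(t)` for all `t ≥ t₀` and all unit `v, w ⊥ ∇f` at points of flow
time `t`. When `g(∇f, ∇f) = -1` the function `f` decreases at unit rate along `∇f`, so that the
points of flow time `t` (counted from the slice `f = 0`) are those with `f = -t`. -/
def CurvatureConstraint (n : ℕ) (g : TensorField E M) (f : M → ℝ) : Prop :=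
  ∃ (a : ℝ → ℝ) (t₀ : ℝ), ContDiffOn ℝ ∞ a (Ici 0) ∧ (∀ t ∈ Ici (0 : ℝ), 0 < a t) ∧
    0 ≤ t₀ ∧ 0 < derivWithin a (Ici 0) t₀ ∧
    (∫⁻ t in Ici (0 : ℝ), ENNReal.ofReal (1 / a t)) = ⊤ ∧
    ∀ t ∈ Ici t₀, ∀ p : M, f p = -t → ∀ v w : TangentSpace 𝓘(ℝ, E) p,
      g p (grad g f p) v = 0 → g p (grad g f p) w = 0 → g p v v = 1 → g p w w = 1 →
      -(iteratedDerivWithin 2 a (Ici 0) t / a t) ≤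
        √(n : ℝ) * curvature g p (grad g f p) v (grad g f p) w

/-- The leaf through `p` of the foliation by the integral curves of `X`: all points that lie with
`p` on a common integral curve, i.e. the image of the maximal integral curve through `p`. -/
def leaf (X : (x : M) → TangentSpace 𝓘(ℝ, E) x) (p : M) : Set M :=
  {q | ∃ (γ : ℝ → M) (J : Set ℝ), IsOpen J ∧ J.OrdConnected ∧
    IsMIntegralCurveOn (I := 𝓘(ℝ, E)) γ X J ∧ ∃ s ∈ J, ∃ t ∈ J, γ s = p ∧ γ t = q}

/-- `γ` is piecewise smooth on `[a, b]` and all its velocities (both one-sided ones at a break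
point) satisfy `P`. -/
def IsPiecewiseSmooth (P : (x : M) → TangentSpace 𝓘(ℝ, E) x → Prop) (γ : ℝ → M) (a b : ℝ) :
    Prop :=
  a < b ∧ ∃ (N : ℕ) (τ : ℕ → ℝ), τ 0 = a ∧ τ N = b ∧ ∀ i < N, τ i < τ (i + 1) ∧
    ContMDiffOn 𝓘(ℝ, ℝ) 𝓘(ℝ, E) ∞ γ (Icc (τ i) (τ (i + 1))) ∧
    ∀ t ∈ Icc (τ i) (τ (i + 1)),
      P (γ t) (mfderivWithin 𝓘(ℝ, ℝ) 𝓘(ℝ, E) γ (Icc (τ i) (τ (i + 1))) t (1 : ℝ))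

end Tensor

/-- A spacetime structure on the manifold `M`: a smooth Lorentzian metric, of signature
`(-, +, …, +)`, and a time orientation, given by a smooth timelike vector field. -/
structure Spacetime (E : Type*) [NormedAddCommGroup E] [NormedSpace ℝ E]
    (M : Type*) [TopologicalSpace M] [ChartedSpace E M] [IsManifold 𝓘(ℝ, E) ∞ M] where
  /-- The metric. -/
  g : TensorField E M
  symm : ∀ x v w, g x v w = g x w v
  signature : ∀ x, ∃ v, g x v v < 0 ∧ ∀ w, g x v w = 0 → w ≠ 0 → 0 < g x w w
  smooth : ContMDiff 𝓘(ℝ, E) (𝓘(ℝ, E).prod 𝓘(ℝ, E →L[ℝ] E →L[ℝ] ℝ)) ∞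
    (fun x => Bundle.TotalSpace.mk' (E →L[ℝ] E →L[ℝ] ℝ)
      (E := fun x : M => TangentSpace 𝓘(ℝ, E) x →L[ℝ] TangentSpace 𝓘(ℝ, E) x →L[ℝ] ℝ) x (g x))
  /-- The time orientation. -/
  T : (x : M) → TangentSpace 𝓘(ℝ, E) x
  T_smooth : ContMDiff 𝓘(ℝ, E) 𝓘(ℝ, E).tangent ∞
    (fun x => (⟨x, T x⟩ : TangentBundle 𝓘(ℝ, E) M))
  T_timelike : ∀ x, g x (T x) (T x) < 0

namespace Spacetime

variable {E : Type*} [NormedAddCommGroup E] [NormedSpace ℝ E]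
  {M : Type*} [TopologicalSpace M] [ChartedSpace E M] [IsManifold 𝓘(ℝ, E) ∞ M]

/-- Future-directed timelike vectors. -/
def FutureTimelike (S : Spacetime E M) (x : M) (v : TangentSpace 𝓘(ℝ, E) x) : Prop :=
  S.g x v v < 0 ∧ S.g x (S.T x) v < 0

/-- Future-directed causal vectors (the second condition forces `v ≠ 0`). -/
def FutureCausal (S : Spacetime E M) (x : M) (v : TangentSpace 𝓘(ℝ, E) x) : Prop :=
  S.g x v v ≤ 0 ∧ S.g x (S.T x) v < 0

/-- The chronological relation `p ≪ q`. -/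
def Chron (S : Spacetime E M) (p q : M) : Prop :=
  ∃ (γ : ℝ → M) (a b : ℝ), IsPiecewiseSmooth S.FutureTimelike γ a b ∧ γ a = p ∧ γ b = q

/-- The chronological past `I⁻(A)`. -/
def chronPast (S : Spacetime E M) (A : Set M) : Set M := {p | ∃ q ∈ A, S.Chron p q}

/-- The Lorentzian length of a piecewise smooth causal curve (the finitely many break points, at
which `mfderiv` is meaningless, do not contribute). -/
def length (S : Spacetime E M) (γ : ℝ → M) (a b : ℝ) : ℝ≥0∞ :=
  ∫⁻ t in Icc a b, ENNReal.ofReal (√(-S.g (γ t)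
    (mfderiv 𝓘(ℝ, ℝ) 𝓘(ℝ, E) γ t (1 : ℝ)) (mfderiv 𝓘(ℝ, ℝ) 𝓘(ℝ, E) γ t (1 : ℝ))))

/-- The Lorentzian distance: the supremum of the lengths of the future-directed causal curves from
`p` to `q`, and `0` if there are none. -/
def dist (S : Spacetime E M) (p q : M) : ℝ≥0∞ :=
  ⨆ (γ : ℝ → M) (a : ℝ) (b : ℝ)
    (_ : IsPiecewiseSmooth S.FutureCausal γ a b ∧ γ a = p ∧ γ b = q), S.length γ a b

/-- Every future timelike Cauchy sequence converges. -/
def FutureCauchyComplete (S : Spacetime E M) : Prop :=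
  ∀ x : ℕ → M, (∀ k, S.Chron (x k) (x (k + 1))) →
    (∃ B : ℕ → ℝ, (∀ k, 0 ≤ B k) ∧ (∀ k k', k ≤ k' → S.dist (x k) (x k') ≤ ENNReal.ofReal (B k)) ∧
      Tendsto B atTop (𝓝 0)) →
    ∃ p, Tendsto x atTop (𝓝 p)

/-- Every past timelike Cauchy sequence converges. -/
def PastCauchyComplete (S : Spacetime E M) : Prop :=
  ∀ x : ℕ → M, (∀ k, S.Chron (x (k + 1)) (x k)) →
    (∃ B : ℕ → ℝ, (∀ k, 0 ≤ B k) ∧ (∀ k k', k ≤ k' → S.dist (x k') (x k) ≤ ENNReal.ofReal (B k)) ∧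
      Tendsto B atTop (𝓝 0)) →
    ∃ p, Tendsto x atTop (𝓝 p)

/-- Timelike Cauchy completeness. -/
def TimelikeCauchyComplete (S : Spacetime E M) : Prop :=
  S.FutureCauchyComplete ∧ S.PastCauchyComplete

/-- A temporal function: a smooth function with timelike gradient. -/
def IsTemporal (S : Spacetime E M) (f : M → ℝ) : Prop :=
  ContMDiff 𝓘(ℝ, E) 𝓘(ℝ, ℝ) ∞ f ∧ ∀ x, gradSq S.g f x < 0

/-- The future-directed timelike vector field `X` spans a future omniscient foliation:
`I⁻(γ) = M` for each leaf `γ`. -/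
def FutureOmniscient (S : Spacetime E M) (X : (x : M) → TangentSpace 𝓘(ℝ, E) x) : Prop :=
  (∀ x, S.FutureTimelike x (X x)) ∧ ∀ p, S.chronPast (leaf X p) = univ

/-- `γ`, defined on the interval `J`, is a future-directed timelike curve without future endpoint
(an interval with a greatest element is excluded: there `atTop` is the principal filter of that
element, and the curve ends). -/
def IsFutureInextendibleTimelike (S : Spacetime E M) (γ : ℝ → M) (J : Set ℝ) : Prop :=
  J.Nonempty ∧ J.OrdConnected ∧
    (∀ s ∈ J, ∀ t ∈ J, s < t → IsPiecewiseSmooth S.FutureTimelike γ s t) ∧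
    ¬ ∃ p, Tendsto (fun t : J => γ t) atTop (𝓝 p)

/-- The future no-observer-horizon condition: `I⁻(γ) = M` for every future-inextendible timelike
curve `γ`. -/
def FutureNOH (S : Spacetime E M) : Prop :=
  ∀ (γ : ℝ → M) (J : Set ℝ), S.IsFutureInextendibleTimelike γ J → S.chronPast (γ '' J) = univ

end Spacetime

end Lorentz

end

/-! Write `U` for the gradient of `f` with respect to the conformal metric `ĝ`. The conformal factor
is chosen so that `ĝ(U, U) = df(U) = -1`. Thus `f` falls at unit rate along `U`, while the timelike
cones and `I⁻` are those of `g`.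

Completeness of `U`. The reversed Cauchy–Schwarz inequality and `|∇f| ≥ ε` bound the proper time of
a causal curve by the drop of `f` divided by `ε` (`mul_sqrt_le_neg_dfun`, `dist_le`). Hence a
chronological sequence along which `f` converges monotonically is timelike Cauchy and has a limit.
An integral curve of `U` therefore cannot stop at a finite parameter (`exists_gradCurve`). This
gives a global flow `Φ` with `f (Φ t x) = f x - t`, and in particular `f` is onto.

Growth of the flow. Put `N = ∇U`. Along the flow, a variation field `J = dΦ v` with `df v = 0`
satisfies `(|J|²)' = 2⟨NJ, J⟩` and, by the Riccati equation (`fderiv_coordHess_eq_coordCurvature`),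
`(|NJ|²)' = 2⟨R(U, J)U, NJ⟩`. The curvature constraint holds for `w` and for `-w`, so it is
two-sided: `|⟨R(U, v)U, w⟩| ≤ (a''/a) |v| |w|`. Comparing `(|J|, |NJ|)` with `(a, a')` yields `|J| ≤
a` whenever `|J| < a` and `|NJ| < a'` initially (`sqrt_conformal_flowDeriv_le`).

Drifting between leaves. Join two nearby points by a chart segment, run through it with parameter
speed `1/(2a)`, and carry each of its points by the flow to the level `f = -θ` at time `θ`. The
velocity is `U` plus an orthogonal vector of `ĝ`-length at most `a · 1/(2a) = 1/2`, so the curve is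
timelike (`futureTimelike_drift`). Since `∫ 1/a = ∞`, the segment is traversed in finite time
(`exists_time_change`). Neighbouring orbits thus enter each other's past (`exists_nhds_chron`), and
connectedness of `M` extends this to all pairs of orbits (`exists_chron`). This is omniscience.

Observer horizons. If `f⁻¹(0)` is compact, the time after which orbits starting there lie in the
future of a given `p` can be chosen uniformly (`exists_forall_chron`). By Cauchy completeness `f`
tends below every bound on a future-inextendible timelike curve (`exists_apply_lt`), so the curve
meets some orbit after that time. -/

set_option maxSynthPendingDepth 3

set_option linter.unusedSectionVars false

namespace Lorentz

/-! ### Lorentzian linear algebra: Cauchy–Schwarz inequalities and time cones. -/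

section LinearAlgebra

variable {V : Type*} [AddCommGroup V] [Module ℝ V] [TopologicalSpace V]
  {B : V →L[ℝ] V →L[ℝ] ℝ}

/-- Cauchy–Schwarz on the orthogonal complement of `u`, where `B` is positive definite. -/
lemma sq_le_mul_of_orthogonal (hB : ∀ x y, B x y = B y x) {u : V}
    (hpos : ∀ w, B u w = 0 → w ≠ 0 → 0 < B w w) {x y : V} (hx : B u x = 0) (hy : B u y = 0) :
    B x y ^ 2 ≤ B x x * B y y := by
  by_cases hy0 : y = 0
  · simp [hy0]
  have hyy := hpos y hy hy0
  -- The component of `x` orthogonal to `y`, scaled by `B y y` to avoid division; it still lies in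
  -- the complement of `u`.
  have hz : 0 ≤ B (B y y • x - B x y • y) (B y y • x - B x y • y) := by
    by_cases hz0 : B y y • x - B x y • y = 0
    · simp [hz0]
    · exact (hpos _ (by simp [hx, hy]) hz0).le
  have key : B (B y y • x - B x y • y) (B y y • x - B x y • y)
      = B y y * (B x x * B y y - B x y ^ 2) := by
    simp only [map_sub, map_smul, sub_apply, smul_apply,
      smul_eq_mul, hB y x]
    ring
  rw [key] at hz
  linarith [nonneg_of_mul_nonneg_right hz hyy]

lemma decomp_orthogonal {u : V} (hu : B u u < 0) (x : V) :
    B u (x - (B u x / B u u) • u) = 0 := by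
  simp only [map_sub, map_smul, smul_eq_mul]
  field_simp [hu.ne]
  ring

/-- The square of `x` in terms of its components along and orthogonal to the timelike `u`. -/
lemma apply_self_decomp (hB : ∀ x y, B x y = B y x) {u : V} (hu : B u u < 0) (x : V) :
    B (x - (B u x / B u u) • u) (x - (B u x / B u u) • u) = B x x - B u x ^ 2 / B u u := by
  simp only [map_sub, map_smul, sub_apply, smul_apply,
      smul_eq_mul, hB x u]
  field_simp [hu.ne]
  ring

lemma nonneg_of_orthogonal {u : V} (hpos : ∀ w, B u w = 0 → w ≠ 0 → 0 < B w w) {w : V}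
    (hw : B u w = 0) : 0 ≤ B w w := by
  by_cases h : w = 0
  · simp [h]
  · exact (hpos w hw h).le

/-- The reversed Cauchy–Schwarz inequality. -/
lemma mul_le_sq_of_timelike (hB : ∀ x y, B x y = B y x) {u : V} (hu : B u u < 0)
    (hpos : ∀ w, B u w = 0 → w ≠ 0 → 0 < B w w) (x : V) : B u u * B x x ≤ B u x ^ 2 := by
  have h := nonneg_of_orthogonal hpos (decomp_orthogonal hu x)
  rw [apply_self_decomp hB hu] at h
  have h2 := mul_nonneg_of_nonpos_of_nonpos hu.le (neg_nonpos.mpr h)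
  have : B u u * -(B x x - B u x ^ 2 / B u u) = B u x ^ 2 - B u u * B x x := by
    field_simp [hu.ne]; ring
  linarith

/-- Two timelike vectors `T`, `u` in the same cone see the same causal vectors as future
directed. -/
lemma apply_neg_iff_of_causal (hB : ∀ x y, B x y = B y x) {u T x : V} (hu : B u u < 0)
    (hpos : ∀ w, B u w = 0 → w ≠ 0 → 0 < B w w) (hT : B T T < 0) (hTu : B T u < 0)
    (hx : B x x ≤ 0) (hx0 : x ≠ 0) : B T x < 0 ↔ B u x < 0 := by
  set k := B u u with hk
  set T' := T - (B u T / k) • u with hT'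
  set x' := x - (B u x / k) • u with hx'
  have oT : B u T' = 0 := decomp_orthogonal hu T
  have ox : B u x' = 0 := decomp_orthogonal hu x
  have sT : B T' T' = B T T - B u T ^ 2 / k := apply_self_decomp hB hu T
  have sx : B x' x' = B x x - B u x ^ 2 / k := apply_self_decomp hB hu x
  have cs := sq_le_mul_of_orthogonal hB hpos oT ox
  have hTx : B T' x' = B T x - B u T * B u x / k := by
    simp only [hT', hx', map_sub, map_smul, sub_apply,
      smul_apply, smul_eq_mul, hB T u, ← hk]
    field_simp [hu.ne]; ring
  have hx'0 := nonneg_of_orthogonal hpos ox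
  have hT'0 := nonneg_of_orthogonal hpos oT
  have hux : B u x ≠ 0 := by
    intro h0
    have : 0 < B x x := hpos x h0 hx0
    linarith
  rw [hB T u] at hTu
  set p := B u T
  set q := B u x
  have hq2 : 0 < q ^ 2 := by positivity
  have hkk : 0 < -k := by linarith
  have h1 : B T' T' < p ^ 2 / (-k) := by rw [sT, div_neg]; linarith
  have h2 : B x' x' ≤ q ^ 2 / (-k) := by rw [sx, div_neg]; linarith
  -- The transverse part of `B T x` is strictly dominated by the part `p * q / k` along `u`,
  -- strictly because `T` is timelike. So `B T x` has the sign of `p * q / k`, which is that of `q`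
  -- since `p / k > 0`.
  have h3 : B T' x' ^ 2 < (p * q / k) ^ 2 := by
    calc B T' x' ^ 2 ≤ B T' T' * B x' x' := cs
      _ ≤ B T' T' * (q ^ 2 / (-k)) := by gcongr
      _ < p ^ 2 / (-k) * (q ^ 2 / (-k)) := by
        apply mul_lt_mul_of_pos_right h1; positivity
      _ = (p * q / k) ^ 2 := by field_simp
  have h4 := sq_lt_sq.mp h3
  have hsum : B T x = B T' x' + p * q / k := by rw [hTx]; ring
  rw [hsum]
  have hpk : 0 < p / k := div_pos_of_neg_of_neg hTu hu
  have hpq : p * q / k = p / k * q := by ring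
  constructor
  · intro h
    by_contra hq
    have hq' : 0 < q := lt_of_le_of_ne (not_lt.mp hq) (Ne.symm hux)
    have : 0 < p * q / k := by rw [hpq]; positivity
    rw [abs_of_pos this] at h4
    linarith [neg_abs_le (B T' x')]
  · intro hq
    have : p * q / k < 0 := by rw [hpq]; exact mul_neg_of_pos_of_neg hpk hq
    rw [abs_of_neg this] at h4
    linarith [le_abs_self (B T' x')]

/-- Positivity on the complement of one timelike vector passes to every timelike vector. -/
lemma pos_of_orthogonal_of_timelike (hB : ∀ x y, B x y = B y x) {v u : V} (hv : B v v < 0)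
    (hpos : ∀ w, B v w = 0 → w ≠ 0 → 0 < B w w) (hu : B u u < 0) {w : V} (hw : B u w = 0)
    (hw0 : w ≠ 0) : 0 < B w w := by
  by_contra hcon
  push Not at hcon
  have huv : B u v ≠ 0 := by
    intro h0
    have hu0 : u ≠ 0 := by rintro rfl; simp at hu
    have := hpos u (by rw [hB, h0]) hu0
    linarith
  rcases lt_or_gt_of_ne huv with h | h
  -- As `B u w = 0`, neither `w` nor `-w` is future-directed for `u`, hence neither is for `v`. This
  -- forces `w ⊥ v`, where `B` is positive.
  · have a := apply_neg_iff_of_causal hB hv hpos hu h hcon hw0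
    have b := apply_neg_iff_of_causal hB hv hpos hu h (x := -w) (by simpa using hcon)
      (by simpa using hw0)
    simp only [map_neg, hw, neg_zero, lt_irrefl, false_iff] at a b
    have hvw : B v w = 0 := by linarith
    linarith [hpos w hvw hw0]
  · have hv' : B (-v) (-v) < 0 := by simpa using hv
    have hpos' : ∀ w, B (-v) w = 0 → w ≠ 0 → 0 < B w w := fun w h => hpos w (by simpa using h)
    have h' : B u (-v) < 0 := by simpa using h
    have a := apply_neg_iff_of_causal hB hv' hpos' hu h' hcon hw0
    have b := apply_neg_iff_of_causal hB hv' hpos' hu h' (x := -w) (by simpa using hcon)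
      (by simpa using hw0)
    simp only [map_neg, hw, neg_zero, lt_irrefl, false_iff, neg_apply] at a b
    have hvw : B v w = 0 := by linarith
    linarith [hpos w hvw hw0]

lemma eq_zero_of_apply_eq_zero {u : V} (hB : ∀ x y, B x y = B y x)
    (hpos : ∀ w, B u w = 0 → w ≠ 0 → 0 < B w w) {x : V} (hx : ∀ y, B x y = 0) : x = 0 := by
  by_contra h0
  have := hpos x (by rw [hB, hx]) h0
  rw [hx] at this
  exact lt_irrefl _ this

end LinearAlgebra

lemma isInvertible_of_injective {E : Type*} [NormedAddCommGroup E] [NormedSpace ℝ E]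
    [FiniteDimensional ℝ E] {B : E →L[ℝ] E →L[ℝ] ℝ} (h : ∀ x, (∀ y, B x y = 0) → x = 0) :
    B.IsInvertible := by
  have hinj : Function.Injective (B : E →ₗ[ℝ] E →L[ℝ] ℝ) := by
    rw [injective_iff_map_eq_zero]
    intro x hx
    exact h x fun y => by
      have : B x = 0 := hx
      simp [this]
  have hfin : Module.finrank ℝ E = Module.finrank ℝ (E →L[ℝ] ℝ) := by
    rw [← (LinearMap.toContinuousLinearMap : (E →ₗ[ℝ] ℝ) ≃ₗ[ℝ] (E →L[ℝ] ℝ)).finrank_eq]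
    exact (Subspace.dual_finrank_eq).symm
  let e := LinearEquiv.ofInjectiveOfFinrankEq (B : E →ₗ[ℝ] E →L[ℝ] ℝ) hinj hfin
  exact ⟨e.toContinuousLinearEquiv, by ext x y; rfl⟩

end Lorentz

namespace Lorentz

/-! ### Hessian of an eikonal function and the Riccati equation, in coordinates. -/

section ChartGeometry

variable {E : Type*} [NormedAddCommGroup E] [NormedSpace ℝ E]

lemma minSmoothness_two_le_infty : minSmoothness ℝ 2 ≤ (∞ : WithTop ℕ∞) := by
  simp only [minSmoothness_of_isRCLikeNormedField]
  exact WithTop.coe_le_coe.2 (le_top : (2 : ℕ∞) ≤ ⊤)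

/-- The gradient of `F` in a coordinate domain with metric components `G`. -/
noncomputable def coordGrad (G : E → E →L[ℝ] E →L[ℝ] ℝ) (F : E → ℝ) (y : E) : E :=
  (G y).inverse (fderiv ℝ F y)

/-- The Christoffel symbols as a continuous bilinear map. -/
noncomputable def christoffelL (G : E → E →L[ℝ] E →L[ℝ] ℝ) (y : E) : E →L[ℝ] E →L[ℝ] E :=
  (ContinuousLinearMap.compL ℝ E (E →L[ℝ] ℝ) E (G y).inverse).comp ((1 / 2 : ℝ) •
    (fderiv ℝ G y + (fderiv ℝ G y).flip -
      ((ContinuousLinearMap.flipₗᵢ ℝ E E ℝ).toContinuousLinearEquiv :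
        (E →L[ℝ] E →L[ℝ] ℝ) →L[ℝ] (E →L[ℝ] E →L[ℝ] ℝ)).comp (fderiv ℝ G y).flip))

lemma christoffelL_apply (G : E → E →L[ℝ] E →L[ℝ] ℝ) (y u v : E) :
    christoffelL G y u v = christoffel G y u v := rfl

/-- The endomorphism `v ↦ ∇_v ∇F`. -/
noncomputable def coordHess (G : E → E →L[ℝ] E →L[ℝ] ℝ) (F : E → ℝ) (y : E) : E →L[ℝ] E :=
  fderiv ℝ (coordGrad G F) y + (christoffelL G y).flip (coordGrad G F y)

/-- Metric components `G` and a solution `F` of the timelike eikonal equation on an open set of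
coordinates. -/
structure IsEikonalOn (Ω : Set E) (G : E → E →L[ℝ] E →L[ℝ] ℝ) (F : E → ℝ) : Prop where
  isOpen : IsOpen Ω
  smooth : ContDiffOn ℝ ∞ G Ω
  smooth_fun : ContDiffOn ℝ ∞ F Ω
  symm : ∀ y ∈ Ω, ∀ u v, G y u v = G y v u
  isInvertible : ∀ y ∈ Ω, (G y).IsInvertible
  eikonal : ∀ y ∈ Ω, fderiv ℝ F y (coordGrad G F y) = -1

namespace IsEikonalOn

variable {Ω : Set E} {G : E → E →L[ℝ] E →L[ℝ] ℝ} {F : E → ℝ} {y : E}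

lemma apply_coordGrad (h : IsEikonalOn Ω G F) (hy : y ∈ Ω) :
    G y (coordGrad G F y) = fderiv ℝ F y :=
  (h.isInvertible y hy).self_apply_inverse _

lemma contDiffOn_inverse [CompleteSpace E] (h : IsEikonalOn Ω G F) :
    ContDiffOn ℝ ∞ (fun y => (G y).inverse) Ω := by
  intro y hy
  obtain ⟨e, he⟩ := h.isInvertible y hy
  have h1 : ContDiffAt ℝ ∞ ContinuousLinearMap.inverse (G y) := by
    rw [← he]; exact contDiffAt_map_inverse e
  exact h1.comp_contDiffWithinAt y (h.smooth y hy)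

lemma contDiffOn_fderiv (h : IsEikonalOn Ω G F) : ContDiffOn ℝ ∞ (fderiv ℝ F) Ω :=
  h.smooth_fun.fderiv_of_isOpen h.isOpen (by simp)

lemma contDiffOn_fderiv_metric (h : IsEikonalOn Ω G F) : ContDiffOn ℝ ∞ (fderiv ℝ G) Ω :=
  h.smooth.fderiv_of_isOpen h.isOpen (by simp)

lemma contDiffOn_coordGrad [CompleteSpace E] (h : IsEikonalOn Ω G F) :
    ContDiffOn ℝ ∞ (coordGrad G F) Ω :=
  h.contDiffOn_inverse.clm_apply h.contDiffOn_fderiv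

set_option synthInstance.maxHeartbeats 200000 in
lemma contDiffOn_christoffelL [CompleteSpace E] (h : IsEikonalOn Ω G F) :
    ContDiffOn ℝ ∞ (christoffelL G) Ω := by
  have h1 : ContDiffOn ℝ ∞ (fun y => (fderiv ℝ G y).flip) Ω :=
    (ContinuousLinearMap.flipₗᵢ ℝ E E (E →L[ℝ] ℝ)).contDiff.comp_contDiffOn
      h.contDiffOn_fderiv_metric
  have h2 : ContDiffOn ℝ ∞ (fun y => ContinuousLinearMap.compL ℝ E (E →L[ℝ] ℝ) E (G y).inverse) Ω :=
    (ContinuousLinearMap.compL ℝ E (E →L[ℝ] ℝ) E).contDiff.comp_contDiffOn h.contDiffOn_inverse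
  exact h2.clm_comp (((h.contDiffOn_fderiv_metric.add h1).sub
    (contDiffOn_const.clm_comp h1)).const_smul _)

lemma contDiffOn_coordHess [CompleteSpace E] (h : IsEikonalOn Ω G F) :
    ContDiffOn ℝ ∞ (coordHess G F) Ω := by
  have h1 : ContDiffOn ℝ ∞ (fun y => (christoffelL G y).flip) Ω :=
    (ContinuousLinearMap.flipₗᵢ ℝ E E E).contDiff.comp_contDiffOn
      h.contDiffOn_christoffelL
  exact (h.contDiffOn_coordGrad.fderiv_of_isOpen h.isOpen (by simp)).add
    (h1.clm_apply h.contDiffOn_coordGrad)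

lemma hasFDerivAt_of_contDiffOn {W : Type*} [NormedAddCommGroup W] [NormedSpace ℝ W] {φ : E → W}
    (hΩ : IsOpen Ω) (hφ : ContDiffOn ℝ ∞ φ Ω) (hy : y ∈ Ω) : HasFDerivAt φ (fderiv ℝ φ y) y :=
  ((hφ.contDiffAt (hΩ.mem_nhds hy)).differentiableAt (by simp)).hasFDerivAt

lemma apply_christoffel (h : IsEikonalOn Ω G F) (hy : y ∈ Ω) (u v w : E) :
    G y (christoffel G y u v) w =
      (1 / 2) * (fderiv ℝ G y u v w + fderiv ℝ G y v u w - fderiv ℝ G y w u v) := by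
  rw [christoffel, (h.isInvertible y hy).self_apply_inverse]
  simp

lemma fderiv_metric_symm (h : IsEikonalOn Ω G F) (hy : y ∈ Ω) (w u v : E) :
    fderiv ℝ G y w u v = fderiv ℝ G y w v u := by
  have hG := hasFDerivAt_of_contDiffOn h.isOpen h.smooth hy
  have h1 := (hG.clm_apply (hasFDerivAt_const u y)).clm_apply (hasFDerivAt_const v y)
  have h2 := (hG.clm_apply (hasFDerivAt_const v y)).clm_apply (hasFDerivAt_const u y)
  have heq : (fun z => G z u v) =ᶠ[𝓝 y] fun z => G z v u := by
    filter_upwards [h.isOpen.mem_nhds hy] with z hz using h.symm z hz u v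
  have := congrArg (fun L => L w) ((h1.congr_of_eventuallyEq heq.symm).unique h2)
  simpa using this

lemma eq_of_apply_eq (h : IsEikonalOn Ω G F) (hy : y ∈ Ω) {a b : E}
    (hab : ∀ w, G y a w = G y b w) : a = b := by
  have : G y a = G y b := by ext w; exact hab w
  rw [← (h.isInvertible y hy).inverse_apply_self a, this, (h.isInvertible y hy).inverse_apply_self]

lemma coordHess_apply (v : E) : coordHess G F y v =
    fderiv ℝ (coordGrad G F) y v + christoffel G y v (coordGrad G F y) := rfl

variable [CompleteSpace E]

/-- The closedness of `dF = G(∇F, ·)`. -/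
lemma fderiv_apply_coordGrad_symm (h : IsEikonalOn Ω G F) (hy : y ∈ Ω) (v w : E) :
    fderiv ℝ G y v (coordGrad G F y) w + G y (fderiv ℝ (coordGrad G F) y v) w =
      fderiv ℝ G y w (coordGrad G F y) v + G y (fderiv ℝ (coordGrad G F) y w) v := by
  have hG := hasFDerivAt_of_contDiffOn h.isOpen h.smooth hy
  have hU := hasFDerivAt_of_contDiffOn h.isOpen h.contDiffOn_coordGrad hy
  have hF := hasFDerivAt_of_contDiffOn h.isOpen h.contDiffOn_fderiv hy
  have heq : (fun z => G z (coordGrad G F z)) =ᶠ[𝓝 y] fderiv ℝ F := by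
    filter_upwards [h.isOpen.mem_nhds hy] with z hz using h.apply_coordGrad hz
  -- Differentiating `G (∇F, ·) = dF` produces the second derivative of `F`, whose symmetry is the
  -- claim.
  have key := ((hG.clm_apply hU).congr_of_eventuallyEq heq.symm).unique hF
  have hsymm : IsSymmSndFDerivAt ℝ F y :=
    (h.smooth_fun.contDiffAt (h.isOpen.mem_nhds hy)).isSymmSndFDerivAt minSmoothness_two_le_infty
  have e1 := congrArg (fun L => L v w) key
  have e2 := congrArg (fun L => L w v) key
  simp only [add_apply, ContinuousLinearMap.comp_apply,
    ContinuousLinearMap.flip_apply] at e1 e2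
  have e3 := hsymm.eq v w
  linarith

/-- Derivative of the constant function `G (∇F, ∇F) = -1`. -/
lemma fderiv_apply_coordGrad_self (h : IsEikonalOn Ω G F) (hy : y ∈ Ω) (v : E) :
    fderiv ℝ G y v (coordGrad G F y) (coordGrad G F y)
      + 2 * G y (fderiv ℝ (coordGrad G F) y v) (coordGrad G F y) = 0 := by
  have hG := hasFDerivAt_of_contDiffOn h.isOpen h.smooth hy
  have hU := hasFDerivAt_of_contDiffOn h.isOpen h.contDiffOn_coordGrad hy
  have heq : (fun z => G z (coordGrad G F z) (coordGrad G F z)) =ᶠ[𝓝 y] fun _ => -1 := by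
    filter_upwards [h.isOpen.mem_nhds hy] with z hz
    rw [h.apply_coordGrad hz, h.eikonal z hz]
  have key := (((hG.clm_apply hU).clm_apply hU).congr_of_eventuallyEq heq.symm).unique
    (hasFDerivAt_const (-1 : ℝ) y)
  have e1 := congrArg (fun L => L v) key
  simp only [add_apply, ContinuousLinearMap.comp_apply,
    ContinuousLinearMap.flip_apply, zero_apply] at e1
  rw [h.symm y hy (coordGrad G F y)] at e1
  linarith

/-- The Hessian is half the Lie derivative of the metric along the gradient. -/
lemma apply_coordHess (h : IsEikonalOn Ω G F) (hy : y ∈ Ω) (v w : E) :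
    2 * G y (coordHess G F y v) w = fderiv ℝ G y (coordGrad G F y) v w
      + G y (fderiv ℝ (coordGrad G F) y v) w + G y v (fderiv ℝ (coordGrad G F) y w) := by
  rw [coordHess_apply, map_add, add_apply, h.apply_christoffel hy]
  have e := h.fderiv_apply_coordGrad_symm hy v w
  rw [h.symm y hy v, h.fderiv_metric_symm hy w v]
  linarith

/-- The Lie derivative formula of `apply_coordHess` is symmetric in its two arguments. -/
lemma apply_coordHess_symm (h : IsEikonalOn Ω G F) (hy : y ∈ Ω) (v w : E) :
    G y (coordHess G F y v) w = G y (coordHess G F y w) v := by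
  have e1 := h.apply_coordHess hy v w
  have e2 := h.apply_coordHess hy w v
  rw [h.fderiv_metric_symm hy _ w v, h.symm y hy w] at e2
  rw [h.symm y hy v] at e1
  linarith

/-- In `G (Γ(v, U), U)` two of the three metric derivatives cancel, so the left side is half the
derivative of `G (U, U) = -1`. Hence the shape operator takes values in `U⊥`. -/
lemma apply_coordHess_coordGrad (h : IsEikonalOn Ω G F) (hy : y ∈ Ω) (v : E) :
    G y (coordHess G F y v) (coordGrad G F y) = 0 := by
  rw [coordHess_apply, map_add, add_apply, h.apply_christoffel hy]
  have e := h.fderiv_apply_coordGrad_self hy v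
  linarith

/-- The integral curves of the gradient are geodesics. -/
lemma coordHess_coordGrad (h : IsEikonalOn Ω G F) (hy : y ∈ Ω) :
    coordHess G F y (coordGrad G F y) = 0 := by
  refine h.eq_of_apply_eq hy fun w => ?_
  rw [h.apply_coordHess_symm hy, h.apply_coordHess_coordGrad hy]
  simp

/-- Product rule for the identity `N U = 0`. It trades a derivative of `N` applied to `U` for a term
of lower order, which the Riccati equation needs. -/
lemma fderiv_coordHess_coordGrad (h : IsEikonalOn Ω G F) (hy : y ∈ Ω) (v : E) :
    fderiv ℝ (coordHess G F) y v (coordGrad G F y)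
      + coordHess G F y (fderiv ℝ (coordGrad G F) y v) = 0 := by
  have hH := hasFDerivAt_of_contDiffOn h.isOpen h.contDiffOn_coordHess hy
  have hU := hasFDerivAt_of_contDiffOn h.isOpen h.contDiffOn_coordGrad hy
  have heq : (fun z => coordHess G F z (coordGrad G F z)) =ᶠ[𝓝 y] fun _ => 0 := by
    filter_upwards [h.isOpen.mem_nhds hy] with z hz using h.coordHess_coordGrad hz
  have key := ((hH.clm_apply hU).congr_of_eventuallyEq heq.symm).unique
    (hasFDerivAt_const (0 : E) y)
  have e1 := congrArg (fun L => L v) key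
  simp only [add_apply, ContinuousLinearMap.comp_apply,
    ContinuousLinearMap.flip_apply, zero_apply] at e1
  rw [add_comm]; exact e1

lemma fderiv_coordHess_apply (h : IsEikonalOn Ω G F) (hy : y ∈ Ω) (v w : E) :
    fderiv ℝ (coordHess G F) y v w = fderiv ℝ (fderiv ℝ (coordGrad G F)) y v w
      + fderiv ℝ (christoffelL G) y v w (coordGrad G F y)
      + christoffel G y w (fderiv ℝ (coordGrad G F) y v) := by
  have hU := hasFDerivAt_of_contDiffOn h.isOpen h.contDiffOn_coordGrad hy
  have hU' := hasFDerivAt_of_contDiffOn h.isOpen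
    (h.contDiffOn_coordGrad.fderiv_of_isOpen h.isOpen (m := ∞) (by simp)) hy
  have hΓ := hasFDerivAt_of_contDiffOn h.isOpen h.contDiffOn_christoffelL hy
  have hH := hasFDerivAt_of_contDiffOn h.isOpen h.contDiffOn_coordHess hy
  have h1 := (hU'.clm_apply (hasFDerivAt_const w y)).add
    ((hΓ.clm_apply (hasFDerivAt_const w y)).clm_apply hU)
  have h2 := hH.clm_apply (hasFDerivAt_const w y)
  have key := congrArg (fun L => L v) (h2.unique h1)
  simp only [add_apply, ContinuousLinearMap.comp_apply, ContinuousLinearMap.flip_apply,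
    zero_apply, map_zero, zero_add] at key
  rw [key, christoffelL_apply]
  abel

/-- The Riccati equation: `D_t (∇_J U) = R(U, J)U` in terms of coordinates. -/
lemma fderiv_coordHess_eq_coordCurvature (h : IsEikonalOn Ω G F) (hy : y ∈ Ω) (v : E) :
    fderiv ℝ (coordHess G F) y (coordGrad G F y) v
      + coordHess G F y (fderiv ℝ (coordGrad G F) y v)
      + christoffel G y (coordGrad G F y) (coordHess G F y v)
    = coordCurvature G y (coordGrad G F y) v (coordGrad G F y) := by
  set U := coordGrad G F y with hUdef
  have hΓ := hasFDerivAt_of_contDiffOn h.isOpen h.contDiffOn_christoffelL hy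
  have eΓ : ∀ a b c : E, fderiv ℝ (fun z => christoffel G z a b) y c
      = fderiv ℝ (christoffelL G) y c a b := by
    intro a b c
    have h1 := (hΓ.clm_apply (hasFDerivAt_const a y)).clm_apply (hasFDerivAt_const b y)
    have h2 : fderiv ℝ (fun z => christoffel G z a b) y = _ := h1.fderiv
    rw [h2]
    simp
  -- The derivatives `∂_U N v` and `∂_v N U` contain the same second derivative of `U` (`e4`), so
  -- their difference involves only Christoffel symbols and first derivatives of `U`. The second one
  -- is known from `N U = 0`, and the geodesic equation (`e6`) replaces the remaining `DU · U` by
  -- `-Γ(U, U)`.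
  have e1 := h.fderiv_coordHess_coordGrad hy v
  have e2 := h.fderiv_coordHess_apply hy U v
  have e3 := h.fderiv_coordHess_apply hy v U
  have hsymm : IsSymmSndFDerivAt ℝ (coordGrad G F) y :=
    (h.contDiffOn_coordGrad.contDiffAt (h.isOpen.mem_nhds hy)).isSymmSndFDerivAt minSmoothness_two_le_infty
  have e4 := hsymm.eq v U
  have e5 := h.coordHess_coordGrad hy
  rw [coordHess_apply] at e5
  rw [← hUdef] at e1 e2 e3 e5
  have e6 : fderiv ℝ (coordGrad G F) y U = - christoffel G y U U := eq_neg_of_add_eq_zero_left e5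
  have cΓ : christoffel G y v (-christoffel G y U U) = - christoffel G y v (christoffel G y U U) := by
    simp only [← christoffelL_apply, map_neg]
  have cΓ2 : christoffel G y U (coordHess G F y v) =
      christoffel G y U (fderiv ℝ (coordGrad G F) y v) + christoffel G y U (christoffel G y v U) := by
    rw [coordHess_apply]
    simp only [← christoffelL_apply, map_add]
    rfl
  rw [coordCurvature, eΓ, eΓ, e2, cΓ2, e6, cΓ]
  rw [e3, e4] at e1
  have e7 : coordHess G F y (fderiv ℝ (coordGrad G F) y v) = - (fderiv ℝ (fderiv ℝ (coordGrad G F)) y U v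
      + fderiv ℝ (christoffelL G) y v U U
      + christoffel G y U (fderiv ℝ (coordGrad G F) y v)) := eq_neg_of_add_eq_zero_right e1
  rw [e7]
  abel

variable {α j k : ℝ → E} {t : ℝ}

/-- The metric along two Jacobi fields of the gradient flow. -/
lemma hasDerivAt_metric (h : IsEikonalOn Ω G F) (hα : HasDerivAt α (coordGrad G F (α t)) t)
    (hy : α t ∈ Ω) (hj : HasDerivAt j (fderiv ℝ (coordGrad G F) (α t) (j t)) t)
    (hk : HasDerivAt k (fderiv ℝ (coordGrad G F) (α t) (k t)) t) :
    HasDerivAt (fun s => G (α s) (j s) (k s)) (2 * G (α t) (coordHess G F (α t) (j t)) (k t)) t := by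
  have hG := (hasFDerivAt_of_contDiffOn h.isOpen h.smooth hy).comp_hasDerivAt t hα
  refine ((hG.clm_apply hj).clm_apply hk).congr_deriv ?_
  rw [h.apply_coordHess hy]
  simp

/-- By metric compatibility the derivative of `|N j|²` is `2⟨D_t(N j), N j⟩`. The hypothesis on `j`
is the linearised flow equation, for which the Riccati equation reads `D_t(N j) = R(U, j)U`. -/
lemma hasDerivAt_coordHess (h : IsEikonalOn Ω G F) (hα : HasDerivAt α (coordGrad G F (α t)) t)
    (hy : α t ∈ Ω) (hj : HasDerivAt j (fderiv ℝ (coordGrad G F) (α t) (j t)) t) :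
    HasDerivAt (fun s => G (α s) (coordHess G F (α s) (j s)) (coordHess G F (α s) (j s)))
      (2 * G (α t) (coordCurvature G (α t) (coordGrad G F (α t)) (j t) (coordGrad G F (α t)))
        (coordHess G F (α t) (j t))) t := by
  have hG := (hasFDerivAt_of_contDiffOn h.isOpen h.smooth hy).comp_hasDerivAt t hα
  have hH := ((hasFDerivAt_of_contDiffOn h.isOpen h.contDiffOn_coordHess hy).comp_hasDerivAt t
    hα).clm_apply hj
  refine ((hG.clm_apply hH).clm_apply hH).congr_deriv ?_
  rw [← h.fderiv_coordHess_eq_coordCurvature hy]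
  simp only [Function.comp_apply, map_add, add_apply]
  set n := coordHess G F (α t) (j t)
  rw [h.apply_christoffel hy, h.symm _ hy n, h.symm _ hy n, h.fderiv_metric_symm hy n _ n]
  ring

end IsEikonalOn

end ChartGeometry

end Lorentz

namespace Lorentz

/-! ### Differentiable dependence of a local flow on its initial point. -/

section LocalFlow

variable {E : Type*} [NormedAddCommGroup E] [NormedSpace ℝ E]

/-- Gronwall's inequality forwards from `0`, and backwards after the reflection `t ↦ -t`. -/
lemma norm_le_of_norm_deriv_le {e e' : ℝ → E} {δ K η : ℝ}
    (he : ∀ t ∈ Ioo (-δ) δ, HasDerivAt e (e' t) t) (h0 : e 0 = 0)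
    (hb : ∀ t ∈ Ioo (-δ) δ, ‖e' t‖ ≤ K * ‖e t‖ + η) {t : ℝ} (ht : t ∈ Ioo (-δ) δ) :
    ‖e t‖ ≤ gronwallBound 0 K η |t| := by
  have main : ∀ (d d' : ℝ → E), (∀ t ∈ Ioo (-δ) δ, HasDerivAt d (d' t) t) → d 0 = 0 →
      (∀ t ∈ Ioo (-δ) δ, ‖d' t‖ ≤ K * ‖d t‖ + η) → ∀ t ∈ Ico 0 δ,
      ‖d t‖ ≤ gronwallBound 0 K η t := by
    intro d d' hd hd0 hdb t ht
    have hsub : ∀ s ∈ Icc 0 t, s ∈ Ioo (-δ) δ := fun s hs =>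
      ⟨by linarith [hs.1, ht.1, ht.2], lt_of_le_of_lt hs.2 ht.2⟩
    have := norm_le_gronwallBound_of_norm_deriv_right_le (a := 0) (b := t) (f := d) (f' := d')
      (δ := 0) (K := K) (ε := η) (fun s hs => (hd s (hsub s hs)).continuousAt.continuousWithinAt)
      (fun s hs => (hd s (hsub s ⟨hs.1, hs.2.le⟩)).hasDerivWithinAt) (by simp [hd0])
      (fun s hs => hdb s (hsub s ⟨hs.1, hs.2.le⟩)) t ⟨ht.1, le_rfl⟩
    simpa using this
  rcases le_total 0 t with h | h
  · rw [abs_of_nonneg h]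
    exact main e e' he h0 hb t ⟨h, ht.2⟩
  · rw [abs_of_nonpos h]
    have hneg : ∀ s ∈ Ioo (-δ) δ, -s ∈ Ioo (-δ) δ := fun s hs =>
      ⟨by linarith [hs.2], by linarith [hs.1]⟩
    have := main (fun s => e (-s)) (fun s => -e' (-s)) (fun s hs => by
      have h1 := (he (-s) (hneg s hs)).scomp s (hasDerivAt_neg s)
      simpa using! h1) (by simpa using h0) (fun s hs => by
      simpa using hb (-s) (hneg s hs)) (-t) ⟨by linarith, by linarith [ht.1]⟩
    simpa using this

/-- The local flow of a `C²` vector field is differentiable in the initial point, and its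
derivative solves the linearised equation. -/
lemma exists_local_flow [CompleteSpace E] {X : E → E} {Ω : Set E} (hΩ : IsOpen Ω)
    (hX : ContDiffOn ℝ ∞ X Ω) {y₀ : E} (hy₀ : y₀ ∈ Ω) :
    ∃ r > 0, ∃ δ > 0, ∃ (α : E → ℝ → E) (A : E → ℝ → E →L[ℝ] E),
      Metric.ball y₀ r ⊆ Ω ∧ ContinuousAt (fun z : E × ℝ => α z.1 z.2) (y₀, 0) ∧
      ∀ y ∈ Metric.ball y₀ r, α y 0 = y ∧ A y 0 = ContinuousLinearMap.id ℝ E ∧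
        ∀ t ∈ Ioo (-δ) δ, α y t ∈ Ω ∧ HasDerivAt (α y) (X (α y t)) t ∧
          HasDerivAt (A y) ((fderiv ℝ X (α y t)).comp (A y t)) t ∧
          HasFDerivAt (fun z => α z t) (A y t) y := by
  -- The field is coupled to its linearisation, so that one application of Picard–Lindelöf yields
  -- both the flow and the candidate for its space derivative.
  set Y : E × (E →L[ℝ] E) → E × (E →L[ℝ] E) := fun z => (X z.1, (fderiv ℝ X z.1).comp z.2) with hY
  have hX0 : ContDiffAt ℝ ∞ X y₀ := hX.contDiffAt (hΩ.mem_nhds hy₀)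
  have hX' : ContDiffOn ℝ ∞ (fderiv ℝ X) Ω := hX.fderiv_of_isOpen hΩ (by simp)
  have hX'0 : ContDiffAt ℝ ∞ (fderiv ℝ X) y₀ := hX'.contDiffAt (hΩ.mem_nhds hy₀)
  set z₀ : E × (E →L[ℝ] E) := (y₀, ContinuousLinearMap.id ℝ E) with hz₀
  have hYc : ContDiffAt ℝ 1 Y z₀ := by
    have h1 : ContDiffAt ℝ ∞ (fun z : E × (E →L[ℝ] E) => X z.1) z₀ :=
      ContDiffAt.comp z₀ (by exact hX0) contDiffAt_fst
    have h2 : ContDiffAt ℝ ∞ (fun z : E × (E →L[ℝ] E) => fderiv ℝ X z.1) z₀ :=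
      ContDiffAt.comp z₀ (by exact hX'0) contDiffAt_fst
    exact (h1.prodMk (h2.clm_comp contDiffAt_snd)).of_le (by simp)
  obtain ⟨ε, hε, a, r, Lc, K, hr, hpl⟩ := IsPicardLindelof.of_contDiffAt_one hYc
  obtain ⟨β, hβ, L', hL'⟩ :=
    (hpl 0).exists_forall_mem_closedBall_eq_hasDerivWithinAt_lipschitzOnWith
  -- a ball on which the derivative of `X` is bounded and Lipschitz
  obtain ⟨K₂, s, hs, hlip⟩ := (hX'0.of_le (m := 1) (by simp)).exists_lipschitzOnWith
  obtain ⟨ρ, hρ, hρs⟩ := Metric.mem_nhds_iff.mp (Filter.inter_mem hs (hΩ.mem_nhds hy₀))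
  have hB : ∀ z ∈ Metric.ball y₀ ρ, ‖fderiv ℝ X z‖ ≤ ‖fderiv ℝ X y₀‖ + K₂ * ρ := by
    intro z hz
    have h1 := hlip.dist_le_mul z (hρs hz).1 y₀ (hρs (Metric.mem_ball_self hρ)).1
    have h2 : K₂ * dist z y₀ ≤ K₂ * ρ := by gcongr; exact (Metric.mem_ball.mp hz).le
    have h3 : ‖fderiv ℝ X z‖ ≤ ‖fderiv ℝ X y₀‖ + ‖fderiv ℝ X z - fderiv ℝ X y₀‖ := by
      simpa using norm_add_le (fderiv ℝ X y₀) (fderiv ℝ X z - fderiv ℝ X y₀)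
    rw [dist_eq_norm] at h1
    linarith
  -- Taylor remainder of second order, from the Lipschitz bound on the derivative of `X` along the
  -- segment.
  have hrem : ∀ z ∈ Metric.ball y₀ ρ, ∀ w ∈ Metric.ball y₀ ρ,
      ‖X w - X z - fderiv ℝ X z (w - z)‖ ≤ K₂ * ‖w - z‖ ^ 2 := by
    intro z hz w hw
    have hseg : segment ℝ z w ⊆ Metric.ball y₀ ρ := (convex_ball y₀ ρ).segment_subset hz hw
    have := (convex_segment z w).norm_image_sub_le_of_norm_hasFDerivWithin_le' (𝕜 := ℝ)
      (f := X) (f' := fderiv ℝ X) (φ := fderiv ℝ X z) (C := K₂ * ‖w - z‖)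
      (fun x hx => (((hX x (hρs (hseg hx)).2).contDiffAt
        (hΩ.mem_nhds (hρs (hseg hx)).2)).differentiableAt (by simp)).hasFDerivAt.hasFDerivWithinAt)
      (fun x hx => by
        rw [← dist_eq_norm]
        refine (hlip.dist_le_mul x (hρs (hseg hx)).1 z (hρs hz).1).trans ?_
        gcongr
        rw [dist_eq_norm]
        obtain ⟨θ, hθ, rfl⟩ := (segment_eq_image' ℝ z w ▸ hx : x ∈ _)
        simp only [add_sub_cancel_left, norm_smul, Real.norm_eq_abs, abs_of_nonneg hθ.1]
        exact mul_le_of_le_one_left (norm_nonneg _) hθ.2)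
      (left_mem_segment ℝ z w) (right_mem_segment ℝ z w)
    calc _ ≤ _ := this
      _ = _ := by ring
  -- the flow stays in the ball for short times
  have hz₀r : z₀ ∈ Metric.closedBall z₀ (r : ℝ) := Metric.mem_closedBall_self r.2
  have hI : ∀ {t : ℝ}, t ∈ Ioo (-ε) ε → t ∈ Icc (0 - ε) (0 + ε) := fun ht =>
    ⟨by linarith [ht.1], by linarith [ht.2]⟩
  have hβd : ∀ z ∈ Metric.closedBall z₀ (r : ℝ), ∀ t ∈ Ioo (-ε) ε,
      HasDerivAt (β z) (Y (β z t)) t := fun z hz t ht =>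
    ((hβ z hz).2 t (hI ht)).hasDerivAt
      (Icc_mem_nhds (by linarith [ht.1]) (by linarith [ht.2]))
  have h00 : (0 : ℝ) ∈ Ioo (-ε) ε := ⟨by linarith, hε⟩
  have hcont := (hβd z₀ hz₀r 0 h00).continuousAt
  have hev := Metric.continuousAt_iff.mp hcont (ρ / 2) (by positivity)
  obtain ⟨δ₁, hδ₁, hδ₁'⟩ := hev
  rw [(hβ z₀ hz₀r).1] at hδ₁'
  set δ := min δ₁ ε with hδ
  have hδpos : 0 < δ := lt_min hδ₁ hε
  -- The last bound keeps nearby orbits within `ρ / 2` of the orbit of `y₀`, which itself stays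
  -- within `ρ / 2` of `y₀`. The `+ 1` guards against `L' = 0`.
  set r' := min (min (r : ℝ) ρ) (ρ / (2 * (L' + 1))) with hr'
  have hr'pos : 0 < r' := lt_min (lt_min hr hρ) (by positivity)
  have hmem : ∀ y ∈ Metric.ball y₀ r', (y, ContinuousLinearMap.id ℝ E) ∈
      Metric.closedBall z₀ (r : ℝ) := by
    intro y hy
    rw [Metric.mem_closedBall, hz₀, Prod.dist_eq]
    simp only [dist_self]
    refine max_le ?_ r.2
    exact (Metric.mem_ball.mp hy).le.trans ((min_le_left _ _).trans (min_le_left _ _))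
  have hIε : ∀ {t : ℝ}, t ∈ Ioo (-δ) δ → t ∈ Ioo (-ε) ε := fun ht =>
    ⟨by linarith [ht.1, min_le_right δ₁ ε], ht.2.trans_le (min_le_right _ _)⟩
  have hlipβ : ∀ y ∈ Metric.ball y₀ r', ∀ z ∈ Metric.ball y₀ r', ∀ t ∈ Ioo (-δ) δ,
      dist (β (y, ContinuousLinearMap.id ℝ E) t).1 (β (z, ContinuousLinearMap.id ℝ E) t).1
        ≤ L' * dist y z := by
    intro y hy z hz t ht
    have := (hL' t (hI (hIε ht))).dist_le_mul _ (hmem y hy) _ (hmem z hz)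
    have h2 : dist (y, ContinuousLinearMap.id ℝ E) (z, ContinuousLinearMap.id ℝ E) = dist y z := by
      rw [Prod.dist_eq]; simp
    rw [h2] at this
    exact (le_max_left _ _).trans (by rw [← Prod.dist_eq]; exact this)
  have hstay : ∀ y ∈ Metric.ball y₀ r', ∀ t ∈ Ioo (-δ) δ,
      (β (y, ContinuousLinearMap.id ℝ E) t).1 ∈ Metric.ball y₀ ρ := by
    intro y hy t ht
    have h1 := hlipβ y hy y₀ (Metric.mem_ball_self hr'pos) t ht
    have h2 : dist (β z₀ t) z₀ < ρ / 2 := hδ₁' (by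
      rw [Real.dist_eq, sub_zero, abs_lt]
      exact ⟨by linarith [ht.1, min_le_left δ₁ ε], ht.2.trans_le (min_le_left _ _)⟩)
    have h3 : dist (β z₀ t).1 y₀ < ρ / 2 := lt_of_le_of_lt (le_max_left _ _)
      (by rw [Prod.dist_eq] at h2; exact h2)
    have h4 : (L' : ℝ) * dist y y₀ ≤ ρ / 2 := by
      have : dist y y₀ ≤ ρ / (2 * (L' + 1)) := (Metric.mem_ball.mp hy).le.trans (min_le_right _ _)
      calc (L' : ℝ) * dist y y₀ ≤ (L' + 1) * (ρ / (2 * (L' + 1))) := by gcongr; linarith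
        _ = ρ / 2 := by field_simp
    rw [Metric.mem_ball]
    calc _ ≤ _ := dist_triangle _ (β z₀ t).1 _
      _ < ρ := by linarith
  have hjoint : ContinuousAt (fun z : E × ℝ => (β (z.1, ContinuousLinearMap.id ℝ E) z.2).1)
      (y₀, 0) := by
    have hfst : (β z₀ 0).1 = y₀ := congrArg Prod.fst (hβ z₀ hz₀r).1
    rw [ContinuousAt, tendsto_iff_dist_tendsto_zero]
    simp only [← hz₀, hfst]
    have hg : ContinuousAt (fun z : E × ℝ => L' * dist z.1 y₀ + dist (β z₀ z.2).1 y₀) (y₀, 0) := by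
      have h1 : ContinuousAt (fun z : E × ℝ => (β z₀ z.2).1) (y₀, 0) :=
        continuousAt_fst.comp (ContinuousAt.comp (f := Prod.snd) (x := (y₀, (0 : ℝ))) hcont
          continuousAt_snd)
      exact (continuousAt_const.mul (continuousAt_fst.dist continuousAt_const)).add
        (h1.dist continuousAt_const)
    have hg0 : Tendsto (fun z : E × ℝ => L' * dist z.1 y₀ + dist (β z₀ z.2).1 y₀) (𝓝 (y₀, 0))
        (𝓝 0) := by
      have := hg.tendsto
      simpa [hfst] using this
    refine squeeze_zero' (Eventually.of_forall fun z => dist_nonneg) ?_ hg0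
    filter_upwards [prod_mem_nhds (Metric.ball_mem_nhds y₀ hr'pos)
      (Ioo_mem_nhds (neg_lt_zero.mpr hδpos) hδpos)] with z hz
    exact (dist_triangle _ (β z₀ z.2).1 _).trans
      (by gcongr; exact hlipβ _ hz.1 _ (Metric.mem_ball_self hr'pos) _ hz.2)
  refine ⟨r', hr'pos, δ, hδpos, fun y t => (β (y, ContinuousLinearMap.id ℝ E) t).1,
    fun y t => (β (y, ContinuousLinearMap.id ℝ E) t).2,
    fun y hy => (hρs (Metric.ball_subset_ball ((min_le_left _ _).trans (min_le_right _ _)) hy)).2, hjoint,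
    fun y hy => ⟨congrArg Prod.fst (hβ _ (hmem y hy)).1,
      congrArg Prod.snd (hβ _ (hmem y hy)).1, fun t ht => ?_⟩⟩
  have hd1 : ∀ y ∈ Metric.ball y₀ r', ∀ t ∈ Ioo (-δ) δ,
      HasDerivAt (fun t => (β (y, ContinuousLinearMap.id ℝ E) t).1)
        (X (β (y, ContinuousLinearMap.id ℝ E) t).1) t := fun y hy t ht =>
    (hasFDerivAt_fst (p := β (y, ContinuousLinearMap.id ℝ E) t)).comp_hasDerivAt t
      (hβd _ (hmem y hy) t (hIε ht))
  have hd2 : ∀ y ∈ Metric.ball y₀ r', ∀ t ∈ Ioo (-δ) δ,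
      HasDerivAt (fun t => (β (y, ContinuousLinearMap.id ℝ E) t).2)
        ((fderiv ℝ X (β (y, ContinuousLinearMap.id ℝ E) t).1).comp
          (β (y, ContinuousLinearMap.id ℝ E) t).2) t := fun y hy t ht =>
    (hasFDerivAt_snd (p := β (y, ContinuousLinearMap.id ℝ E) t)).comp_hasDerivAt t
      (hβd _ (hmem y hy) t (hIε ht))
  refine ⟨(hρs (hstay y hy t ht)).2, hd1 y hy t ht, hd2 y hy t ht, ?_⟩
  set Kb := ‖fderiv ℝ X y₀‖ + K₂ * ρ with hKb
  have hKb0 : 0 ≤ Kb := by positivity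
  -- quadratic error estimate
  have hquad : ∀ z ∈ Metric.ball y₀ r',
      ‖(β (z, ContinuousLinearMap.id ℝ E) t).1 - (β (y, ContinuousLinearMap.id ℝ E) t).1
        - (β (y, ContinuousLinearMap.id ℝ E) t).2 (z - y)‖
      ≤ gronwallBound 0 Kb (K₂ * L' ^ 2) |t| * ‖z - y‖ ^ 2 := by
    intro z hz
    -- The error of the linear approximation solves the linearised equation up to the Taylor
    -- remainder, which is at most `K₂ (L' ‖z - y‖)²` by the Lipschitz bound on the flow.
    have h := norm_le_of_norm_deriv_le (δ := δ) (K := Kb) (η := K₂ * (L' * ‖z - y‖) ^ 2)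
      (e := fun t => (β (z, ContinuousLinearMap.id ℝ E) t).1
        - (β (y, ContinuousLinearMap.id ℝ E) t).1
        - (β (y, ContinuousLinearMap.id ℝ E) t).2 (z - y))
      (fun t ht => ((hd1 z hz t ht).sub (hd1 y hy t ht)).sub
        ((hd2 y hy t ht).clm_apply (hasDerivAt_const t (z - y))))
      (by simp [(hβ _ (hmem y hy)).1, (hβ _ (hmem z hz)).1])
      (fun t ht => by
        set p := (β (z, ContinuousLinearMap.id ℝ E) t).1
        set q := (β (y, ContinuousLinearMap.id ℝ E) t).1
        set A := (β (y, ContinuousLinearMap.id ℝ E) t).2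
        have e1 := hrem q (hstay y hy t ht) p (hstay z hz t ht)
        have e2 := hB q (hstay y hy t ht)
        have e3 := hlipβ z hz y hy t ht
        rw [dist_eq_norm, dist_eq_norm] at e3
        have e4 : X p - X q - (((fderiv ℝ X q).comp A) (z - y) + A 0) =
            (X p - X q - fderiv ℝ X q (p - q)) + fderiv ℝ X q (p - q - A (z - y)) := by
          simp only [map_sub, map_zero, ContinuousLinearMap.comp_apply]; abel
        rw [e4]
        calc _ ≤ ‖X p - X q - fderiv ℝ X q (p - q)‖ + ‖fderiv ℝ X q (p - q - A (z - y))‖ :=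
              norm_add_le _ _
          _ ≤ K₂ * ‖p - q‖ ^ 2 + Kb * ‖p - q - A (z - y)‖ := by
              gcongr
              exact (ContinuousLinearMap.le_opNorm _ _).trans (by gcongr)
          _ ≤ K₂ * (L' * ‖z - y‖) ^ 2 + Kb * ‖p - q - A (z - y)‖ := by gcongr
          _ = _ := by ring) ht
    -- With zero initial value `gronwallBound` is linear in its inhomogeneity, so `‖z - y‖²` factors
    -- out. The case `Kb = 0` has its own formula.
    refine h.trans (le_of_eq ?_)
    by_cases hK0 : Kb = 0
    · simp only [hK0, gronwallBound_K0]; ring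
    · simp only [gronwallBound_of_K_ne_0 hK0]; ring
  rw [hasFDerivAt_iff_isLittleO]
  have hO : (fun z => (β (z, ContinuousLinearMap.id ℝ E) t).1
      - (β (y, ContinuousLinearMap.id ℝ E) t).1
      - (β (y, ContinuousLinearMap.id ℝ E) t).2 (z - y)) =O[𝓝 y] fun z => ‖z - y‖ ^ 2 := by
    refine Asymptotics.IsBigO.of_bound (gronwallBound 0 Kb (K₂ * L' ^ 2) |t|) ?_
    filter_upwards [Metric.isOpen_ball.mem_nhds hy] with z hz
    simpa using hquad z hz
  refine hO.trans_isLittleO ?_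
  have h1 : (fun z => ‖z - y‖ ^ 2) = fun z => ‖z - y‖ * ‖z - y‖ := by ext; ring
  rw [h1]
  have h2 : Tendsto (fun z => ‖z - y‖) (𝓝 y) (𝓝 0) := by
    have : Continuous fun z : E => ‖z - y‖ := by fun_prop
    simpa using this.tendsto y
  have h3 : (fun z : E => ‖z - y‖) =o[𝓝 y] fun _ => (1 : ℝ) := (Asymptotics.isLittleO_one_iff ℝ).mpr h2
  have := h3.mul_isBigO (Asymptotics.isBigO_refl (fun z : E => ‖z - y‖) (𝓝 y))
  simpa using this.norm_right
end LocalFlow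

end Lorentz

namespace Lorentz

/-! ### Translation between the manifold and its charts, with tangent spaces identified with `E`. -/

section Coordinates

variable {E : Type*} [NormedAddCommGroup E] [NormedSpace ℝ E]
  {M : Type*} [TopologicalSpace M] [ChartedSpace E M]

/-- The derivative at `x` of the chart at `p`, as an endomorphism of the model space. -/
noncomputable def chartDeriv (p x : M) : E →L[ℝ] E :=
  mfderiv 𝓘(ℝ, E) 𝓘(ℝ, E) (extChartAt 𝓘(ℝ, E) p) x

/-- The derivative at `y` of the inverse of the chart at `p`. -/
noncomputable def chartSymmDeriv (p : M) (y : E) : E →L[ℝ] E :=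
  mfderiv 𝓘(ℝ, E) 𝓘(ℝ, E) (extChartAt 𝓘(ℝ, E) p).symm y

/-- A tensor field with the tangent spaces identified with the model space. -/
def TensorField.at (g : TensorField E M) (x : M) : E →L[ℝ] E →L[ℝ] ℝ := g x

/-- The gradient, with the tangent spaces identified with the model space. -/
noncomputable def gradE (g : TensorField E M) (f : M → ℝ) (x : M) : E := grad g f x

/-- The differential of a function, with the tangent spaces identified with the model space. -/
noncomputable def dfun (f : M → ℝ) (x : M) : E →L[ℝ] ℝ := mvfderiv 𝓘(ℝ, E) f x

/-- The curve `γ` has velocity `v` at `t`. -/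
def HasVelocityAt (γ : ℝ → M) (v : E) (t : ℝ) : Prop :=
  HasMFDerivAt 𝓘(ℝ, ℝ) 𝓘(ℝ, E) γ t ((1 : ℝ →L[ℝ] ℝ).smulRight v)

lemma coordMetric_apply (g : TensorField E M) (p : M) (y u v : E) :
    coordMetric g p y u v = g.at ((extChartAt 𝓘(ℝ, E) p).symm y)
      (chartSymmDeriv p y u) (chartSymmDeriv p y v) := rfl

lemma isOpen_target (p : M) : IsOpen (extChartAt 𝓘(ℝ, E) p).target :=
  isOpen_extChartAt_target p

lemma HasVelocityAt.continuousAt {γ : ℝ → M} {v : E} {t : ℝ} (h : HasVelocityAt γ v t) :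
    ContinuousAt γ t := HasMFDerivAt.continuousAt h

variable [IsManifold 𝓘(ℝ, E) ∞ M]

lemma chartDeriv_chartSymmDeriv (p : M) {y : E} (hy : y ∈ (extChartAt 𝓘(ℝ, E) p).target) (v : E) :
    chartDeriv p ((extChartAt 𝓘(ℝ, E) p).symm y) (chartSymmDeriv p y v) = v := by
  have := mfderiv_extChartAt_comp_mfderivWithin_extChartAt_symm (I := 𝓘(ℝ, E)) hy
  rw [ModelWithCorners.Boundaryless.range_eq_univ, mfderivWithin_univ] at this
  exact congrArg (fun L : E →L[ℝ] E => L v) this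

lemma chartSymmDeriv_chartDeriv (p : M) {x : M} (hx : x ∈ (extChartAt 𝓘(ℝ, E) p).source) (v : E) :
    chartSymmDeriv p (extChartAt 𝓘(ℝ, E) p x) (chartDeriv p x v) = v := by
  have := mfderivWithin_extChartAt_symm_comp_mfderiv_extChartAt' (I := 𝓘(ℝ, E)) hx
  rw [ModelWithCorners.Boundaryless.range_eq_univ, mfderivWithin_univ] at this
  exact congrArg (fun L : E →L[ℝ] E => L v) this

lemma chartDeriv_chartSymmDeriv' (p : M) {x : M} (hx : x ∈ (extChartAt 𝓘(ℝ, E) p).source) (v : E) :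
    chartDeriv p x (chartSymmDeriv p (extChartAt 𝓘(ℝ, E) p x) v) = v := by
  have := chartDeriv_chartSymmDeriv p ((extChartAt 𝓘(ℝ, E) p).map_source hx) v
  rwa [(extChartAt 𝓘(ℝ, E) p).left_inv hx] at this

lemma coordMetric_chartDeriv (g : TensorField E M) (p : M) {x : M}
    (hx : x ∈ (extChartAt 𝓘(ℝ, E) p).source) (u v : E) :
    coordMetric g p (extChartAt 𝓘(ℝ, E) p x) (chartDeriv p x u) (chartDeriv p x v) = g.at x u v := by
  rw [coordMetric_apply, chartSymmDeriv_chartDeriv p hx, chartSymmDeriv_chartDeriv p hx,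
    (extChartAt 𝓘(ℝ, E) p).left_inv hx]

lemma hasMFDerivAt_extChartAt_source (p : M) {x : M} (hx : x ∈ (extChartAt 𝓘(ℝ, E) p).source) :
    HasMFDerivAt 𝓘(ℝ, E) 𝓘(ℝ, E) (extChartAt 𝓘(ℝ, E) p) x
      (chartDeriv (E := E) p x) :=
  (mdifferentiableAt_extChartAt (by rwa [extChartAt_source] at hx)).hasMFDerivAt

lemma hasMFDerivAt_extChartAt_symm (p : M) {y : E} (hy : y ∈ (extChartAt 𝓘(ℝ, E) p).target) :
    HasMFDerivAt 𝓘(ℝ, E) 𝓘(ℝ, E) (extChartAt 𝓘(ℝ, E) p).symm y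
      (chartSymmDeriv (E := E) p y) := by
  have := mdifferentiableWithinAt_extChartAt_symm (I := 𝓘(ℝ, E)) hy
  rw [ModelWithCorners.Boundaryless.range_eq_univ, mdifferentiableWithinAt_univ] at this
  exact this.hasMFDerivAt

/-- The velocity in the chart at `p`. -/
lemma HasVelocityAt.hasDerivAt {γ : ℝ → M} {v : E} {t : ℝ} (h : HasVelocityAt γ v t) (p : M)
    (hp : γ t ∈ (extChartAt 𝓘(ℝ, E) p).source) :
    HasDerivAt (fun s => extChartAt 𝓘(ℝ, E) p (γ s)) (chartDeriv p (γ t) v) t := by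
  have h1 := (hasMFDerivAt_extChartAt_source p hp).comp t h
  have h2 : HasFDerivAt (fun s => extChartAt 𝓘(ℝ, E) p (γ s))
    ((chartDeriv p (γ t)).comp ((1 : ℝ →L[ℝ] ℝ).smulRight v)) t := h1.hasFDerivAt
  refine h2.hasDerivAt.congr_deriv ?_
  change chartDeriv p (γ t) ((1 : ℝ) • v) = _
  rw [one_smul]

/-- A curve given in the chart at `p`. -/
lemma hasVelocityAt_symm_comp {α : ℝ → E} {w : E} {t : ℝ} (p : M)
    (hp : α t ∈ (extChartAt 𝓘(ℝ, E) p).target) (h : HasDerivAt α w t) :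
    HasVelocityAt (fun s => (extChartAt 𝓘(ℝ, E) p).symm (α s)) (chartSymmDeriv p (α t) w) t := by
  have h1 := (hasMFDerivAt_extChartAt_symm p hp).comp t h.hasFDerivAt.hasMFDerivAt
  have h2 : ((1 : ℝ →L[ℝ] ℝ).smulRight (chartSymmDeriv p (α t) w))
      = (chartSymmDeriv p (α t)).comp (ContinuousLinearMap.toSpanSingleton ℝ w) := by
    ext; simp
  exact h1.congr_mfderiv h2.symm

variable {f : M → ℝ}

lemma hasMFDerivAt_dfun (hf : ContMDiff 𝓘(ℝ, E) 𝓘(ℝ, ℝ) ∞ f) (x : M) :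
    HasMFDerivAt 𝓘(ℝ, E) 𝓘(ℝ, ℝ) f x (dfun (E := E) f x) :=
  ((hf x).mdifferentiableAt (by simp)).hasMFDerivAt

/-- The coordinate expression of the differential of a function. -/
lemma hasFDerivAt_comp_symm (hf : ContMDiff 𝓘(ℝ, E) 𝓘(ℝ, ℝ) ∞ f) (p : M) {y : E}
    (hy : y ∈ (extChartAt 𝓘(ℝ, E) p).target) :
    HasFDerivAt (fun z => f ((extChartAt 𝓘(ℝ, E) p).symm z))
      ((dfun f ((extChartAt 𝓘(ℝ, E) p).symm y)).comp (chartSymmDeriv p y)) y :=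
  ((hasMFDerivAt_dfun hf _).comp y (hasMFDerivAt_extChartAt_symm p hy)).hasFDerivAt

lemma fderiv_comp_symm_chartDeriv (hf : ContMDiff 𝓘(ℝ, E) 𝓘(ℝ, ℝ) ∞ f) (p : M) {x : M}
    (hx : x ∈ (extChartAt 𝓘(ℝ, E) p).source) (v : E) :
    fderiv ℝ (fun z => f ((extChartAt 𝓘(ℝ, E) p).symm z)) (extChartAt 𝓘(ℝ, E) p x)
      (chartDeriv p x v) = dfun f x v := by
  rw [(hasFDerivAt_comp_symm hf p ((extChartAt 𝓘(ℝ, E) p).map_source hx)).fderiv,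
    ContinuousLinearMap.comp_apply, chartSymmDeriv_chartDeriv p hx,
    (extChartAt 𝓘(ℝ, E) p).left_inv hx]

lemma HasVelocityAt.comp_function (hf : ContMDiff 𝓘(ℝ, E) 𝓘(ℝ, ℝ) ∞ f) {γ : ℝ → M} {v : E} {t : ℝ}
    (h : HasVelocityAt γ v t) : HasDerivAt (fun s => f (γ s)) (dfun f (γ t) v) t := by
  have h1 : HasFDerivAt (fun s => f (γ s)) ((dfun f (γ t)).comp ((1 : ℝ →L[ℝ] ℝ).smulRight v)) t :=
    ((hasMFDerivAt_dfun hf (γ t)).comp t h).hasFDerivAt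
  refine h1.hasDerivAt.congr_deriv ?_
  change dfun f (γ t) ((1 : ℝ) • v) = _
  rw [one_smul]

lemma contDiffOn_comp_symm (hf : ContMDiff 𝓘(ℝ, E) 𝓘(ℝ, ℝ) ∞ f) (p : M) :
    ContDiffOn ℝ ∞ (fun z => f ((extChartAt 𝓘(ℝ, E) p).symm z)) (extChartAt 𝓘(ℝ, E) p).target := by
  rw [← contMDiffOn_iff_contDiffOn]
  exact hf.comp_contMDiffOn (contMDiffOn_extChartAt_symm p)

/-- The tangent map of the inverse chart is smooth. Applied to constant `X` it gives the coordinate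
frame, in which a smooth tensor has smooth components. -/
lemma contMDiffOn_chartSymmDeriv (p : M) {X : E → E}
    (hX : ContDiffOn ℝ ∞ X (extChartAt 𝓘(ℝ, E) p).target) :
    ContMDiffOn 𝓘(ℝ, E) 𝓘(ℝ, E).tangent ∞
      (fun y => (⟨(extChartAt 𝓘(ℝ, E) p).symm y, chartSymmDeriv p y (X y)⟩ :
        TangentBundle 𝓘(ℝ, E) M)) (extChartAt 𝓘(ℝ, E) p).target := by
  have h1 := (contMDiffOn_extChartAt_symm (I := 𝓘(ℝ, E)) (n := ∞) p).contMDiffOn_tangentMapWithin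
    (m := ∞) (by simp) (isOpen_target p).uniqueMDiffOn
  have h2 : ContMDiffOn 𝓘(ℝ, E) 𝓘(ℝ, E).tangent ∞
      (fun y => (⟨y, X y⟩ : TangentBundle 𝓘(ℝ, E) E)) (extChartAt 𝓘(ℝ, E) p).target :=
    contMDiffOn_vectorSpace_iff_contDiffOn.mpr hX
  refine (h1.comp h2 (fun y hy => hy)).congr fun y hy => ?_
  simp only [Function.comp, tangentMapWithin]
  rw [mfderivWithin_of_isOpen (isOpen_target p) hy]
  rfl

/-- A smooth tensor field has smooth components. -/
lemma contDiffOn_coordMetric [FiniteDimensional ℝ E] {g : TensorField E M}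
    (hg : ContMDiff 𝓘(ℝ, E) (𝓘(ℝ, E).prod 𝓘(ℝ, E →L[ℝ] E →L[ℝ] ℝ)) ∞
    (fun x => Bundle.TotalSpace.mk' (E →L[ℝ] E →L[ℝ] ℝ)
      (E := fun x : M => TangentSpace 𝓘(ℝ, E) x →L[ℝ] TangentSpace 𝓘(ℝ, E) x →L[ℝ] ℝ) x (g x)))
    (p : M) : ContDiffOn ℝ ∞ (coordMetric g p) (extChartAt 𝓘(ℝ, E) p).target := by
  rw [contDiffOn_clm_apply]
  intro u
  rw [contDiffOn_clm_apply]
  intro v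
  have h1 := hg.comp_contMDiffOn (contMDiffOn_extChartAt_symm (I := 𝓘(ℝ, E)) (n := ∞) p)
  have hu := contMDiffOn_chartSymmDeriv p (X := fun _ => u) contDiffOn_const
  have hv := contMDiffOn_chartSymmDeriv p (X := fun _ => v) contDiffOn_const
  have h2 := ContMDiffOn.clm_bundle_apply₂ (F₁ := E) (F₂ := E) (F₃ := ℝ)
    (E₁ := fun x : M => TangentSpace 𝓘(ℝ, E) x) (E₂ := fun x : M => TangentSpace 𝓘(ℝ, E) x)
    (E₃ := Bundle.Trivial M ℝ)
    (b := (extChartAt 𝓘(ℝ, E) p).symm) (ψ := fun y => g ((extChartAt 𝓘(ℝ, E) p).symm y))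
    (v := fun y => chartSymmDeriv p y u) (w := fun y => chartSymmDeriv p y v) h1 hu hv
  intro y hy
  have h3 := h2 y hy
  rw [Bundle.contMDiffWithinAt_totalSpace] at h3
  exact h3.2.contDiffWithinAt

end Coordinates

end Lorentz

namespace Lorentz

/-! ### The gradient in charts, the conformal metric and the time orientation. -/

section General

variable {E : Type*} [NormedAddCommGroup E] [NormedSpace ℝ E]
  {M : Type*} [TopologicalSpace M] [ChartedSpace E M] [IsManifold 𝓘(ℝ, E) ∞ M]
  {g : TensorField E M} {f : M → ℝ}

lemma tangentBundle_mk_eq {x x' : M} (h : x = x') {v v' : E} (hv : v = v') :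
    (⟨x, v⟩ : TangentBundle 𝓘(ℝ, E) M) = ⟨x', v'⟩ := by
  subst h hv
  rfl

lemma at_gradE {x : M} (h : (g.at x).IsInvertible) : g.at x (gradE g f x) = dfun f x :=
  h.self_apply_inverse (dfun f x)

lemma gradE_eq {x : M} (h : (g.at x).IsInvertible) {u : E} (hu : ∀ w, g.at x u w = dfun f x w) :
    gradE g f x = u :=
  (h.inverse_apply_eq (y := dfun f x)).mpr (ContinuousLinearMap.ext fun w => (hu w).symm)

lemma isInvertible_coordMetric [FiniteDimensional ℝ E] (p : M) {y : E}
    (hy : y ∈ (extChartAt 𝓘(ℝ, E) p).target)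
    (h : (g.at ((extChartAt 𝓘(ℝ, E) p).symm y)).IsInvertible) :
    (coordMetric g p y).IsInvertible := by
  refine isInvertible_of_injective fun u hu => ?_
  have h1 : g.at ((extChartAt 𝓘(ℝ, E) p).symm y) (chartSymmDeriv p y u) = 0 := by
    ext w
    have := hu (chartDeriv p ((extChartAt 𝓘(ℝ, E) p).symm y) w)
    rw [coordMetric_apply] at this
    have e := chartSymmDeriv_chartDeriv p ((extChartAt 𝓘(ℝ, E) p).map_target hy) w
    rw [(extChartAt 𝓘(ℝ, E) p).right_inv hy] at e
    rw [e] at this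
    simpa using this
  have h2 : chartSymmDeriv p y u = 0 := by
    rw [← h.inverse_apply_self (chartSymmDeriv p y u), h1, map_zero]
  rw [← chartDeriv_chartSymmDeriv p hy u, h2, map_zero]

/-- Both vectors represent the differential of `f` through the same nondegenerate metric. -/
lemma coordGrad_coordMetric [FiniteDimensional ℝ E] (hf : ContMDiff 𝓘(ℝ, E) 𝓘(ℝ, ℝ) ∞ f) (p : M)
    {x : M} (hx : x ∈ (extChartAt 𝓘(ℝ, E) p).source) (h : (g.at x).IsInvertible) :
    coordGrad (coordMetric g p) (fun z => f ((extChartAt 𝓘(ℝ, E) p).symm z))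
      (extChartAt 𝓘(ℝ, E) p x) = chartDeriv p x (gradE g f x) := by
  have hy := (extChartAt 𝓘(ℝ, E) p).map_source hx
  have hi := isInvertible_coordMetric (g := g) p hy (by rwa [(extChartAt 𝓘(ℝ, E) p).left_inv hx])
  refine hi.inverse_apply_eq.mpr (ContinuousLinearMap.ext fun w => ?_)
  have e := chartDeriv_chartSymmDeriv' p hx w
  rw [← e, coordMetric_chartDeriv g p hx, fderiv_comp_symm_chartDeriv hf p hx, at_gradE h]

end General

namespace Spacetime

variable {E : Type*} [NormedAddCommGroup E] [NormedSpace ℝ E] [FiniteDimensional ℝ E]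
  {M : Type*} [TopologicalSpace M] [ChartedSpace E M] [IsManifold 𝓘(ℝ, E) ∞ M]
  {S : Spacetime E M} {f : M → ℝ}

lemma at_symm (S : Spacetime E M) (x : M) (v w : E) : S.g.at x v w = S.g.at x w v := S.symm x v w

lemma isInvertible_at (S : Spacetime E M) (x : M) : (S.g.at x).IsInvertible := by
  obtain ⟨v, hv, hpos⟩ := S.signature x
  exact isInvertible_of_injective fun u hu =>
    eq_zero_of_apply_eq_zero (B := S.g.at x) (u := v) (S.at_symm x) hpos hu

lemma at_gradE_apply (S : Spacetime E M) (f : M → ℝ) (x : M) (v : E) :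
    S.g.at x (gradE S.g f x) v = dfun f x v := by
  rw [at_gradE (S.isInvertible_at x)]

lemma gradSq_eq (S : Spacetime E M) (f : M → ℝ) (x : M) :
    gradSq S.g f x = dfun f x (gradE S.g f x) :=
  S.at_gradE_apply f x (gradE S.g f x)

/-- The kernel of `df` is the orthogonal complement of the timelike vector `∇f`, hence spacelike. -/
lemma at_pos (hf : S.IsTemporal f) (x : M) {w : E} (hw : dfun f x w = 0) (hw0 : w ≠ 0) :
    0 < S.g.at x w w := by
  obtain ⟨v, hv, hpos⟩ := S.signature x
  exact pos_of_orthogonal_of_timelike (B := S.g.at x) (S.at_symm x) hv hpos (u := gradE S.g f x)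
    (hf.2 x) (by rw [S.at_gradE_apply, hw]) hw0

lemma at_pos' (hf : S.IsTemporal f) (x : M) (w : E) (hw : S.g.at x (gradE S.g f x) w = 0)
    (hw0 : w ≠ 0) : 0 < S.g.at x w w :=
  at_pos hf x (by rwa [S.at_gradE_apply] at hw) hw0

lemma ne_zero_of_apply_T_neg {x : M} {v : E} (h : S.g.at x (S.T x) v < 0) : v ≠ 0 := by
  rintro rfl
  simp at h

/-- The time orientation in terms of the temporal function. -/
lemma apply_T_neg_iff (hf : S.IsTemporal f) (hfut : ∀ x, S.FutureTimelike x (grad S.g f x)) {x : M}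
    {v : E} (hv : S.g.at x v v ≤ 0) (hv0 : v ≠ 0) : S.g.at x (S.T x) v < 0 ↔ dfun f x v < 0 := by
  rw [← S.at_gradE_apply f x v]
  exact apply_neg_iff_of_causal (B := S.g.at x) (S.at_symm x) (hf.2 x) (at_pos' hf x)
    (S.T_timelike x) (hfut x).2 hv hv0

lemma futureTimelike_iff (hf : S.IsTemporal f) (hfut : ∀ x, S.FutureTimelike x (grad S.g f x))
    {x : M} {v : E} : S.FutureTimelike x v ↔ S.g.at x v v < 0 ∧ dfun f x v < 0 := by
  constructor
  · rintro ⟨h1, h2⟩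
    exact ⟨h1, (apply_T_neg_iff hf hfut (le_of_lt h1) (ne_zero_of_apply_T_neg h2)).mp h2⟩
  · rintro ⟨h1, h2⟩
    refine ⟨h1, (apply_T_neg_iff hf hfut h1.le ?_).mpr h2⟩
    rintro rfl
    simp at h2

/-- Causal curves decrease `f` at least at the rate `ε` per unit of proper time. -/
lemma mul_sqrt_le_neg_dfun (hf : S.IsTemporal f) (hfut : ∀ x, S.FutureTimelike x (grad S.g f x))
    {ε : ℝ} (hε : 0 < ε) (hgrad : ∀ x, ε ≤ √|gradSq S.g f x|) {x : M} {v : E}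
    (hv : S.FutureCausal x v) : ε * √(-S.g.at x v v) ≤ -dfun f x v := by
  have h2 := (apply_T_neg_iff hf hfut hv.1 (ne_zero_of_apply_T_neg hv.2)).mp hv.2
  have h1 : S.g.at x v v ≤ 0 := hv.1
  -- Reversed Cauchy–Schwarz against `∇f`: `|∇f|² |v|² ≤ (df v)²`.
  have h3 := mul_le_sq_of_timelike (B := S.g.at x) (u := gradE S.g f x)
    (S.at_symm x) (hf.2 x) (at_pos' hf x) v
  rw [S.at_gradE_apply f x v] at h3
  have h4 : ε ^ 2 ≤ -S.g.at x (gradE S.g f x) (gradE S.g f x) := by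
    have h5 : ε ^ 2 ≤ √|gradSq S.g f x| ^ 2 := by gcongr; exact hgrad x
    rw [Real.sq_sqrt (abs_nonneg _), abs_of_neg (hf.2 x)] at h5
    exact h5
  refine le_of_sq_le_sq ?_ (by linarith)
  rw [mul_pow, Real.sq_sqrt (by linarith)]
  nlinarith

/-- The conformal factor `-g(∇f, ∇f)`. -/
noncomputable def factor (S : Spacetime E M) (f : M → ℝ) (x : M) : ℝ := -gradSq S.g f x

lemma factor_pos (hf : S.IsTemporal f) (x : M) : 0 < S.factor f x := neg_pos.mpr (hf.2 x)

lemma conformal_at (x : M) (v w : E) :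
    (conformal S.g f).at x v w = S.factor f x * S.g.at x v w := rfl

lemma isInvertible_conformal (hf : S.IsTemporal f) (x : M) :
    ((conformal S.g f).at x).IsInvertible := by
  refine isInvertible_of_injective fun u hu => ?_
  have : ∀ y, S.g.at x u y = 0 := fun y => by
    have := hu y
    rw [conformal_at] at this
    exact (mul_eq_zero.mp this).resolve_left (factor_pos hf x).ne'
  exact eq_zero_of_apply_eq_zero (B := S.g.at x) (u := gradE S.g f x) (S.at_symm x) (at_pos' hf x) this

lemma gradE_conformal (hf : S.IsTemporal f) (x : M) :
    gradE (conformal S.g f) f x = (S.factor f x)⁻¹ • gradE S.g f x := by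
  refine gradE_eq (isInvertible_conformal hf x) fun w => ?_
  rw [conformal_at, map_smul, smul_apply, S.at_gradE_apply, smul_eq_mul,
    mul_inv_cancel_left₀ (factor_pos hf x).ne']

/-- Scaling the metric by `-g(∇f, ∇f)` divides the gradient by the same factor. This is the eikonal
equation for `ĝ`, and it makes flow time equal to the drop of `f`. -/
lemma dfun_gradE_conformal (hf : S.IsTemporal f) (x : M) :
    dfun f x (gradE (conformal S.g f) f x) = -1 := by
  rw [gradE_conformal hf, map_smul, ← S.gradSq_eq, smul_eq_mul]
  have := factor_pos hf x
  rw [show gradSq S.g f x = - S.factor f x by simp [factor]]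
  field_simp

lemma conformal_at_gradE (hf : S.IsTemporal f) (x : M) :
    (conformal S.g f).at x (gradE (conformal S.g f) f x) = dfun f x :=
  at_gradE (isInvertible_conformal hf x)

lemma conformal_symm (x : M) (v w : E) :
    (conformal S.g f).at x v w = (conformal S.g f).at x w v := by
  rw [conformal_at, conformal_at, S.at_symm]

lemma conformal_pos (hf : S.IsTemporal f) (x : M) {w : E} (hw : dfun f x w = 0) (hw0 : w ≠ 0) :
    0 < (conformal S.g f).at x w w := by
  rw [conformal_at]
  exact mul_pos (factor_pos hf x) (at_pos hf x hw hw0)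

lemma conformal_neg_iff (hf : S.IsTemporal f) (x : M) {w : E} :
    (conformal S.g f).at x w w < 0 ↔ S.g.at x w w < 0 := by
  rw [conformal_at]
  exact ⟨fun h => by nlinarith [factor_pos hf x], fun h => mul_neg_of_pos_of_neg (factor_pos hf x) h⟩

lemma contDiffOn_factor (hf : S.IsTemporal f) (p : M) :
    ContDiffOn ℝ ∞ (fun y => S.factor f ((extChartAt 𝓘(ℝ, E) p).symm y))
      (extChartAt 𝓘(ℝ, E) p).target := by
  have hG := contDiffOn_coordMetric S.smooth p
  have hF := contDiffOn_comp_symm hf.1 p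
  have hF' := hF.fderiv_of_isOpen (isOpen_target p) (m := ∞) (by simp)
  have hinv : ContDiffOn ℝ ∞ (fun y => (coordMetric S.g p y).inverse)
      (extChartAt 𝓘(ℝ, E) p).target := by
    intro y hy
    obtain ⟨e, he⟩ := isInvertible_coordMetric (g := S.g) p hy (S.isInvertible_at _)
    have h1 : ContDiffAt ℝ ∞ ContinuousLinearMap.inverse (coordMetric S.g p y) := by
      rw [← he]; exact contDiffAt_map_inverse e
    exact h1.comp_contDiffWithinAt y (hG y hy)
  refine ((hF'.clm_apply (hinv.clm_apply hF')).neg).congr fun y hy => ?_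
  have hx := (extChartAt 𝓘(ℝ, E) p).map_target hy
  have e := coordGrad_coordMetric (g := S.g) hf.1 p hx (S.isInvertible_at _)
  rw [(extChartAt 𝓘(ℝ, E) p).right_inv hy] at e
  have e2 := fderiv_comp_symm_chartDeriv hf.1 p hx (gradE S.g f ((extChartAt 𝓘(ℝ, E) p).symm y))
  rw [← e, (extChartAt 𝓘(ℝ, E) p).right_inv hy] at e2
  rw [factor, S.gradSq_eq, ← e2]
  rfl

lemma coordMetric_conformal (p : M) (y : E) : coordMetric (conformal S.g f) p y =
    S.factor f ((extChartAt 𝓘(ℝ, E) p).symm y) • coordMetric S.g p y := by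
  ext u v
  rw [smul_apply, smul_apply, coordMetric_apply, coordMetric_apply, conformal_at, smul_eq_mul]

lemma contDiffOn_coordMetric_conformal (hf : S.IsTemporal f) (p : M) :
    ContDiffOn ℝ ∞ (coordMetric (conformal S.g f) p) (extChartAt 𝓘(ℝ, E) p).target :=
  ((contDiffOn_factor hf p).smul (contDiffOn_coordMetric S.smooth p)).congr
    fun y _ => coordMetric_conformal p y

/-- The conformal metric and `f` in the chart at `p`. -/
lemma isEikonalOn (hf : S.IsTemporal f) (p : M) :
    IsEikonalOn (extChartAt 𝓘(ℝ, E) p).target (coordMetric (conformal S.g f) p)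
      (fun z => f ((extChartAt 𝓘(ℝ, E) p).symm z)) where
  isOpen := isOpen_target p
  smooth := contDiffOn_coordMetric_conformal hf p
  smooth_fun := contDiffOn_comp_symm hf.1 p
  symm y _ u v := by rw [coordMetric_apply, coordMetric_apply, conformal_symm]
  isInvertible y hy := isInvertible_coordMetric p hy (isInvertible_conformal hf _)
  eikonal y hy := by
    have hx := (extChartAt 𝓘(ℝ, E) p).map_target hy
    have e := coordGrad_coordMetric (g := conformal S.g f) hf.1 p hx (isInvertible_conformal hf _)
    have e2 := fderiv_comp_symm_chartDeriv hf.1 p hx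
      (gradE (conformal S.g f) f ((extChartAt 𝓘(ℝ, E) p).symm y))
    rw [← e, (extChartAt 𝓘(ℝ, E) p).right_inv hy] at e2
    rw [e2, dfun_gradE_conformal hf]

/-- The unit gradient field is smooth. -/
lemma contMDiff_gradE_conformal (hf : S.IsTemporal f) :
    ContMDiff 𝓘(ℝ, E) 𝓘(ℝ, E).tangent ∞
      (fun x => (⟨x, gradE (E := E) (M := M) (conformal S.g f) f x⟩ : TangentBundle 𝓘(ℝ, E) M)) := by
  intro p
  have hp := mem_extChartAt_source (I := 𝓘(ℝ, E)) p
  have h1 := contMDiffOn_chartSymmDeriv p (isEikonalOn hf p).contDiffOn_coordGrad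
  have h2 := (h1.comp (contMDiffOn_extChartAt (I := 𝓘(ℝ, E)) (n := ∞) (x := p))
    (fun x hx => (extChartAt 𝓘(ℝ, E) p).map_source (by rwa [extChartAt_source]))).contMDiffAt
    ((chartAt E p).open_source.mem_nhds (mem_chart_source E p))
  refine h2.congr_of_eventuallyEq ?_
  filter_upwards [(isOpen_extChartAt_source (I := 𝓘(ℝ, E)) p).mem_nhds hp] with x hx
  refine tangentBundle_mk_eq ((extChartAt 𝓘(ℝ, E) p).left_inv hx).symm ?_
  rw [coordGrad_coordMetric hf.1 p hx (isInvertible_conformal hf _),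
    chartSymmDeriv_chartDeriv p hx]

end Spacetime

end Lorentz

namespace Lorentz

/-! ### Concatenation of piecewise smooth curves and coordinate segments. -/

section Piecewise

variable {E : Type*} [NormedAddCommGroup E] [NormedSpace ℝ E]
  {M : Type*} [TopologicalSpace M] [ChartedSpace E M]
  {P : (x : M) → TangentSpace 𝓘(ℝ, E) x → Prop}

lemma prop_mfderivWithin_congr {γ γ' : ℝ → M} {s : Set ℝ} {t : ℝ} (ht : t ∈ s)
    (h : ∀ r ∈ s, γ' r = γ r) (hP : P (γ t) (mfderivWithin 𝓘(ℝ, ℝ) 𝓘(ℝ, E) γ s t (1 : ℝ))) :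
    P (γ' t) (mfderivWithin 𝓘(ℝ, ℝ) 𝓘(ℝ, E) γ' s t (1 : ℝ)) := by
  -- The two velocities live in tangent spaces at base points that are only propositionally equal. A
  -- predicate on `E` removes the dependency.
  have key : ∀ (Q : M → E → Prop) (L L' : ℝ →L[ℝ] E), L' = L → Q (γ t) (L 1) → Q (γ' t) (L' 1) := by
    rintro Q L L' rfl hQ
    rwa [h t ht]
  exact key P (mfderivWithin 𝓘(ℝ, ℝ) 𝓘(ℝ, E) γ s t) (mfderivWithin 𝓘(ℝ, ℝ) 𝓘(ℝ, E) γ' s t)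
    (mfderivWithin_congr h (h t ht)) hP

lemma strictMonoOn_nodes {N : ℕ} {τ : ℕ → ℝ} (h : ∀ i < N, τ i < τ (i + 1)) {i j : ℕ} (hij : i ≤ j)
    (hj : j ≤ N) : τ i ≤ τ j := by
  induction j, hij using Nat.le_induction with
  | base => exact le_rfl
  | succ k hk ih => exact (ih (by omega)).trans (h k (by omega)).le

lemma prop_mfderivWithin_shift {γ : ℝ → M} {a b k : ℝ} (hab : a < b)
    (hγ : ContMDiffOn 𝓘(ℝ, ℝ) 𝓘(ℝ, E) ∞ γ (Icc a b))
    (hP : ∀ t ∈ Icc a b, P (γ t) (mfderivWithin 𝓘(ℝ, ℝ) 𝓘(ℝ, E) γ (Icc a b) t (1 : ℝ))) :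
    ContMDiffOn 𝓘(ℝ, ℝ) 𝓘(ℝ, E) ∞ (fun t => γ (t + k)) (Icc (a - k) (b - k)) ∧
    ∀ t ∈ Icc (a - k) (b - k), P (γ (t + k))
      (mfderivWithin 𝓘(ℝ, ℝ) 𝓘(ℝ, E) (fun t => γ (t + k)) (Icc (a - k) (b - k)) t (1 : ℝ)) := by
  have hmaps : MapsTo (fun t : ℝ => t + k) (Icc (a - k) (b - k)) (Icc a b) := fun t ht =>
    ⟨by linarith [ht.1], by linarith [ht.2]⟩
  have hsm : ContMDiff 𝓘(ℝ, ℝ) 𝓘(ℝ, ℝ) ∞ (fun t : ℝ => t + k) := by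
    rw [contMDiff_iff_contDiff]; fun_prop
  refine ⟨hγ.comp hsm.contMDiffOn hmaps, fun t ht => ?_⟩
  have h1 := ((hγ _ (hmaps ht)).mdifferentiableWithinAt (by simp)).hasMFDerivWithinAt
  have h2 : HasMFDerivWithinAt 𝓘(ℝ, ℝ) 𝓘(ℝ, ℝ) (fun t : ℝ => t + k) (Icc (a - k) (b - k)) t
      (ContinuousLinearMap.id ℝ ℝ) :=
    ((hasFDerivAt_id t).add_const k).hasMFDerivAt.hasMFDerivWithinAt
  have h3 := (HasMFDerivWithinAt.comp (g := γ) (f := fun t => t + k) t h1 h2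
    (fun r hr => hmaps hr)).mfderivWithin
    ((uniqueDiffOn_Icc (by linarith)).uniqueMDiffOn t ht)
  have key : ∀ (Q : M → E → Prop) (L L' : ℝ →L[ℝ] E), L' = L.comp (ContinuousLinearMap.id ℝ ℝ) →
      Q (γ (t + k)) (L 1) → Q (γ (t + k)) (L' 1) := by
    rintro Q L L' rfl hQ
    simpa using hQ
  exact key P (mfderivWithin 𝓘(ℝ, ℝ) 𝓘(ℝ, E) γ (Icc a b) (t + k)) _ h3 (hP _ (hmaps ht))

/-- The second curve is translated in time by `c - b` to start at `b`, and its nodes are appended to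
those of the first. -/
lemma IsPiecewiseSmooth.trans {γ₁ γ₂ : ℝ → M} {a b c d : ℝ} (h₁ : IsPiecewiseSmooth P γ₁ a b)
    (h₂ : IsPiecewiseSmooth P γ₂ c d) (h : γ₁ b = γ₂ c) :
    ∃ (γ : ℝ → M) (e : ℝ), IsPiecewiseSmooth P γ a e ∧ γ a = γ₁ a ∧ γ e = γ₂ d := by
  obtain ⟨hab, N₁, τ₁, h10, h1N, h1⟩ := h₁
  obtain ⟨hcd, N₂, τ₂, h20, h2N, h2⟩ := h₂
  set γ : ℝ → M := fun t => if t ≤ b then γ₁ t else γ₂ (t + (c - b)) with hγ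
  have hleft : ∀ t ≤ b, γ t = γ₁ t := fun t ht => by simp [hγ, ht]
  have hright : ∀ t, b ≤ t → γ t = γ₂ (t + (c - b)) := by
    intro t ht
    rcases ht.eq_or_lt with rfl | ht
    · simp [hγ, h]
    · simp [hγ, not_le.mpr ht]
  refine ⟨γ, d - (c - b), ⟨by linarith, N₁ + N₂,
    fun i => if i ≤ N₁ then τ₁ i else τ₂ (i - N₁) - (c - b), by simp [h10], ?_, ?_⟩,
    hleft a hab.le, by rw [hright _ (by linarith)]; congr 1; ring⟩
  -- If `N₂` were `0`, the last node would be taken from `τ₁`; this is excluded by `c < d`.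
  · by_cases hN : N₂ = 0
    · subst hN
      rw [h20] at h2N
      exact absurd h2N hcd.ne
    · simp only [show ¬ (N₁ + N₂ ≤ N₁) by omega, if_false, Nat.add_sub_cancel_left, h2N]
  · intro i hi
    by_cases hi1 : i < N₁
    · simp only [show i ≤ N₁ by omega, show i + 1 ≤ N₁ by omega, if_true]
      obtain ⟨e1, e2, e3⟩ := h1 i hi1
      have hle : τ₁ (i + 1) ≤ b := by
        rw [← h1N]; exact strictMonoOn_nodes (fun i hi => (h1 i hi).1) (by omega) le_rfl
      have hEq : ∀ t ∈ Icc (τ₁ i) (τ₁ (i + 1)), γ t = γ₁ t := fun t ht => hleft t (ht.2.trans hle)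
      exact ⟨e1, e2.congr hEq, fun t ht => prop_mfderivWithin_congr ht hEq (e3 t ht)⟩
    -- At the junction `j = N₁` both branches give `b`, so the second formula is valid there as
    -- well.
    · have hτ : ∀ j, N₁ ≤ j → (if j ≤ N₁ then τ₁ j else τ₂ (j - N₁) - (c - b))
          = τ₂ (j - N₁) - (c - b) := by
        intro j hj
        rcases hj.eq_or_lt with rfl | hj
        · simp [h1N, h20]
        · simp [show ¬ j ≤ N₁ by omega]
      simp only [hτ i (by omega), hτ (i + 1) (by omega)]
      rw [show i + 1 - N₁ = i - N₁ + 1 by omega]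
      obtain ⟨e1, e2, e3⟩ := h2 (i - N₁) (by omega)
      have hge : c ≤ τ₂ (i - N₁) := by
        rw [← h20]; exact strictMonoOn_nodes (fun i hi => (h2 i hi).1) (by omega) (by omega)
      obtain ⟨e4, e5⟩ := prop_mfderivWithin_shift (k := c - b) e1 e2 e3
      have hEq : ∀ t ∈ Icc (τ₂ (i - N₁) - (c - b)) (τ₂ (i - N₁ + 1) - (c - b)),
          γ t = γ₂ (t + (c - b)) := fun t ht => hright t (by linarith [ht.1])
      exact ⟨by linarith, e4.congr hEq, fun t ht => prop_mfderivWithin_congr ht hEq (e5 t ht)⟩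

/-- A coordinate line segment. -/
lemma isPiecewiseSmooth_segment [IsManifold 𝓘(ℝ, E) ∞ M] (p : M) {y w : E} {s : ℝ} (hs : 0 < s)
    (h : ∀ t ∈ Icc 0 s, y + t • w ∈ (extChartAt 𝓘(ℝ, E) p).target ∧
      P ((extChartAt 𝓘(ℝ, E) p).symm (y + t • w)) (chartSymmDeriv (E := E) p (y + t • w) w)) :
    IsPiecewiseSmooth P (fun t => (extChartAt 𝓘(ℝ, E) p).symm (y + t • w)) 0 s := by
  refine ⟨hs, 1, fun i => i * s, by simp, by simp, fun i hi => ?_⟩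
  obtain rfl : i = 0 := by omega
  simp only [Nat.cast_zero, zero_mul, zero_add, Nat.cast_one, one_mul]
  refine ⟨hs, ?_, fun t ht => ?_⟩
  · refine (contMDiffOn_extChartAt_symm (I := 𝓘(ℝ, E)) (n := ∞) p).comp (t := _) (s := Icc 0 s) ?_
      fun t ht => (h t ht).1
    rw [contMDiffOn_iff_contDiffOn]
    fun_prop
  · have hd : HasDerivAt (fun t : ℝ => y + t • w) w t := by
      simpa using ((hasDerivAt_id t).smul_const w).const_add y
    have h1 : HasMFDerivAt 𝓘(ℝ, ℝ) 𝓘(ℝ, E) (fun t => (extChartAt 𝓘(ℝ, E) p).symm (y + t • w)) t _ :=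
      hasVelocityAt_symm_comp p (h t ht).1 hd
    have h2 := h1.hasMFDerivWithinAt (s := Icc 0 s) |>.mfderivWithin
      ((uniqueDiffOn_Icc hs).uniqueMDiffOn t ht)
    have key : ∀ (Q : M → E → Prop) (L : ℝ →L[ℝ] E) (v : E) (x : M),
        L = (1 : ℝ →L[ℝ] ℝ).smulRight v → Q x v → Q x (L 1) := by
      rintro Q L v x rfl hQ
      simpa using hQ
    exact key P _ _ _ h2 (h t ht).2

end Piecewise

/-! ### The chronological relation along curves that are merely differentiable. -/

namespace Spacetime

variable {E : Type*} [NormedAddCommGroup E] [NormedSpace ℝ E] [FiniteDimensional ℝ E]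
  {M : Type*} [TopologicalSpace M] [ChartedSpace E M] [IsManifold 𝓘(ℝ, E) ∞ M]
  {S : Spacetime E M} {f : M → ℝ}

lemma Chron.trans {p q r : M} (h₁ : S.Chron p q) (h₂ : S.Chron q r) : S.Chron p r := by
  obtain ⟨γ₁, a, b, hγ₁, rfl, rfl⟩ := h₁
  obtain ⟨γ₂, c, d, hγ₂, hc, rfl⟩ := h₂
  obtain ⟨γ, e, hγ, h1, h2⟩ := hγ₁.trans hγ₂ hc.symm
  exact ⟨γ, a, e, hγ, h1, h2⟩

/-- Near a point with a future timelike vector, coordinate segments of nearby directions are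
timelike. -/
lemma exists_chron_of_direction (hf : S.IsTemporal f)
    (hfut : ∀ x, S.FutureTimelike x (grad S.g f x)) (q : M) {v : E} (hv : S.FutureTimelike q v) :
    ∃ r > 0, ∀ y ∈ Metric.ball (extChartAt 𝓘(ℝ, E) q q) r,
      ∀ z ∈ Metric.ball (extChartAt 𝓘(ℝ, E) q q) r, ∀ s > (0 : ℝ),
      s⁻¹ • (z - y) ∈ Metric.ball (chartDeriv q q v) r →
      S.Chron ((extChartAt 𝓘(ℝ, E) q).symm y) ((extChartAt 𝓘(ℝ, E) q).symm z) := by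
  set y₀ := extChartAt 𝓘(ℝ, E) q q
  set w₀ := chartDeriv q q v
  have hq := mem_extChartAt_source (I := 𝓘(ℝ, E)) q
  have hy₀ : y₀ ∈ (extChartAt 𝓘(ℝ, E) q).target := mem_extChartAt_target q
  have hG : ContinuousAt (coordMetric S.g q) y₀ :=
    (contDiffOn_coordMetric S.smooth q).continuousOn.continuousAt ((isOpen_target q).mem_nhds hy₀)
  have hF : ContinuousAt (fderiv ℝ fun z => f ((extChartAt 𝓘(ℝ, E) q).symm z)) y₀ :=
    ((contDiffOn_comp_symm hf.1 q).fderiv_of_isOpen (isOpen_target q)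
      (m := ∞) (by simp)).continuousOn.continuousAt ((isOpen_target q).mem_nhds hy₀)
  obtain ⟨hv1, hv2⟩ := (futureTimelike_iff hf hfut).mp hv
  have c1 : ContinuousAt (fun z : E × E => coordMetric S.g q z.1 z.2 z.2) (y₀, w₀) := by
    have : ContinuousAt (fun z : E × E => coordMetric S.g q z.1) (y₀, w₀) :=
      ContinuousAt.comp (g := coordMetric S.g q) (f := Prod.fst) (by exact hG) continuousAt_fst
    exact (this.clm_apply continuousAt_snd).clm_apply continuousAt_snd
  have c2 : ContinuousAt (fun z : E × E =>
      fderiv ℝ (fun z => f ((extChartAt 𝓘(ℝ, E) q).symm z)) z.1 z.2) (y₀, w₀) := by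
    have : ContinuousAt (fun z : E × E => fderiv ℝ (fun z => f ((extChartAt 𝓘(ℝ, E) q).symm z)) z.1)
        (y₀, w₀) :=
      ContinuousAt.comp (g := fderiv ℝ (fun z => f ((extChartAt 𝓘(ℝ, E) q).symm z))) (f := Prod.fst)
        (by exact hF) continuousAt_fst
    exact this.clm_apply continuousAt_snd
  have e1 : coordMetric S.g q y₀ w₀ w₀ < 0 := by
    rw [coordMetric_chartDeriv S.g q hq]; exact hv1
  have e2 : fderiv ℝ (fun z => f ((extChartAt 𝓘(ℝ, E) q).symm z)) y₀ w₀ < 0 := by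
    rw [fderiv_comp_symm_chartDeriv hf.1 q hq]; exact hv2
  have c3 : ∀ᶠ z : E × E in 𝓝 (y₀, w₀), z.1 ∈ (extChartAt 𝓘(ℝ, E) q).target :=
    continuousAt_fst.preimage_mem_nhds ((isOpen_target q).mem_nhds hy₀)
  -- Being future timelike is an open condition on the pair of base point and direction, so one
  -- radius serves for both. By convexity of the ball it then holds along the whole segment from `y`
  -- to `z`.
  obtain ⟨r, hr, hball⟩ := Metric.eventually_nhds_iff.mp
    ((c1.eventually (gt_mem_nhds e1)).and ((c2.eventually (gt_mem_nhds e2)).and c3))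
  refine ⟨r, hr, fun y hy z hz s hs hw => ?_⟩
  set w := s⁻¹ • (z - y)
  have hz' : z = y + s • w := by simp [w, hs.ne']
  refine ⟨fun t => (extChartAt 𝓘(ℝ, E) q).symm (y + t • w), 0, s,
    isPiecewiseSmooth_segment q hs fun t ht => ?_, by simp, by simp only [hz']⟩
  have hmem : y + t • w ∈ Metric.ball y₀ r := by
    have : y + t • w = AffineMap.lineMap y z (t / s) := by
      rw [AffineMap.lineMap_apply, hz']
      simp only [vsub_eq_sub, add_sub_cancel_left, vadd_eq_add, smul_smul]
      rw [div_mul_cancel₀ _ hs.ne', add_comm]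
    rw [this]
    exact (convex_ball y₀ r).lineMap_mem hy hz
      ⟨div_nonneg ht.1 hs.le, (div_le_one hs).mpr ht.2⟩
  obtain ⟨k1, k2, k3⟩ := hball (y := (y + t • w, w)) (by
    rw [Prod.dist_eq]; exact max_lt hmem hw)
  refine ⟨k3, (futureTimelike_iff hf hfut).mpr ⟨k1, ?_⟩⟩
  rw [(hasFDerivAt_comp_symm hf.1 q k3).fderiv] at k2
  exact k2

variable {Γ : ℝ → M} {v : E} {t : ℝ}

/-- The chord from `Γ t` to `Γ s`, divided by `s - t`, is close to the velocity. This is the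
hypothesis under which `exists_chron_of_direction` replaces the arc by a coordinate segment. -/
lemma eventually_slope_mem (h : HasVelocityAt Γ v t) {r : ℝ} (hr : 0 < r) :
    ∀ᶠ s in 𝓝[≠] t, Γ s ∈ (extChartAt 𝓘(ℝ, E) (Γ t)).source ∧
      extChartAt 𝓘(ℝ, E) (Γ t) (Γ s) ∈ Metric.ball (extChartAt 𝓘(ℝ, E) (Γ t) (Γ t)) r ∧
      (s - t)⁻¹ • (extChartAt 𝓘(ℝ, E) (Γ t) (Γ s) - extChartAt 𝓘(ℝ, E) (Γ t) (Γ t)) ∈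
        Metric.ball (chartDeriv (Γ t) (Γ t) v) r := by
  have hq := mem_extChartAt_source (I := 𝓘(ℝ, E)) (Γ t)
  have hd := h.hasDerivAt (Γ t) hq
  have h1 : ∀ᶠ s in 𝓝 t, Γ s ∈ (extChartAt 𝓘(ℝ, E) (Γ t)).source :=
    h.continuousAt.preimage_mem_nhds ((isOpen_extChartAt_source (Γ t)).mem_nhds hq)
  have h2 := hd.continuousAt.preimage_mem_nhds (Metric.ball_mem_nhds _ hr)
  have h3 := (hasDerivAt_iff_tendsto_slope.mp hd).eventually (Metric.ball_mem_nhds _ hr)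
  filter_upwards [h1.filter_mono nhdsWithin_le_nhds, mem_nhdsWithin_of_mem_nhds h2, h3] with s k1 k2 k3
  exact ⟨k1, k2, k3⟩

/-- Points shortly after `Γ t` on a timelike curve are interior to the future of `Γ t`. -/
lemma eventually_chron_nhds (hf : S.IsTemporal f)
    (hfut : ∀ x, S.FutureTimelike x (grad S.g f x)) (h : HasVelocityAt Γ v t)
    (hv : S.FutureTimelike (Γ t) v) :
    ∀ᶠ s in 𝓝[>] t, ∀ᶠ z in 𝓝 (Γ s), S.Chron (Γ t) z := by
  obtain ⟨r, hr, hchron⟩ := exists_chron_of_direction hf hfut (Γ t) hv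
  filter_upwards [(eventually_slope_mem h hr).filter_mono
    (nhdsWithin_mono t fun s (hs : t < s) => hs.ne'), self_mem_nhdsWithin] with s ⟨k1, k2, k3⟩ hs
  have hc := continuousAt_extChartAt' (I := 𝓘(ℝ, E)) k1
  have hc2 : ContinuousAt (fun z => (s - t)⁻¹ • (extChartAt 𝓘(ℝ, E) (Γ t) z
      - extChartAt 𝓘(ℝ, E) (Γ t) (Γ t))) (Γ s) := (hc.sub continuousAt_const).const_smul _
  filter_upwards [(isOpen_extChartAt_source (I := 𝓘(ℝ, E)) (Γ t)).mem_nhds k1,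
    hc.preimage_mem_nhds (Metric.isOpen_ball.mem_nhds k2),
    hc2.preimage_mem_nhds (Metric.isOpen_ball.mem_nhds k3)] with z l1 l2 l3
  have := hchron _ (Metric.mem_ball_self hr) _ l2 (s - t) (sub_pos.mpr hs) l3
  rwa [extChartAt_to_inv, (extChartAt 𝓘(ℝ, E) (Γ t)).left_inv l1] at this

lemma eventually_chron_left (hf : S.IsTemporal f)
    (hfut : ∀ x, S.FutureTimelike x (grad S.g f x)) (h : HasVelocityAt Γ v t)
    (hv : S.FutureTimelike (Γ t) v) : ∀ᶠ s in 𝓝[<] t, S.Chron (Γ s) (Γ t) := by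
  obtain ⟨r, hr, hchron⟩ := exists_chron_of_direction hf hfut (Γ t) hv
  filter_upwards [(eventually_slope_mem h hr).filter_mono
    (nhdsWithin_mono t fun s (hs : s < t) => hs.ne), self_mem_nhdsWithin] with s ⟨k1, k2, k3⟩ hs
  have := hchron _ k2 _ (Metric.mem_ball_self hr) (t - s) (sub_pos.mpr hs) (by
    convert k3 using 1
    rw [← neg_sub s t, inv_neg, neg_smul, ← smul_neg, neg_sub])
  rwa [extChartAt_to_inv, (extChartAt 𝓘(ℝ, E) (Γ t)).left_inv k1] at this

/-- A curve with a future timelike velocity everywhere connects chronologically related points. -/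
lemma chron_of_hasVelocityAt (hf : S.IsTemporal f)
    (hfut : ∀ x, S.FutureTimelike x (grad S.g f x)) {a b : ℝ} (hab : a < b)
    (h : ∀ t ∈ Icc a b, ∃ v : E, HasVelocityAt Γ v t ∧ S.FutureTimelike (Γ t) v) :
    S.Chron (Γ a) (Γ b) := by
  -- `Γ` may fail to be smooth, so it is not itself an admissible curve. Instead the set of
  -- reachable times is shown to contain its supremum (chords from the left) and to extend beyond it
  -- (chords to the right) unless that is `b`; transitivity concatenates the chords.
  set K := {t | t ∈ Icc a b ∧ (t = a ∨ S.Chron (Γ a) (Γ t))} with hK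
  have haK : a ∈ K := ⟨⟨le_rfl, hab.le⟩, Or.inl rfl⟩
  have hbdd : BddAbove K := ⟨b, fun t ht => ht.1.2⟩
  set c := sSup K with hc
  have hac : a ≤ c := le_csSup hbdd haK
  have hcb : c ≤ b := csSup_le ⟨a, haK⟩ fun t ht => ht.1.2
  obtain ⟨v, hv1, hv2⟩ := h c ⟨hac, hcb⟩
  have hcK : c ∈ K := by
    refine ⟨⟨hac, hcb⟩, ?_⟩
    rcases hac.eq_or_lt with h0 | h0
    · exact Or.inl h0.symm
    right
    obtain ⟨l, hl, hl2⟩ := (mem_nhdsLT_iff_exists_Ioo_subset' h0).mp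
      (eventually_chron_left hf hfut hv1 hv2)
    obtain ⟨t, htK, ht⟩ := exists_lt_of_lt_csSup ⟨a, haK⟩ hl
    rcases (le_csSup hbdd htK).eq_or_lt with h1 | h1
    · rcases htK.2 with h2 | h2
      · exact absurd (h2.symm.trans h1) h0.ne
      · rwa [h1] at h2
    · have h3 := hl2 ⟨ht, h1⟩
      rcases htK.2 with h2 | h2
      · rw [← h2]; exact h3
      · exact h2.trans h3
  rcases hcb.eq_or_lt with h0 | h0
  · rcases hcK.2 with h1 | h1
    · exact absurd (h1.symm.trans h0) hab.ne
    · rwa [h0] at h1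
  exfalso
  obtain ⟨u, hu, hu2⟩ := (mem_nhdsGT_iff_exists_Ioo_subset' h0).mp
    (eventually_chron_nhds hf hfut hv1 hv2)
  have hcu : c < min u b := lt_min hu h0
  obtain ⟨t, ht1, ht2⟩ := exists_between hcu
  have h3 : S.Chron (Γ c) (Γ t) := (hu2 ⟨ht1, ht2.trans_le (min_le_left _ _)⟩).self_of_nhds
  have : t ∈ K := ⟨⟨hac.trans ht1.le, ht2.le.trans (min_le_right _ _)⟩, Or.inr (by
    rcases hcK.2 with h2 | h2
    · rw [← h2]; exact h3
    · exact h2.trans h3)⟩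
  exact absurd (le_csSup hbdd this) (not_le.mpr ht1)

end Spacetime

end Lorentz

namespace Lorentz

/-! ### Length bounds by the drop of `f`, and completeness of the unit gradient. -/

namespace Spacetime

variable {E : Type*} [NormedAddCommGroup E] [NormedSpace ℝ E] [FiniteDimensional ℝ E]
  {M : Type*} [TopologicalSpace M] [ChartedSpace E M] [IsManifold 𝓘(ℝ, E) ∞ M]
  {S : Spacetime E M} {f : M → ℝ}

/-- The length of a smooth causal piece is controlled by the decrease of `f`. -/
lemma length_piece_le (hf : S.IsTemporal f) (hfut : ∀ x, S.FutureTimelike x (grad S.g f x))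
    {ε : ℝ} (hε : 0 < ε) (hgrad : ∀ x, ε ≤ √|gradSq S.g f x|) {γ : ℝ → M} {a b : ℝ} (hab : a < b)
    (hγ : ContMDiffOn 𝓘(ℝ, ℝ) 𝓘(ℝ, E) ∞ γ (Icc a b))
    (hc : ∀ t ∈ Icc a b, S.FutureCausal (γ t)
      (mfderivWithin 𝓘(ℝ, ℝ) 𝓘(ℝ, E) γ (Icc a b) t (1 : ℝ))) :
    f (γ b) ≤ f (γ a) ∧ S.length γ a b ≤ ENNReal.ofReal ((f (γ a) - f (γ b)) / ε) := by
  set V : ℝ → E := fun t => mfderiv 𝓘(ℝ, ℝ) 𝓘(ℝ, E) γ t (1 : ℝ) with hV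
  have hvel : ∀ t ∈ Ioo a b, HasVelocityAt γ (V t) t := by
    intro t ht
    have h1 := ((hγ t (Ioo_subset_Icc_self ht)).contMDiffAt
      (Icc_mem_nhds ht.1 ht.2)).mdifferentiableAt (by simp) |>.hasMFDerivAt
    refine h1.congr_mfderiv ?_
    have key : ∀ L : ℝ →L[ℝ] E, L = (1 : ℝ →L[ℝ] ℝ).smulRight (L 1) := by intro L; ext; simp
    exact key _
  have hcaus : ∀ t ∈ Ioo a b, S.FutureCausal (γ t) (V t) := by
    intro t ht
    have := hc t (Ioo_subset_Icc_self ht)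
    rwa [mfderivWithin_of_mem_nhds (Icc_mem_nhds ht.1 ht.2)] at this
  set h : ℝ → ℝ := fun t => -(f (γ t)) / ε
  set h' : ℝ → ℝ := fun t => -(dfun f (γ t) (V t)) / ε
  have hd : ∀ t ∈ Ioo a b, HasDerivAt h (h' t) t := fun t ht =>
    ((hvel t ht).comp_function hf.1).neg.div_const ε
  have hbound : ∀ t ∈ Ioo a b, √(-S.g.at (γ t) (V t) (V t)) ≤ h' t := by
    intro t ht
    have := mul_sqrt_le_neg_dfun hf hfut hε hgrad (hcaus t ht)
    rw [le_div_iff₀ hε]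
    linarith
  have hpos : ∀ t ∈ Ioo a b, 0 ≤ h' t := fun t ht => (Real.sqrt_nonneg _).trans (hbound t ht)
  have hcont : ContinuousOn h (Icc a b) :=
    ((hf.1.continuous.comp_continuousOn hγ.continuousOn).neg).div_const ε
  -- A nonnegative derivative of a function continuous up to the endpoints is integrable, so the
  -- fundamental theorem of calculus applies on the closed interval.
  have hint := intervalIntegral.integrableOn_deriv_of_nonneg hcont hd hpos
  have hftc := intervalIntegral.integral_eq_sub_of_hasDerivAt_of_le hab.le hcont hd
    ((intervalIntegrable_iff_integrableOn_Ioc_of_le hab.le).mpr hint)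
  rw [intervalIntegral.integral_of_le hab.le, integral_Ioc_eq_integral_Ioo] at hftc
  have hval : h b - h a = (f (γ a) - f (γ b)) / ε := by simp only [h]; ring
  have hnn : 0 ≤ (f (γ a) - f (γ b)) / ε := by
    rw [← hval, ← hftc]
    exact setIntegral_nonneg measurableSet_Ioo hpos
  refine ⟨by
    have := mul_nonneg hnn hε.le
    rw [div_mul_cancel₀ _ hε.ne'] at this
    linarith, ?_⟩
  -- The endpoints, where `mfderiv` carries no information, form a null set.
  have hlen : S.length γ a b = ∫⁻ t in Ioo a b, ENNReal.ofReal (√(-S.g.at (γ t) (V t) (V t))) :=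
    (setLIntegral_congr Ioo_ae_eq_Icc).symm
  rw [hlen, ← hval, ← hftc, ofReal_integral_eq_lintegral_ofReal
    (hint.mono_set Ioo_subset_Ioc_self)
    ((ae_restrict_iff' measurableSet_Ioo).mpr (Eventually.of_forall hpos))]
  exact setLIntegral_mono' measurableSet_Ioo fun t ht => ENNReal.ofReal_le_ofReal (hbound t ht)

lemma length_le (hf : S.IsTemporal f) (hfut : ∀ x, S.FutureTimelike x (grad S.g f x))
    {ε : ℝ} (hε : 0 < ε) (hgrad : ∀ x, ε ≤ √|gradSq S.g f x|) {γ : ℝ → M} {a b : ℝ}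
    (h : IsPiecewiseSmooth S.FutureCausal γ a b) :
    f (γ b) ≤ f (γ a) ∧ S.length γ a b ≤ ENNReal.ofReal ((f (γ a) - f (γ b)) / ε) := by
  obtain ⟨hab, N, τ, rfl, rfl, hτ⟩ := h
  have key : ∀ j ≤ N, f (γ (τ j)) ≤ f (γ (τ 0)) ∧
      S.length γ (τ 0) (τ j) ≤ ENNReal.ofReal ((f (γ (τ 0)) - f (γ (τ j))) / ε) := by
    intro j
    induction j with
    | zero => intro _; simp [length]
    | succ j ih =>
      intro hj
      obtain ⟨i1, i2⟩ := ih (by omega)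
      obtain ⟨e1, e2, e3⟩ := hτ j (by omega)
      obtain ⟨p1, p2⟩ := length_piece_le hf hfut hε hgrad e1 e2 e3
      refine ⟨p1.trans i1, ?_⟩
      have hle : τ 0 ≤ τ j := strictMonoOn_nodes (fun i hi => (hτ i hi).1) (by omega) (by omega)
      have hu : S.length γ (τ 0) (τ (j + 1)) ≤
          S.length γ (τ 0) (τ j) + S.length γ (τ j) (τ (j + 1)) := by
        unfold length
        rw [← Icc_union_Icc_eq_Icc hle e1.le]
        exact lintegral_union_le _ _ _
      refine hu.trans ((add_le_add i2 p2).trans ?_)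
      rw [← ENNReal.ofReal_add (div_nonneg (by linarith) hε.le) (div_nonneg (by linarith) hε.le)]
      apply ENNReal.ofReal_le_ofReal
      apply le_of_eq; ring
  exact key N le_rfl

/-- Along a chronological sequence with `f (x k) → L` this supplies the bounds `B k`, namely `|f (x
k) - L| / ε`, required by Cauchy completeness. -/
lemma dist_le (hf : S.IsTemporal f) (hfut : ∀ x, S.FutureTimelike x (grad S.g f x))
    {ε : ℝ} (hε : 0 < ε) (hgrad : ∀ x, ε ≤ √|gradSq S.g f x|) (p q : M) :
    S.dist p q ≤ ENNReal.ofReal ((f p - f q) / ε) := by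
  refine iSup_le fun γ => iSup_le fun a => iSup_le fun b => iSup_le ?_
  rintro ⟨h, rfl, rfl⟩
  exact (length_le hf hfut hε hgrad h).2

/-- Chronologically related points with nearby values of `f` form a Cauchy sequence. -/
lemma exists_tendsto_future (hf : S.IsTemporal f) (hfut : ∀ x, S.FutureTimelike x (grad S.g f x))
    {ε : ℝ} (hε : 0 < ε) (hgrad : ∀ x, ε ≤ √|gradSq S.g f x|) (hS : S.FutureCauchyComplete)
    {x : ℕ → M} (hx : ∀ k, S.Chron (x k) (x (k + 1))) {L : ℝ} (hL : ∀ k, L ≤ f (x k))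
    (hlim : Tendsto (fun k => f (x k)) atTop (𝓝 L)) : ∃ p, Tendsto x atTop (𝓝 p) := by
  refine hS x hx ⟨fun k => (f (x k) - L) / ε, fun k => div_nonneg (by linarith [hL k]) hε.le,
    fun k k' _ => (dist_le hf hfut hε hgrad _ _).trans (ENNReal.ofReal_le_ofReal ?_), ?_⟩
  · exact div_le_div_of_nonneg_right (by linarith [hL k']) hε.le
  · simpa using (hlim.sub_const L).div_const ε

lemma exists_tendsto_past (hf : S.IsTemporal f) (hfut : ∀ x, S.FutureTimelike x (grad S.g f x))
    {ε : ℝ} (hε : 0 < ε) (hgrad : ∀ x, ε ≤ √|gradSq S.g f x|) (hS : S.PastCauchyComplete)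
    {x : ℕ → M} (hx : ∀ k, S.Chron (x (k + 1)) (x k)) {L : ℝ} (hL : ∀ k, f (x k) ≤ L)
    (hlim : Tendsto (fun k => f (x k)) atTop (𝓝 L)) : ∃ p, Tendsto x atTop (𝓝 p) := by
  refine hS x hx ⟨fun k => (L - f (x k)) / ε, fun k => div_nonneg (by linarith [hL k]) hε.le,
    fun k k' _ => (dist_le hf hfut hε hgrad _ _).trans (ENNReal.ofReal_le_ofReal ?_), ?_⟩
  · exact div_le_div_of_nonneg_right (by linarith [hL k']) hε.le
  · simpa using (hlim.const_sub L).div_const ε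

/-- The unit gradient of `f` with respect to the conformal metric. -/
noncomputable def unitGrad (S : Spacetime E M) (f : M → ℝ) (x : M) : E :=
  gradE (conformal S.g f) f x

lemma dfun_unitGrad (hf : S.IsTemporal f) (x : M) : dfun f x (S.unitGrad f x) = -1 :=
  dfun_gradE_conformal hf x

lemma conformal_unitGrad (hf : S.IsTemporal f) (x : M) (v : E) :
    (conformal S.g f).at x (S.unitGrad f x) v = dfun f x v := by
  rw [unitGrad, conformal_at_gradE hf]

lemma futureTimelike_unitGrad (hf : S.IsTemporal f)
    (hfut : ∀ x, S.FutureTimelike x (grad S.g f x)) (x : M) :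
    S.FutureTimelike x (S.unitGrad f x) := by
  rw [futureTimelike_iff hf hfut, ← conformal_neg_iff hf, conformal_unitGrad hf, dfun_unitGrad hf]
  norm_num

lemma coordGrad_unitGrad (hf : S.IsTemporal f) (p : M) {x : M}
    (hx : x ∈ (extChartAt 𝓘(ℝ, E) p).source) :
    coordGrad (coordMetric (conformal S.g f) p) (fun z => f ((extChartAt 𝓘(ℝ, E) p).symm z))
      (extChartAt 𝓘(ℝ, E) p x) = chartDeriv p x (S.unitGrad f x) :=
  coordGrad_coordMetric hf.1 p hx (isInvertible_conformal hf x)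

/-- `γ` is an integral curve of the unit gradient on `s`. -/
def IsGradCurveOn (S : Spacetime E M) (f : M → ℝ) (γ : ℝ → M) (s : Set ℝ) : Prop :=
  ∀ t ∈ s, HasVelocityAt γ (S.unitGrad f (γ t)) t

lemma isGradCurveOn_iff {γ : ℝ → M} {s : Set ℝ} (hs : IsOpen s) : S.IsGradCurveOn f γ s ↔
    IsMIntegralCurveOn (I := 𝓘(ℝ, E)) γ (fun x => S.unitGrad (E := E) f x) s :=
  ⟨fun h t ht => HasMFDerivAt.hasMFDerivWithinAt (h t ht),
    fun h t ht => (h t ht).hasMFDerivAt (hs.mem_nhds ht)⟩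

lemma contMDiff_unitGrad (hf : S.IsTemporal f) : ContMDiff 𝓘(ℝ, E) 𝓘(ℝ, E).tangent 1
      (fun x => (⟨x, S.unitGrad (E := E) (M := M) f x⟩ : TangentBundle 𝓘(ℝ, E) M)) :=
  (contMDiff_gradE_conformal hf).of_le (by simp)

lemma IsGradCurveOn.eqOn [T2Space M] (hf : S.IsTemporal f) {γ γ' : ℝ → M} {a b t₀ : ℝ}
    (h : S.IsGradCurveOn f γ (Ioo a b)) (h' : S.IsGradCurveOn f γ' (Ioo a b)) (ht : t₀ ∈ Ioo a b)
    (heq : γ t₀ = γ' t₀) : EqOn γ γ' (Ioo a b) :=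
  isMIntegralCurveOn_Ioo_eqOn_of_contMDiff_boundaryless ht (contMDiff_unitGrad hf)
    ((isGradCurveOn_iff isOpen_Ioo).mp h) ((isGradCurveOn_iff isOpen_Ioo).mp h') heq

/-- The sum `f (γ t) + t` has derivative `df(U) + 1 = 0`. -/
lemma IsGradCurveOn.apply_eq (hf : S.IsTemporal f) {γ : ℝ → M} {a b s t : ℝ}
    (h : S.IsGradCurveOn f γ (Ioo a b)) (hs : s ∈ Ioo a b) (ht : t ∈ Ioo a b) :
    f (γ t) + t = f (γ s) + s := by
  have hd : ∀ r ∈ Ioo a b, HasDerivAt (fun r => f (γ r) + r) 0 r := by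
    intro r hr
    have := ((h r hr).comp_function hf.1).add (hasDerivAt_id r)
    rw [dfun_unitGrad hf] at this
    simpa using! this
  exact isOpen_Ioo.is_const_of_deriv_eq_zero isPreconnected_Ioo
    (fun r hr => (hd r hr).differentiableAt.differentiableWithinAt)
    (fun r hr => (hd r hr).deriv) ht hs

lemma IsGradCurveOn.chron (hf : S.IsTemporal f) (hfut : ∀ x, S.FutureTimelike x (grad S.g f x))
    {γ : ℝ → M} {s : Set ℝ} (h : S.IsGradCurveOn f γ s) {a b : ℝ} (hab : a < b)
    (hs : Icc a b ⊆ s) : S.Chron (γ a) (γ b) :=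
  chron_of_hasVelocityAt hf hfut hab fun t ht =>
    ⟨_, h t (hs ht), futureTimelike_unitGrad hf hfut _⟩

lemma IsGradCurveOn.comp_add {γ : ℝ → M} {a b : ℝ} (h : S.IsGradCurveOn f γ (Ioo a b)) (k : ℝ) :
    S.IsGradCurveOn f (fun t => γ (t + k)) (Ioo (a - k) (b - k)) := by
  rw [isGradCurveOn_iff isOpen_Ioo] at h ⊢
  have := h.comp_add k
  convert! this using 1
  ext t
  simp [sub_lt_iff_lt_add, lt_sub_iff_add_lt]

lemma IsGradCurveOn.mono {γ : ℝ → M} {s s' : Set ℝ} (h : S.IsGradCurveOn f γ s) (hs : s' ⊆ s) :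
    S.IsGradCurveOn f γ s' := fun t ht => h t (hs ht)

/-- Local flow of the unit gradient in a chart. -/
lemma exists_chart_flow (hf : S.IsTemporal f) (p : M) {x : M}
    (hx : x ∈ (extChartAt 𝓘(ℝ, E) p).source) :
    ∃ r > 0, ∃ δ > 0, ∃ (α : E → ℝ → E) (A : E → ℝ → E →L[ℝ] E),
      Metric.ball (extChartAt 𝓘(ℝ, E) p x) r ⊆ (extChartAt 𝓘(ℝ, E) p).target ∧
      ContinuousAt (fun z : E × ℝ => α z.1 z.2) (extChartAt 𝓘(ℝ, E) p x, 0) ∧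
      ∀ y ∈ Metric.ball (extChartAt 𝓘(ℝ, E) p x) r, α y 0 = y ∧
        A y 0 = ContinuousLinearMap.id ℝ E ∧
        S.IsGradCurveOn f (fun t => (extChartAt 𝓘(ℝ, E) p).symm (α y t)) (Ioo (-δ) δ) ∧
        ∀ t ∈ Ioo (-δ) δ, α y t ∈ (extChartAt 𝓘(ℝ, E) p).target ∧
          HasDerivAt (α y) (coordGrad (coordMetric (conformal S.g f) p)
            (fun z => f ((extChartAt 𝓘(ℝ, E) p).symm z)) (α y t)) t ∧
          HasDerivAt (A y) ((fderiv ℝ (coordGrad (coordMetric (conformal S.g f) p)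
            (fun z => f ((extChartAt 𝓘(ℝ, E) p).symm z))) (α y t)).comp (A y t)) t ∧
          HasFDerivAt (fun z => α z t) (A y t) y := by
  obtain ⟨r, hr, δ, hδ, α, A, hball, hjoint, h⟩ := exists_local_flow (isOpen_target p)
    (isEikonalOn hf p).contDiffOn_coordGrad ((extChartAt 𝓘(ℝ, E) p).map_source hx)
  refine ⟨r, hr, δ, hδ, α, A, hball, hjoint, fun y hy => ?_⟩
  obtain ⟨h0, h1, h2⟩ := h y hy
  refine ⟨h0, h1, fun t ht => ?_, h2⟩
  obtain ⟨k1, k2, -, -⟩ := h2 t ht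
  have e := hasVelocityAt_symm_comp p k1 k2
  have e2 := coordGrad_unitGrad hf p ((extChartAt 𝓘(ℝ, E) p).map_target k1)
  rw [(extChartAt 𝓘(ℝ, E) p).right_inv k1] at e2
  have e3 := chartSymmDeriv_chartDeriv p ((extChartAt 𝓘(ℝ, E) p).map_target k1)
    (S.unitGrad f ((extChartAt 𝓘(ℝ, E) p).symm (α y t)))
  rw [(extChartAt 𝓘(ℝ, E) p).right_inv k1] at e3
  rwa [e2, e3] at e

/-- Near a limit point of an orbit the existence time does not shrink, so restarting close enough to
it continues the orbit past the limit. -/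
lemma exists_uniform_gradCurve (hf : S.IsTemporal f) (p : M) :
    ∃ W ∈ 𝓝 p, ∃ δ > 0, ∀ z ∈ W, ∃ γ : ℝ → M, γ 0 = z ∧ S.IsGradCurveOn f γ (Ioo (-δ) δ) := by
  have hp := mem_extChartAt_source (I := 𝓘(ℝ, E)) p
  obtain ⟨r, hr, δ, hδ, α, A, hball, -, h⟩ := exists_chart_flow hf p hp
  refine ⟨_, Filter.inter_mem ((isOpen_extChartAt_source (I := 𝓘(ℝ, E)) p).mem_nhds hp)
    ((continuousAt_extChartAt (I := 𝓘(ℝ, E)) p).preimage_mem_nhds (Metric.ball_mem_nhds _ hr)),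
    δ, hδ, fun z hz => ?_⟩
  obtain ⟨h0, -, h2, -⟩ := h _ hz.2
  exact ⟨_, by simp only [h0]; exact (extChartAt 𝓘(ℝ, E) p).left_inv hz.1, h2⟩

/-- Extending an integral curve to the right. -/
lemma IsGradCurveOn.extend [T2Space M] (hf : S.IsTemporal f) {γ γ' : ℝ → M} {a b a' b' t₀ : ℝ}
    (h : S.IsGradCurveOn f γ (Ioo a b)) (h' : S.IsGradCurveOn f γ' (Ioo a' b'))
    (ht : t₀ ∈ Ioo a b ∩ Ioo a' b') (heq : γ t₀ = γ' t₀) :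
    ∃ β : ℝ → M, (∀ t ∈ Ioo a b, β t = γ t) ∧ S.IsGradCurveOn f β (Ioo a b ∪ Ioo a' b') := by
  classical
  refine ⟨piecewise (Ioo a b) γ γ', fun t ht => piecewise_eq_of_mem _ _ _ ht, ?_⟩
  rw [isGradCurveOn_iff (isOpen_Ioo.union isOpen_Ioo)]
  exact isMIntegralCurveOn_piecewise (contMDiff_unitGrad hf) ((isGradCurveOn_iff isOpen_Ioo).mp h)
    ((isGradCurveOn_iff isOpen_Ioo).mp h') ht heq

/-- The unit gradient of a temporal function with gradient bounded below is complete. -/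
lemma exists_gradCurve [T2Space M] (hf : S.IsTemporal f)
    (hfut : ∀ x, S.FutureTimelike x (grad S.g f x))
    {ε : ℝ} (hε : 0 < ε) (hgrad : ∀ x, ε ≤ √|gradSq S.g f x|) (hS : S.TimelikeCauchyComplete)
    (x : M) : ∃ γ : ℝ → M, γ 0 = x ∧ S.IsGradCurveOn f γ univ := by
  -- Symmetric intervals of existence: enlarging one requires a continuation at both ends.
  set s := {a : ℝ | 0 < a ∧ ∃ γ : ℝ → M, γ 0 = x ∧ S.IsGradCurveOn f γ (Ioo (-a) a)} with hs
  suffices hbdd : ¬ BddAbove s by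
    have := (exists_isMIntegralCurve_iff_exists_isMIntegralCurveOn_Ioo (I := 𝓘(ℝ, E))
      (contMDiff_unitGrad hf) x).mpr fun a => by
        obtain ⟨b, ⟨hb, γ, h0, hγ⟩, hab⟩ := not_bddAbove_iff.mp hbdd a
        exact ⟨γ, h0, (isGradCurveOn_iff isOpen_Ioo).mp (hγ.mono
          (Ioo_subset_Ioo (by linarith) hab.le))⟩
    obtain ⟨γ, h0, hγ⟩ := this
    exact ⟨γ, h0, fun t _ => hγ t⟩
  intro hbdd
  have hne : s.Nonempty := by
    obtain ⟨W, hW, δ, hδ, h⟩ := exists_uniform_gradCurve hf x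
    exact ⟨δ, hδ, h x (mem_of_mem_nhds hW)⟩
  set A := sSup s with hA
  have hA0 : 0 < A := by
    obtain ⟨a, ha⟩ := hne
    exact ha.1.trans_le (le_csSup hbdd ha)
  -- the curve on the whole interval
  have hall : ∀ a : ℝ, ∃ γ : ℝ → M, a < A → γ 0 = x ∧ S.IsGradCurveOn f γ (Ioo (-a) a) := by
    intro a
    by_cases ha : a < A
    · obtain ⟨b, ⟨hb, γ, h0, hγ⟩, hab⟩ := exists_lt_of_lt_csSup hne ha
      exact ⟨γ, fun _ => ⟨h0, hγ.mono (Ioo_subset_Ioo (by linarith) hab.le)⟩⟩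
    · exact ⟨fun _ => x, fun h => absurd h ha⟩
  choose c hc using hall
  -- The radius `(|t| + A) / 2` lies strictly between `|t|` and `A`. By uniqueness the choice of
  -- radius does not matter.
  set Γ : ℝ → M := fun t => c ((|t| + A) / 2) t with hΓ
  have hΓeq : ∀ a, 0 < a → a < A → EqOn Γ (c a) (Ioo (-a) a) := by
    intro a ha haA t ht
    have hta : |t| < a := abs_lt.mpr ht
    have h1 : (|t| + A) / 2 < A := by linarith
    have h2 : |t| < (|t| + A) / 2 := by linarith
    have h0 : 0 < (|t| + A) / 2 := by linarith [abs_nonneg t]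
    have hm : 0 < min ((|t| + A) / 2) a := lt_min h0 ha
    exact IsGradCurveOn.eqOn hf
      ((hc _ h1).2.mono (Ioo_subset_Ioo (neg_le_neg (min_le_left _ a)) (min_le_left _ a)))
      ((hc _ haA).2.mono (Ioo_subset_Ioo (neg_le_neg (min_le_right ((|t| + A) / 2) _))
        (min_le_right ((|t| + A) / 2) _)))
      (t₀ := 0) ⟨by linarith, hm⟩ (by rw [(hc _ h1).1, (hc _ haA).1])
      (abs_lt.mp (lt_min h2 hta))
  have hΓ0 : Γ 0 = x := by simp only [hΓ]; exact (hc _ (by simp; linarith)).1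
  have hΓc : S.IsGradCurveOn f Γ (Ioo (-A) A) := by
    intro t ht
    have htA : |t| < A := abs_lt.mpr ht
    obtain ⟨a, ha1, ha2⟩ := exists_between htA
    have ha0 : 0 < a := (abs_nonneg t).trans_lt ha1
    have hmem : t ∈ Ioo (-a) a := abs_lt.mp ha1
    have h1 := (hc a ha2).2 t hmem
    have h2 : Γ =ᶠ[𝓝 t] c a := by
      filter_upwards [isOpen_Ioo.mem_nhds hmem] with r hr using hΓeq a ha0 ha2 hr
    have h3 := HasMFDerivAt.congr_of_eventuallyEq h1 h2
    have h4 : Γ t = c a t := hΓeq a ha0 ha2 hmem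
    rw [h4]
    exact h3
  have hfΓ : ∀ t ∈ Ioo (-A) A, f (Γ t) = f x - t := by
    intro t ht
    have := hΓc.apply_eq hf (s := 0) ⟨by linarith, hA0⟩ ht
    rw [hΓ0] at this
    linarith
  -- a sequence of times
  set u : ℕ → ℝ := fun k => A - A / (k + 2) with hu
  have hu1 : ∀ k, u k ∈ Ioo 0 A := by
    intro k
    have h1 : 0 < A / (k + 2 : ℝ) := by positivity
    have h2 : A / (k + 2 : ℝ) < A := div_lt_self hA0 (by linarith [(Nat.cast_nonneg k : (0 : ℝ) ≤ k)])
    exact ⟨by simp only [hu]; linarith, by simp only [hu]; linarith⟩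
  have hu2 : ∀ k, u k < u (k + 1) := by
    intro k
    simp only [hu]
    have : A / ((k + 1 : ℕ) + 2 : ℝ) < A / (k + 2 : ℝ) := by
      apply div_lt_div_of_pos_left hA0 (by positivity)
      push_cast; linarith
    linarith
  have hu3 : Tendsto u atTop (𝓝 A) := by
    have h1 : Tendsto (fun k : ℕ => A / ((k : ℝ) + 2)) atTop (𝓝 0) :=
      tendsto_const_nhds.div_atTop
        (tendsto_atTop_add_const_right _ _ tendsto_natCast_atTop_atTop)
    simpa using h1.const_sub A
  have hmem : ∀ k, u k ∈ Ioo (-A) A := fun k => ⟨by linarith [(hu1 k).1], (hu1 k).2⟩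
  have hmem' : ∀ k, -u k ∈ Ioo (-A) A := fun k => ⟨by linarith [(hu1 k).2], by linarith [(hu1 k).1]⟩
  -- On the orbit `f` equals `f x - t`, hence converges as `t → A`; future completeness gives an
  -- endpoint. Past completeness does the same as `t → -A`.
  obtain ⟨p, hp⟩ := exists_tendsto_future hf hfut hε hgrad hS.1 (x := fun k => Γ (u k))
    (L := f x - A)
    (fun k => hΓc.chron hf hfut (hu2 k) (fun r hr =>
      ⟨(hmem k).1.trans_le hr.1, hr.2.trans_lt (hmem (k + 1)).2⟩))
    (fun k => by rw [hfΓ _ (hmem k)]; linarith [(hu1 k).2])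
    (by simp_rw [hfΓ _ (hmem _)]; exact hu3.const_sub _)
  obtain ⟨q, hq⟩ := exists_tendsto_past hf hfut hε hgrad hS.2 (x := fun k => Γ (-u k))
    (L := f x + A)
    (fun k => hΓc.chron hf hfut (neg_lt_neg (hu2 k)) (fun r hr =>
      ⟨(hmem' (k + 1)).1.trans_le hr.1, hr.2.trans_lt (hmem' k).2⟩))
    (fun k => by rw [hfΓ _ (hmem' k)]; linarith [(hu1 k).2])
    (by simp_rw [hfΓ _ (hmem' _), sub_neg_eq_add]; exact hu3.const_add _)
  -- Restarting within `δ / 2` of the end time, with life span `δ`, reaches beyond `A` by at least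
  -- `δ / 2`; likewise at the past end.
  obtain ⟨W, hW, δ, hδ, hloc⟩ := exists_uniform_gradCurve hf p
  obtain ⟨W', hW', δ', hδ', hloc'⟩ := exists_uniform_gradCurve hf q
  obtain ⟨k, hk1, hk2⟩ := ((hp.eventually hW).and
    (hu3.eventually (lt_mem_nhds (show A - δ / 2 < A by linarith)))).exists
  obtain ⟨l, hl1, hl2⟩ := ((hq.eventually hW').and
    (hu3.eventually (lt_mem_nhds (show A - δ' / 2 < A by linarith)))).exists
  obtain ⟨c₁, hc₁0, hc₁⟩ := hloc _ hk1
  obtain ⟨c₂, hc₂0, hc₂⟩ := hloc' _ hl1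
  have hr := hc₁.comp_add (-u k)
  have hl := hc₂.comp_add (u l)
  obtain ⟨β, hβ1, hβ2⟩ := hΓc.extend hf hr (t₀ := u k)
    ⟨hmem k, by constructor <;> linarith⟩ (by simp [hc₁0])
  have hβ3 : S.IsGradCurveOn f β (Ioo (-A) (A + δ / 2)) := hβ2.mono (by
    intro t ht
    by_cases h : t < A
    · exact Or.inl ⟨ht.1, h⟩
    · exact Or.inr ⟨by linarith [(hu1 k).2, not_lt.mp h], by linarith [ht.2]⟩)
  obtain ⟨β', hβ1', hβ2'⟩ := hβ3.extend hf hl (t₀ := -u l)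
    ⟨⟨(hmem' l).1, by linarith [(hmem' l).2]⟩, by constructor <;> linarith⟩
    (by simp [hc₂0, hβ1 _ (hmem' l)])
  have hη : 0 < min (δ / 2) (δ' / 2) := by positivity
  have hfin : A + min (δ / 2) (δ' / 2) ∈ s := by
    refine ⟨by linarith, β', ?_, hβ2'.mono ?_⟩
    · rw [hβ1' 0 ⟨by linarith, by linarith⟩, hβ1 0 ⟨by linarith, hA0⟩, hΓ0]
    · intro t ht
      have m1 := min_le_left (δ / 2) (δ' / 2)
      have m2 := min_le_right (δ / 2) (δ' / 2)
      by_cases h : -A < t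
      · exact Or.inl ⟨h, by linarith [ht.2]⟩
      · exact Or.inr ⟨by linarith [ht.1], by linarith [(hu1 l).2, not_lt.mp h]⟩
  linarith [le_csSup hbdd hfin]

end Spacetime

end Lorentz

/-! ### The global flow of the unit gradient and its derivative. -/

namespace Lorentz

/-- A set that is a union of pieces of a neighbourhood cover of a connected space is everything. -/
lemma eq_univ_of_forall_nhds {α : Type*} [TopologicalSpace α] [PreconnectedSpace α] {s : Set α}
    (hne : s.Nonempty) (h : ∀ q, ∃ V ∈ 𝓝 q, ∀ u ∈ V, ∀ v ∈ V, u ∈ s → v ∈ s) : s = univ := by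
  refine IsClopen.eq_univ ⟨?_, ?_⟩ hne
  · rw [← isOpen_compl_iff, isOpen_iff_mem_nhds]
    intro t ht
    obtain ⟨V, hV, h⟩ := h t
    filter_upwards [hV] with u hu hus using ht (h u hu t (mem_of_mem_nhds hV) hus)
  · rw [isOpen_iff_mem_nhds]
    intro t ht
    obtain ⟨V, hV, h⟩ := h t
    filter_upwards [hV] with u hu using h t (mem_of_mem_nhds hV) u hu ht

namespace Spacetime

variable {E : Type*} [NormedAddCommGroup E] [NormedSpace ℝ E] [FiniteDimensional ℝ E]
  {M : Type*} [TopologicalSpace M] [ChartedSpace E M] [IsManifold 𝓘(ℝ, E) ∞ M]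
  {S : Spacetime E M} {f : M → ℝ} {Φ : ℝ → M → M}

/-- `Φ` is the global flow of the unit gradient. -/
structure IsGradFlow (S : Spacetime E M) (f : M → ℝ) (Φ : ℝ → M → M) : Prop where
  zero : ∀ x, Φ 0 x = x
  isGradCurveOn : ∀ x, S.IsGradCurveOn f (fun t => Φ t x) univ

/-- The derivative of the flow in the space variable. -/
noncomputable def flowDeriv (Φ : ℝ → M → M) (t : ℝ) (x : M) : E →L[ℝ] E :=
  mfderiv 𝓘(ℝ, E) 𝓘(ℝ, E) (Φ t) x

lemma exists_isGradFlow [T2Space M] (hf : S.IsTemporal f)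
    (hfut : ∀ x, S.FutureTimelike x (grad S.g f x))
    {ε : ℝ} (hε : 0 < ε) (hgrad : ∀ x, ε ≤ √|gradSq S.g f x|) (hS : S.TimelikeCauchyComplete) :
    ∃ Φ : ℝ → M → M, S.IsGradFlow f Φ := by
  choose γ h0 hγ using exists_gradCurve hf hfut hε hgrad hS
  exact ⟨fun t x => γ x t, h0, hγ⟩

namespace IsGradFlow

/-- Uniqueness of integral curves, on an interval long enough to contain both `0` and `t`. -/
lemma add [T2Space M] (hΦ : S.IsGradFlow f Φ) (hf : S.IsTemporal f) (s t : ℝ) (x : M) :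
    Φ (s + t) x = Φ t (Φ s x) := by
  have h1 := ((hΦ.isGradCurveOn x).mono (subset_univ (Ioo (s - (|t| + 1)) (s + (|t| + 1))))).comp_add s
  have h2 := (hΦ.isGradCurveOn (Φ s x)).mono
    (subset_univ (Ioo (s - (|t| + 1) - s) (s + (|t| + 1) - s)))
  have := h1.eqOn hf h2 (t₀ := 0) ⟨by linarith [abs_nonneg t], by linarith [abs_nonneg t]⟩
    (by simp [hΦ.zero]) (x := t) ⟨by linarith [neg_abs_le t], by linarith [le_abs_self t]⟩
  rw [add_comm]
  exact this

lemma apply (hΦ : S.IsGradFlow f Φ) (hf : S.IsTemporal f) (t : ℝ) (x : M) :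
    f (Φ t x) = f x - t := by
  have h2 := ((hΦ.isGradCurveOn x).mono (subset_univ (Ioo (-(|t| + 1)) (|t| + 1)))).apply_eq hf
    (s := 0) (t := t) ⟨by linarith [abs_nonneg t], by linarith [abs_nonneg t]⟩
    ⟨by linarith [neg_abs_le t], by linarith [le_abs_self t]⟩
  simp only [hΦ.zero] at h2
  linarith

lemma continuous_time (hΦ : S.IsGradFlow f Φ) (x : M) : Continuous fun t => Φ t x :=
  continuous_iff_continuousAt.mpr fun t => (hΦ.isGradCurveOn x t (mem_univ t)).continuousAt

lemma chron (hΦ : S.IsGradFlow f Φ) (hf : S.IsTemporal f)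
    (hfut : ∀ x, S.FutureTimelike x (grad S.g f x)) {s t : ℝ} (hst : s < t) (x : M) :
    S.Chron (Φ s x) (Φ t x) :=
  (hΦ.isGradCurveOn x).chron hf hfut hst (subset_univ _)

/-- The flow in a chart. -/
lemma exists_chart [T2Space M] (hΦ : S.IsGradFlow f Φ) (hf : S.IsTemporal f) (p : M) {x : M}
    (hx : x ∈ (extChartAt 𝓘(ℝ, E) p).source) :
    ∃ r > 0, ∃ δ > 0, ∃ (α : E → ℝ → E) (A : E → ℝ → E →L[ℝ] E),
      ContinuousAt (fun z : E × ℝ => α z.1 z.2) (extChartAt 𝓘(ℝ, E) p x, 0) ∧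
      ∀ z ∈ (extChartAt 𝓘(ℝ, E) p).source,
        extChartAt 𝓘(ℝ, E) p z ∈ Metric.ball (extChartAt 𝓘(ℝ, E) p x) r →
        α (extChartAt 𝓘(ℝ, E) p z) 0 = extChartAt 𝓘(ℝ, E) p z ∧
        A (extChartAt 𝓘(ℝ, E) p z) 0 = ContinuousLinearMap.id ℝ E ∧
        ∀ t ∈ Ioo (-δ) δ, α (extChartAt 𝓘(ℝ, E) p z) t ∈ (extChartAt 𝓘(ℝ, E) p).target ∧
          Φ t z = (extChartAt 𝓘(ℝ, E) p).symm (α (extChartAt 𝓘(ℝ, E) p z) t) ∧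
          HasDerivAt (α (extChartAt 𝓘(ℝ, E) p z)) (coordGrad (coordMetric (conformal S.g f) p)
            (fun z => f ((extChartAt 𝓘(ℝ, E) p).symm z)) (α (extChartAt 𝓘(ℝ, E) p z) t)) t ∧
          HasDerivAt (A (extChartAt 𝓘(ℝ, E) p z))
            ((fderiv ℝ (coordGrad (coordMetric (conformal S.g f) p)
            (fun z => f ((extChartAt 𝓘(ℝ, E) p).symm z))) (α (extChartAt 𝓘(ℝ, E) p z) t)).comp
            (A (extChartAt 𝓘(ℝ, E) p z) t)) t ∧
          HasMFDerivAt 𝓘(ℝ, E) 𝓘(ℝ, E) (Φ t) z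
            (((chartSymmDeriv (E := E) p (α (extChartAt 𝓘(ℝ, E) p z) t)).comp
              (A (extChartAt 𝓘(ℝ, E) p z) t)).comp (chartDeriv (E := E) p z) : E →L[ℝ] E) := by
  obtain ⟨r, hr, δ, hδ, α, A, hball, hjoint, h⟩ := exists_chart_flow hf p hx
  have heq : ∀ z ∈ (extChartAt 𝓘(ℝ, E) p).source,
      extChartAt 𝓘(ℝ, E) p z ∈ Metric.ball (extChartAt 𝓘(ℝ, E) p x) r → ∀ t ∈ Ioo (-δ) δ,
      Φ t z = (extChartAt 𝓘(ℝ, E) p).symm (α (extChartAt 𝓘(ℝ, E) p z) t) := by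
    intro z hz hzr t ht
    obtain ⟨h0, -, h2, -⟩ := h _ hzr
    exact ((hΦ.isGradCurveOn z).mono (subset_univ (Ioo (-δ) δ))).eqOn hf h2 (t₀ := 0)
      ⟨by linarith, hδ⟩ (by simp only [h0, hΦ.zero, (extChartAt 𝓘(ℝ, E) p).left_inv hz]) ht
  refine ⟨r, hr, δ, hδ, α, A, hjoint, fun z hz hzr => ?_⟩
  obtain ⟨h0, h1, -, h2⟩ := h _ hzr
  refine ⟨h0, h1, fun t ht => ?_⟩
  obtain ⟨k1, k2, k3, k4⟩ := h2 t ht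
  refine ⟨k1, heq z hz hzr t ht, k2, k3, ?_⟩
  have e1 := ((hasMFDerivAt_extChartAt_symm p k1).comp (extChartAt 𝓘(ℝ, E) p z)
    k4.hasMFDerivAt).comp z (hasMFDerivAt_extChartAt_source p hz)
  refine HasMFDerivAt.congr_of_eventuallyEq e1 ?_
  filter_upwards [(isOpen_extChartAt_source (I := 𝓘(ℝ, E)) p).mem_nhds hz,
    (continuousAt_extChartAt' (I := 𝓘(ℝ, E)) hz).preimage_mem_nhds
      (Metric.isOpen_ball.mem_nhds hzr)] with y hy hyr
  exact heq y hy hyr t ht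

/-- For short times the flow is differentiable near each point, by the chart flow. Writing `Φ v = Φ
(v - u) ∘ Φ u` spreads differentiability at `x` between neighbouring times, and the line is
connected. -/
lemma mdifferentiableAt [T2Space M] (hΦ : S.IsGradFlow f Φ) (hf : S.IsTemporal f) (t : ℝ) (x : M) :
    MDifferentiableAt 𝓘(ℝ, E) 𝓘(ℝ, E) (Φ t) x := by
  set s := {t | MDifferentiableAt 𝓘(ℝ, E) 𝓘(ℝ, E) (Φ t) x} with hs
  have key : ∀ t, ∃ V ∈ 𝓝 t, ∀ u ∈ V, ∀ v ∈ V, u ∈ s → v ∈ s := by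
    intro t
    have hx := mem_extChartAt_source (I := 𝓘(ℝ, E)) (Φ t x)
    obtain ⟨r, hr, δ, hδ, α, A, -, h⟩ := hΦ.exists_chart hf (Φ t x) hx
    have hV1 := (hΦ.continuous_time x).continuousAt.preimage_mem_nhds (Filter.inter_mem
      ((isOpen_extChartAt_source (I := 𝓘(ℝ, E)) (Φ t x)).mem_nhds hx)
      ((continuousAt_extChartAt (I := 𝓘(ℝ, E)) (Φ t x)).preimage_mem_nhds (Metric.ball_mem_nhds _ hr)))
    refine ⟨_, Filter.inter_mem hV1 (Ioo_mem_nhds (show t - δ / 2 < t by linarith)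
      (show t < t + δ / 2 by linarith)), fun u hu v hv hus => ?_⟩
    obtain ⟨-, -, h2⟩ := h (Φ u x) hu.1.1 hu.1.2
    obtain ⟨-, -, -, -, k⟩ := h2 (v - u) ⟨by linarith [hu.2.2, hv.2.1], by linarith [hu.2.1, hv.2.2]⟩
    have e : Φ v = Φ (v - u) ∘ Φ u := by
      ext y
      rw [Function.comp, ← hΦ.add hf]
      congr 1
      ring
    simp only [hs, mem_ofPred_eq, e]
    exact k.mdifferentiableAt.comp x hus
  have h0 : (0 : ℝ) ∈ s := by
    have : Φ 0 = id := funext hΦ.zero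
    simp only [hs, mem_ofPred_eq, this]
    exact mdifferentiableAt_id
  have ht : t ∈ s := by rw [eq_univ_of_forall_nhds ⟨0, h0⟩ key]; exact mem_univ t
  exact ht

lemma hasMFDerivAt [T2Space M] (hΦ : S.IsGradFlow f Φ) (hf : S.IsTemporal f) (t : ℝ) (x : M) :
    HasMFDerivAt 𝓘(ℝ, E) 𝓘(ℝ, E) (Φ t) x (flowDeriv (E := E) Φ t x) :=
  (hΦ.mdifferentiableAt hf t x).hasMFDerivAt

lemma continuous_space [T2Space M] (hΦ : S.IsGradFlow f Φ) (hf : S.IsTemporal f) (t : ℝ) :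
    Continuous (Φ t) :=
  continuous_iff_continuousAt.mpr fun x => (hΦ.hasMFDerivAt hf t x).continuousAt

lemma flowDeriv_zero (hΦ : S.IsGradFlow f Φ) (x : M) :
    flowDeriv (E := E) Φ 0 x = ContinuousLinearMap.id ℝ E := by
  have : Φ 0 = id := funext hΦ.zero
  rw [flowDeriv, this]
  exact mfderiv_id

lemma flowDeriv_add [T2Space M] (hΦ : S.IsGradFlow f Φ) (hf : S.IsTemporal f) (s t : ℝ) (x : M) :
    flowDeriv (E := E) Φ (s + t) x = (flowDeriv Φ t (Φ s x)).comp (flowDeriv Φ s x) := by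
  have e : Φ (s + t) = Φ t ∘ Φ s := funext fun y => hΦ.add hf s t y
  have := (hΦ.hasMFDerivAt hf t (Φ s x)).comp x (hΦ.hasMFDerivAt hf s x)
  rw [flowDeriv, e]
  exact this.mfderiv

/-- The flow preserves the differential of `f`. -/
lemma dfun_flowDeriv [T2Space M] (hΦ : S.IsGradFlow f Φ) (hf : S.IsTemporal f) (t : ℝ) (x : M)
    (v : E) : dfun f (Φ t x) (flowDeriv Φ t x v) = dfun f x v := by
  have h1 : HasMFDerivAt 𝓘(ℝ, E) 𝓘(ℝ, ℝ) (f ∘ Φ t) x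
      ((dfun f (Φ t x)).comp (flowDeriv Φ t x) : E →L[ℝ] ℝ) :=
    (hasMFDerivAt_dfun hf.1 (Φ t x)).comp x (hΦ.hasMFDerivAt hf t x)
  have h2 : HasMFDerivAt 𝓘(ℝ, E) 𝓘(ℝ, ℝ) (f ∘ Φ t) x (dfun f x : E →L[ℝ] ℝ) := by
    have e : f ∘ Φ t = (fun r => r - t) ∘ f := funext fun y => hΦ.apply hf t y
    rw [e]
    have h3 : HasMFDerivAt 𝓘(ℝ, ℝ) 𝓘(ℝ, ℝ) (fun r : ℝ => r - t) (f x)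
        (ContinuousLinearMap.id ℝ ℝ) :=
      ((hasFDerivAt_id (f x)).sub_const t).hasMFDerivAt
    exact (h3.comp x (hasMFDerivAt_dfun hf.1 x)).congr_mfderiv (ContinuousLinearMap.ext fun _ => rfl)
  exact congrArg (fun L : E →L[ℝ] ℝ => L v) (hasMFDerivAt_unique h1 h2)

/-- The flow carries the velocity of a curve by its derivative. -/
lemma hasVelocityAt_comp [T2Space M] (hΦ : S.IsGradFlow f Φ) (hf : S.IsTemporal f) (s : ℝ)
    {γ : ℝ → M} {v : E} {t : ℝ} (h : HasVelocityAt γ v t) :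
    HasVelocityAt (fun r => Φ s (γ r)) (flowDeriv Φ s (γ t) v) t := by
  refine ((hΦ.hasMFDerivAt hf s (γ t)).comp t h).congr_mfderiv ?_
  refine ContinuousLinearMap.ext_ring ?_
  change flowDeriv Φ s (γ t) ((1 : ℝ) • v) = (1 : ℝ) • flowDeriv Φ s (γ t) v
  rw [one_smul, one_smul]

/-- The flow carries the unit gradient to itself. -/
lemma flowDeriv_unitGrad [T2Space M] (hΦ : S.IsGradFlow f Φ) (hf : S.IsTemporal f) (t : ℝ) (x : M) :
    flowDeriv Φ t x (S.unitGrad f x) = S.unitGrad f (Φ t x) := by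
  have h1 := hΦ.hasVelocityAt_comp hf t (hΦ.isGradCurveOn x 0 (mem_univ 0))
  have h2 := hΦ.isGradCurveOn (Φ t x) 0 (mem_univ 0)
  have e : (fun r => Φ t (Φ r x)) = fun r => Φ r (Φ t x) := funext fun r => by
    rw [← hΦ.add hf, ← hΦ.add hf, add_comm]
  rw [e] at h1
  simp only [hΦ.zero] at h1 h2
  have : (1 : ℝ) • flowDeriv Φ t x (S.unitGrad f x) = (1 : ℝ) • S.unitGrad f (Φ t x) :=
    congrArg (fun L : ℝ →L[ℝ] E => L 1) (hasMFDerivAt_unique h1 h2)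
  rwa [one_smul, one_smul] at this

/-- The linearized flow in a chart. -/
lemma hasDerivAt_chartDeriv_flowDeriv_zero [T2Space M] (hΦ : S.IsGradFlow f Φ) (hf : S.IsTemporal f)
    (p : M) {x : M} (hx : x ∈ (extChartAt 𝓘(ℝ, E) p).source) (v : E) :
    HasDerivAt (fun t => chartDeriv p (Φ t x) (flowDeriv Φ t x v))
      (fderiv ℝ (coordGrad (coordMetric (conformal S.g f) p)
        (fun z => f ((extChartAt 𝓘(ℝ, E) p).symm z))) (extChartAt 𝓘(ℝ, E) p x)
        (chartDeriv p x v)) 0 := by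
  obtain ⟨r, hr, δ, hδ, α, A, -, h⟩ := hΦ.exists_chart hf p hx
  obtain ⟨h0, h1, h2⟩ := h x hx (Metric.mem_ball_self hr)
  have hd := ((h2 0 ⟨by linarith, hδ⟩).2.2.2.1).clm_apply (hasDerivAt_const 0 (chartDeriv p x v))
  rw [h0, h1] at hd
  simp only [ContinuousLinearMap.comp_id, map_zero, add_zero] at hd
  refine hd.congr_of_eventuallyEq ?_
  filter_upwards [Ioo_mem_nhds (show -δ < 0 by linarith) hδ] with t ht
  obtain ⟨k1, k2, -, -, k5⟩ := h2 t ht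
  have e : flowDeriv Φ t x v = chartSymmDeriv p (α (extChartAt 𝓘(ℝ, E) p x) t)
      (A (extChartAt 𝓘(ℝ, E) p x) t (chartDeriv p x v)) :=
    congrArg (fun L : E →L[ℝ] E => L v) k5.mfderiv
  rw [e, k2, chartDeriv_chartSymmDeriv p k1]

lemma hasDerivAt_chart [T2Space M] (hΦ : S.IsGradFlow f Φ) (hf : S.IsTemporal f)
    (p x : M) {t : ℝ} (hx : Φ t x ∈ (extChartAt 𝓘(ℝ, E) p).source) :
    HasDerivAt (fun s => extChartAt 𝓘(ℝ, E) p (Φ s x)) (coordGrad (coordMetric (conformal S.g f) p)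
        (fun z => f ((extChartAt 𝓘(ℝ, E) p).symm z)) (extChartAt 𝓘(ℝ, E) p (Φ t x))) t := by
  rw [coordGrad_unitGrad hf p hx]
  exact (hΦ.isGradCurveOn x t (mem_univ t)).hasDerivAt p hx

/-- The case `t = 0`, started at `Φ t x` with the vector already carried there, by the cocycle
identity `flowDeriv_add`. -/
lemma hasDerivAt_chartDeriv_flowDeriv [T2Space M] (hΦ : S.IsGradFlow f Φ) (hf : S.IsTemporal f)
    (p x : M) {t : ℝ} (hx : Φ t x ∈ (extChartAt 𝓘(ℝ, E) p).source) (v : E) :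
    HasDerivAt (fun s => chartDeriv p (Φ s x) (flowDeriv Φ s x v))
      (fderiv ℝ (coordGrad (coordMetric (conformal S.g f) p)
        (fun z => f ((extChartAt 𝓘(ℝ, E) p).symm z))) (extChartAt 𝓘(ℝ, E) p (Φ t x))
        (chartDeriv p (Φ t x) (flowDeriv Φ t x v))) t := by
  have h := hΦ.hasDerivAt_chartDeriv_flowDeriv_zero hf p hx (flowDeriv Φ t x v)
  rw [show (0 : ℝ) = t - t by ring] at h
  have h' := h.comp_sub_const t t
  refine h'.congr_of_eventuallyEq (Eventually.of_forall fun s => ?_)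
  have e : s = t + (s - t) := by ring
  change _ = chartDeriv p (Φ (s - t) (Φ t x)) (flowDeriv Φ (s - t) (Φ t x) (flowDeriv Φ t x v))
  have e2 : flowDeriv Φ (s - t) (Φ t x) (flowDeriv Φ t x v) = flowDeriv Φ (t + (s - t)) x v := by
    rw [hΦ.flowDeriv_add hf]; rfl
  rw [← hΦ.add hf, e2, ← e]

/-- Joint differentiability of the flow at time `0`. -/
lemma hasVelocityAt_of_time [T2Space M] (hΦ : S.IsGradFlow f Φ) (hf : S.IsTemporal f)
    {γ : ℝ → M} {v : E} {t : ℝ} (h : HasVelocityAt γ v t) {τ : ℝ → ℝ} {τ' : ℝ}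
    (hτ : HasDerivAt τ τ' t) (h0 : τ t = 0) :
    HasVelocityAt (fun s => Φ (τ s) (γ s)) (v + τ' • S.unitGrad f (γ t)) t := by
  set p := γ t with hp
  have hx := mem_extChartAt_source (I := 𝓘(ℝ, E)) p
  obtain ⟨r, hr, δ, hδ, α, A, hc, hα⟩ := hΦ.exists_chart hf p hx
  set X := coordGrad (coordMetric (conformal S.g f) p)
        (fun z => f ((extChartAt 𝓘(ℝ, E) p).symm z)) with hX
  set y₀ := extChartAt 𝓘(ℝ, E) p p with hy₀
  have hy₀t : y₀ ∈ (extChartAt 𝓘(ℝ, E) p).target := (extChartAt 𝓘(ℝ, E) p).map_source hx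
  have a0 : α y₀ 0 = y₀ := (hα p hx (Metric.mem_ball_self hr)).1
  have hXc : ContinuousAt X y₀ := (((isEikonalOn hf p).contDiffOn_coordGrad).contDiffAt
    ((isOpen_target p).mem_nhds hy₀t)).continuousAt
  have hXα : ContinuousAt (fun z : E × ℝ => X (α z.1 z.2)) (y₀, 0) :=
    ContinuousAt.comp (f := fun z : E × ℝ => α z.1 z.2) (g := X) (by simpa [a0] using hXc) hc
  have hderiv : HasFDerivAt (fun z : E × ℝ => α z.1 z.2)
      (ContinuousLinearMap.fst ℝ E ℝ + (ContinuousLinearMap.snd ℝ E ℝ).smulRight (X y₀)) (y₀, 0) := by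
    rw [hasFDerivAt_iff_isLittleO, Asymptotics.isLittleO_iff]
    intro c hcpos
    have hev := (Metric.continuousAt_iff'.mp hXα) c hcpos
    simp only [a0] at hev
    rw [Metric.eventually_nhds_iff_ball] at hev
    obtain ⟨ρ, hρ, hρ'⟩ := hev
    have htn : (extChartAt 𝓘(ℝ, E) p).target ∈ 𝓝 y₀ := (isOpen_target p).mem_nhds hy₀t
    filter_upwards [prod_mem_nhds (Filter.inter_mem htn
      (Metric.ball_mem_nhds y₀ (lt_min hr hρ))) (Ioo_mem_nhds
        (show -(min δ ρ) < 0 by simp [hδ, hρ]) (lt_min hδ hρ))] with z hz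
    obtain ⟨⟨hz1, hz2⟩, hz3⟩ := hz
    have hzs := (extChartAt 𝓘(ℝ, E) p).map_target hz1
    have hzr := (extChartAt 𝓘(ℝ, E) p).right_inv hz1
    have hαz := hα _ hzs (by
      rw [hzr]; exact Metric.ball_subset_ball (min_le_left _ _) hz2)
    rw [hzr] at hαz
    obtain ⟨b0, -, b2⟩ := hαz
    -- The time derivative of `α z s - s X(y₀)` is at most `c` near `(y₀, 0)`, and the value at time
    -- `0` is exactly `z`. Hence the error is at most `c |s|`.
    have hmean := (convex_uIcc (0 : ℝ) z.2).norm_image_sub_le_of_norm_hasDerivWithin_le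
      (f := fun s => α z.1 s - s • X y₀) (f' := fun s => X (α z.1 s) - X y₀) (C := c)
      (fun s hs => by
        have hs' : s ∈ Ioo (-(min δ ρ)) (min δ ρ) :=
          (ordConnected_Ioo.uIcc_subset ⟨by simp [hδ, hρ], lt_min hδ hρ⟩ hz3) hs
        have := (b2 s ⟨by linarith [hs'.1, min_le_left δ ρ], hs'.2.trans_le (min_le_left _ _)⟩).2.2.1
        have h5 := this.sub ((hasDerivAt_id s).smul_const (X y₀))
        rw [one_smul] at h5
        exact h5.hasDerivWithinAt)
      (fun s hs => by
        have hs' : s ∈ Ioo (-(min δ ρ)) (min δ ρ) :=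
          (ordConnected_Ioo.uIcc_subset ⟨by simp [hδ, hρ], lt_min hδ hρ⟩ hz3) hs
        have h6 := hρ' (z.1, s) (by
          rw [Metric.mem_ball, Prod.dist_eq]
          refine max_lt ((Metric.mem_ball.mp hz2).trans_le (min_le_right _ _)) ?_
          rw [Real.dist_eq, sub_zero]
          exact (abs_lt.mpr hs').trans_le (min_le_right _ _))
        rw [dist_eq_norm] at h6
        exact h6.le)
      left_mem_uIcc right_mem_uIcc
    simp only [b0, zero_smul, sub_zero, Real.norm_eq_abs] at hmean
    have e1 : α z.1 z.2 - α y₀ 0 - (ContinuousLinearMap.fst ℝ E ℝ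
        + (ContinuousLinearMap.snd ℝ E ℝ).smulRight (X y₀)) (z - (y₀, 0)) =
        α z.1 z.2 - z.2 • X y₀ - z.1 := by
      simp only [a0, add_apply, ContinuousLinearMap.coe_fst', Prod.fst_sub,
        ContinuousLinearMap.smulRight_apply, ContinuousLinearMap.coe_snd', Prod.snd_sub, sub_zero]
      abel
    rw [e1]
    refine hmean.trans ?_
    gcongr
    calc |z.2| = ‖(z - (y₀, 0)).2‖ := by simp
      _ ≤ _ := norm_snd_le _
  have hγ' := h.hasDerivAt p (by rw [← hp]; exact hx)
  have hpair : HasDerivAt (fun s => (extChartAt 𝓘(ℝ, E) p (γ s), τ s)) (chartDeriv p (γ t) v, τ') t :=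
    hγ'.prodMk hτ
  have hcomp : HasDerivAt (fun s => α (extChartAt 𝓘(ℝ, E) p (γ s)) (τ s))
      (chartDeriv p p v + τ' • X y₀) t := by
    have := HasFDerivAt.comp_hasDerivAt (f := fun s => (extChartAt 𝓘(ℝ, E) p (γ s), τ s)) t
      (by simpa only [h0, ← hp] using hderiv) hpair
    refine this.congr_deriv ?_
    simp [← hp]
  have hst : α (extChartAt 𝓘(ℝ, E) p (γ t)) (τ t) ∈ (extChartAt 𝓘(ℝ, E) p).target := by
    rw [h0, ← hp, a0]; exact hy₀t
  have hvel := hasVelocityAt_symm_comp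
    (α := fun s => α (extChartAt 𝓘(ℝ, E) p (γ s)) (τ s)) p hst hcomp
  have e2 : chartSymmDeriv p (α (extChartAt 𝓘(ℝ, E) p (γ t)) (τ t)) (chartDeriv p p v + τ' • X y₀) =
      v + τ' • S.unitGrad f p := by
    rw [h0, ← hp, a0, hX, coordGrad_unitGrad hf p hx, map_add, map_smul,
      chartSymmDeriv_chartDeriv p hx, chartSymmDeriv_chartDeriv p hx]
  rw [e2] at hvel
  refine HasMFDerivAt.congr_of_eventuallyEq hvel ?_
  filter_upwards [h.continuousAt.preimage_mem_nhds
      ((isOpen_extChartAt_source (I := 𝓘(ℝ, E)) p).mem_nhds hx),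
    hγ'.continuousAt.preimage_mem_nhds (Metric.ball_mem_nhds _ hr),
    hτ.continuousAt.preimage_mem_nhds (by rw [h0]; exact Ioo_mem_nhds (neg_lt_zero.mpr hδ) hδ)]
    with s hs1 hs2 hs3
  exact ((hα _ hs1 hs2).2.2 _ hs3).2.1

end IsGradFlow

end Spacetime

end Lorentz

namespace Lorentz

/-! ### Comparison of a pair of differential inequalities with `a'' = k a`. -/

section Comparison

/-- A coupled system of differential inequalities that preserves positivity. -/
lemma pos_of_coupled {p r p' r' k : ℝ → ℝ} {t₁ : ℝ}
    (hp : ∀ t, t₁ ≤ t → HasDerivAt p (p' t) t) (hr : ∀ t, t₁ ≤ t → HasDerivAt r (r' t) t)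
    (hk : ∀ t, t₁ ≤ t → 0 ≤ k t) (hpr : ∀ t, t₁ ≤ t → r t ≤ p' t)
    (hrp : ∀ t, t₁ ≤ t → k t * p t ≤ r' t) (hp0 : 0 < p t₁) (hr0 : 0 < r t₁) :
    ∀ t, t₁ ≤ t → 0 < p t := by
  by_contra! hcon
  obtain ⟨T, hT, hpT⟩ := hcon
  have hpc : ContinuousOn p (Icc t₁ T) := fun t ht => (hp t ht.1).continuousAt.continuousWithinAt
  have hrc : ContinuousOn r (Icc t₁ T) := fun t ht => (hr t ht.1).continuousAt.continuousWithinAt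
  set B := Icc t₁ T ∩ (fun t => min (p t) (r t)) ⁻¹' Iic 0 with hB
  have hBc : IsClosed B := (hpc.inf hrc).preimage_isClosed_of_isClosed isClosed_Icc isClosed_Iic
  have hBne : B.Nonempty := ⟨T, ⟨hT, le_rfl⟩, (min_le_left _ _).trans hpT⟩
  have hBb : BddBelow B := ⟨t₁, fun t ht => ht.1.1⟩
  -- The first time at which `p` or `r` fails to be positive. Up to then each makes the other
  -- nondecreasing, so both keep at least their positive initial values, a contradiction.
  set τ := sInf B with hτ
  have hτB : τ ∈ B := hBc.csInf_mem hBne hBb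
  have hgood : ∀ t ∈ Ico t₁ τ, 0 < p t ∧ 0 < r t := by
    intro t ht
    by_contra hc
    have : t ∈ B := by
      refine ⟨⟨ht.1, ht.2.le.trans hτB.1.2⟩, ?_⟩
      by_contra hlt
      exact hc (lt_min_iff.mp (not_le.mp hlt))
    exact absurd (csInf_le hBb this) (not_le.mpr ht.2)
  have hsub : Icc t₁ τ ⊆ Icc t₁ T := Icc_subset_Icc_right hτB.1.2
  have hpm : MonotoneOn p (Icc t₁ τ) := by
    refine monotoneOn_of_deriv_nonneg (convex_Icc _ _) (hpc.mono hsub)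
      (fun t ht => ?_) (fun t ht => ?_)
    · rw [interior_Icc] at ht
      exact (hp t ht.1.le).differentiableAt.differentiableWithinAt
    · rw [interior_Icc] at ht
      rw [(hp t ht.1.le).deriv]
      exact (hgood t ⟨ht.1.le, ht.2⟩).2.le.trans (hpr t ht.1.le)
  have hrm : MonotoneOn r (Icc t₁ τ) := by
    refine monotoneOn_of_deriv_nonneg (convex_Icc _ _) (hrc.mono hsub)
      (fun t ht => ?_) (fun t ht => ?_)
    · rw [interior_Icc] at ht
      exact (hr t ht.1.le).differentiableAt.differentiableWithinAt
    · rw [interior_Icc] at ht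
      rw [(hr t ht.1.le).deriv]
      exact (mul_nonneg (hk t ht.1.le) (hgood t ⟨ht.1.le, ht.2⟩).1.le).trans (hrp t ht.1.le)
  have h1 : t₁ ≤ τ := hτB.1.1
  have h2 := hpm ⟨le_rfl, h1⟩ ⟨h1, le_rfl⟩ h1
  have h3 := hrm ⟨le_rfl, h1⟩ ⟨h1, le_rfl⟩ h1
  exact absurd hτB.2 (not_le.mpr (lt_min (hp0.trans_le h2) (hr0.trans_le h3)))

/-- The left side is the derivative of `√(X + e)`; the shift by `e` keeps the square root
differentiable where `X` vanishes. -/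
lemma div_sqrt_le {D X Z k e : ℝ} (he : 0 < e) (hX : 0 ≤ X) (hk : 0 ≤ k)
    (h : |D| ≤ 2 * (k * (√X * √Z))) : D / (2 * √(X + e)) ≤ k * √Z := by
  have h0 : 0 < √(X + e) := Real.sqrt_pos.mpr (by linarith)
  have h1 : √X ≤ √(X + e) := Real.sqrt_le_sqrt (by linarith)
  rw [div_le_iff₀ (by positivity)]
  calc D ≤ 2 * (k * (√X * √Z)) := (le_abs_self D).trans h
    _ ≤ 2 * (k * (√(X + e) * √Z)) := by gcongr
    _ = _ := by ring

/-- Growth of solutions of the Jacobi inequality against the warping function `a`. -/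
lemma sqrt_le_of_jacobi {a a' k X Z X' Z' : ℝ → ℝ} {t₁ : ℝ}
    (ha : ∀ t, t₁ ≤ t → HasDerivAt a (a' t) t) (ha' : ∀ t, t₁ ≤ t → HasDerivAt a' (k t * a t) t)
    (hk : ∀ t, t₁ ≤ t → 0 ≤ k t)
    (hX : ∀ t, t₁ ≤ t → HasDerivAt X (X' t) t) (hZ : ∀ t, t₁ ≤ t → HasDerivAt Z (Z' t) t)
    (hX0 : ∀ t, t₁ ≤ t → 0 ≤ X t) (hZ0 : ∀ t, t₁ ≤ t → 0 ≤ Z t)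
    (hXb : ∀ t, t₁ ≤ t → |X' t| ≤ 2 * (√(X t) * √(Z t)))
    (hZb : ∀ t, t₁ ≤ t → |Z' t| ≤ 2 * (k t * (√(X t) * √(Z t))))
    (h1 : √(X t₁) < a t₁) (h2 : √(Z t₁) < a' t₁) : ∀ t, t₁ ≤ t → √(X t) ≤ a t := by
  have hlim : ∀ c : ℝ, Tendsto (fun e => √(c + e)) (𝓝[>] 0) (𝓝 √c) := fun c => by
    have h : Continuous fun e => √(c + e) := by fun_prop
    have := (h.tendsto 0).mono_left (nhdsWithin_le_nhds (s := Ioi 0))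
    simpa using this
  -- The initial inequalities are strict, so they survive a small shift.
  obtain ⟨e, ⟨he1, he2⟩, he⟩ := ((((hlim (X t₁)).eventually (gt_mem_nhds h1)).and
    ((hlim (Z t₁)).eventually (gt_mem_nhds h2))).and self_mem_nhdsWithin).exists
  have he : 0 < e := he
  intro t ht
  -- For `p = a - √(X + e)` and `r = a' - √(Z + e)` the hypotheses give `p' ≥ r` and `r' ≥ k p`.
  have key := pos_of_coupled (p := fun t => a t - √(X t + e)) (r := fun t => a' t - √(Z t + e))
    (p' := fun t => a' t - X' t / (2 * √(X t + e)))
    (r' := fun t => k t * a t - Z' t / (2 * √(Z t + e))) (k := k) (t₁ := t₁)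
    (fun t ht => (ha t ht).sub (((hX t ht).add_const e).sqrt (by linarith [hX0 t ht])))
    (fun t ht => (ha' t ht).sub (((hZ t ht).add_const e).sqrt (by linarith [hZ0 t ht])))
    hk
    (fun t ht => by
      have i1 := div_sqrt_le (k := 1) he (hX0 t ht) zero_le_one
        (by simpa using hXb t ht)
      have i2 : √(Z t) ≤ √(Z t + e) := Real.sqrt_le_sqrt (by linarith)
      linarith)
    (fun t ht => by
      have i1 := div_sqrt_le (k := k t) (D := Z' t) (Z := X t) he (hZ0 t ht) (hk t ht)
        (by rw [mul_comm (√(Z t))]; exact hZb t ht)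
      have i2 : √(X t) ≤ √(X t + e) := Real.sqrt_le_sqrt (by linarith)
      have i3 := mul_le_mul_of_nonneg_left i2 (hk t ht)
      rw [mul_sub]
      linarith)
    (sub_pos.mpr he1) (sub_pos.mpr he2) t ht
  have i2 : √(X t) ≤ √(X t + e) := Real.sqrt_le_sqrt (by linarith)
  linarith

end Comparison

/-! ### Shape operator, radial curvature and growth of the linearised flow. -/

namespace Spacetime

variable {E : Type*} [NormedAddCommGroup E] [NormedSpace ℝ E] [FiniteDimensional ℝ E]
  {M : Type*} [TopologicalSpace M] [ChartedSpace E M] [IsManifold 𝓘(ℝ, E) ∞ M]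
  {S : Spacetime E M} {f : M → ℝ} {Φ : ℝ → M → M}

/-- The endomorphism `v ↦ ∇_v U` of the tangent space at `x`, computed in the chart at `p`. -/
noncomputable def chartShape (S : Spacetime E M) (f : M → ℝ) (p x : M) : E →L[ℝ] E :=
  (chartSymmDeriv p (extChartAt 𝓘(ℝ, E) p x)).comp ((coordHess (coordMetric (conformal S.g f) p)
    (fun z => f ((extChartAt 𝓘(ℝ, E) p).symm z)) (extChartAt 𝓘(ℝ, E) p x)).comp (chartDeriv p x))

lemma chartDeriv_chartShape (p : M) {x : M} (hx : x ∈ (extChartAt 𝓘(ℝ, E) p).source) (v : E) :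
    chartDeriv p x (chartShape S f p x v) = coordHess (coordMetric (conformal S.g f) p)
      (fun z => f ((extChartAt 𝓘(ℝ, E) p).symm z)) (extChartAt 𝓘(ℝ, E) p x) (chartDeriv p x v) :=
  chartDeriv_chartSymmDeriv' p hx _

lemma dfun_chartShape (hf : S.IsTemporal f) (p : M) {x : M}
    (hx : x ∈ (extChartAt 𝓘(ℝ, E) p).source) (v : E) : dfun f x (chartShape S f p x v) = 0 := by
  rw [← conformal_unitGrad hf, conformal_symm, ← coordMetric_chartDeriv _ p hx,
    chartDeriv_chartShape p hx, ← coordGrad_unitGrad hf p hx]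
  exact (isEikonalOn hf p).apply_coordHess_coordGrad ((extChartAt 𝓘(ℝ, E) p).map_source hx) _

lemma conformal_sq_le (hf : S.IsTemporal f) (x : M) {v w : E} (hv : dfun f x v = 0)
    (hw : dfun f x w = 0) : (conformal S.g f).at x v w ^ 2 ≤
      (conformal S.g f).at x v v * (conformal S.g f).at x w w := by
  refine sq_le_mul_of_orthogonal (B := (conformal S.g f).at x) (u := S.unitGrad f x)
    (conformal_symm x) (fun w hw hw0 => ?_) ?_ ?_
  · rw [conformal_unitGrad hf] at hw
    exact conformal_pos hf x hw hw0
  · rwa [conformal_unitGrad hf]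
  · rwa [conformal_unitGrad hf]

lemma conformal_nonneg (hf : S.IsTemporal f) (x : M) {v : E} (hv : dfun f x v = 0) :
    0 ≤ (conformal S.g f).at x v v := by
  by_cases h : v = 0
  · simp [h]
  · exact (conformal_pos hf x hv h).le

lemma abs_conformal_le (hf : S.IsTemporal f) (x : M) {v w : E} (hv : dfun f x v = 0)
    (hw : dfun f x w = 0) : |(conformal S.g f).at x v w| ≤
      √((conformal S.g f).at x v v) * √((conformal S.g f).at x w w) := by
  rw [← Real.sqrt_mul (conformal_nonneg hf x hv)]
  exact Real.abs_le_sqrt (conformal_sq_le hf x hv hw)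

/-- The bilinear form `⟨R(U, v)U, w⟩` of the conformal metric. -/
noncomputable def radialCurvature (S : Spacetime E M) (f : M → ℝ) (q : M) (v w : E) : ℝ :=
  curvature (conformal S.g f) q (S.unitGrad f q) v (S.unitGrad f q) w

/-- `w ↦ ⟨R(U, v)U, w⟩` is homogeneous in both arguments. -/
lemma curvature_smul_smul (hf : S.IsTemporal f) (q : M) (c d : ℝ) (v w : E) :
    S.radialCurvature f q (c • v) (d • w) =
      c * d * S.radialCurvature f q v w := by
  have hq := mem_extChartAt_source (I := 𝓘(ℝ, E)) q
  have hy := (extChartAt 𝓘(ℝ, E) q).map_source hq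
  have key : ∀ v w : E, S.radialCurvature f q v w =
      coordMetric (conformal S.g f) q (extChartAt 𝓘(ℝ, E) q q)
        (coordCurvature (coordMetric (conformal S.g f) q) (extChartAt 𝓘(ℝ, E) q q)
          (chartDeriv q q (S.unitGrad f q)) (chartDeriv q q v) (chartDeriv q q (S.unitGrad f q)))
        (chartDeriv q q w) := fun _ _ => rfl
  -- The Riccati equation expresses `R(U, v)U` through operators that are visibly linear in `v`.
  rw [key, key, ← coordGrad_unitGrad hf q hq,
    ← (isEikonalOn hf q).fderiv_coordHess_eq_coordCurvature hy,
    ← (isEikonalOn hf q).fderiv_coordHess_eq_coordCurvature hy]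
  simp only [← christoffelL_apply, map_smul, map_add, add_apply, smul_apply, smul_eq_mul]
  ring

/-- The two-sided curvature bound contained in the curvature constraint. -/
lemma abs_curvature_le (hf : S.IsTemporal f) {n : ℕ} (hn : 1 ≤ n) {q : M} {k : ℝ}
    (h : ∀ v w : E, dfun f q v = 0 → dfun f q w = 0 → (conformal S.g f).at q v v = 1 →
      (conformal S.g f).at q w w = 1 →
      -k ≤ √(n : ℝ) * S.radialCurvature f q v w)
    {v w : E} (hv : dfun f q v = 0) (hw : dfun f q w = 0) :
    |S.radialCurvature f q v w| ≤
      k * (√((conformal S.g f).at q v v) * √((conformal S.g f).at q w w)) := by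
  by_cases hv0 : v = 0
  · have := curvature_smul_smul hf q 0 1 (0 : E) w
    simp only [zero_smul, one_smul, zero_mul] at this
    rw [hv0, this]
    simp
  by_cases hw0 : w = 0
  · have := curvature_smul_smul hf q 1 0 v (0 : E)
    simp only [zero_smul, one_smul, mul_zero, zero_mul] at this
    rw [hw0, this]
    simp
  have hvp := conformal_pos hf q hv hv0
  have hwp := conformal_pos hf q hw hw0
  set c := √((conformal S.g f).at q v v) with hc
  set d := √((conformal S.g f).at q w w) with hd
  have hc0 : 0 < c := Real.sqrt_pos.mpr hvp
  have hd0 : 0 < d := Real.sqrt_pos.mpr hwp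
  have hcc : c * c = (conformal S.g f).at q v v := Real.mul_self_sqrt hvp.le
  have hdd : d * d = (conformal S.g f).at q w w := Real.mul_self_sqrt hwp.le
  have hunit : ∀ (u : E) (b s : ℝ), 0 < b → b * b = (conformal S.g f).at q u u → s * s = 1 →
      (conformal S.g f).at q ((s * b⁻¹) • u) ((s * b⁻¹) • u) = 1 := by
    intro u b s hb hbb hs
    simp only [map_smul, smul_apply, smul_eq_mul, ← hbb]
    have : b ≠ 0 := hb.ne'
    field_simp
    rw [pow_two, hs]
  -- The constraint is tested on the normalised pairs `(v, w)` and `(v, -w)`, which turns the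
  -- one-sided bound into a two-sided one. The factor `√n ≥ 1` is then discarded.
  have h1 := h ((1 * c⁻¹) • v) ((1 * d⁻¹) • w) (by simp [hv]) (by simp [hw])
    (hunit v c 1 hc0 hcc (by norm_num)) (hunit w d 1 hd0 hdd (by norm_num))
  have h2 := h ((1 * c⁻¹) • v) (((-1) * d⁻¹) • w) (by simp [hv]) (by simp [hw])
    (hunit v c 1 hc0 hcc (by norm_num)) (hunit w d (-1) hd0 hdd (by norm_num))
  rw [curvature_smul_smul hf] at h1 h2
  set R := S.radialCurvature f q v w
  have hn1 : (1 : ℝ) ≤ √(n : ℝ) := by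
    rw [Real.one_le_sqrt]; exact_mod_cast hn
  have h3 : √(n : ℝ) * (|R| / (c * d)) ≤ k := by
    rcases abs_cases R with ⟨e, -⟩ | ⟨e, -⟩ <;> rw [e]
    · have : √(n : ℝ) * (1 * c⁻¹ * (-1 * d⁻¹) * R) = -(√(n : ℝ) * (R / (c * d))) := by
        field_simp
      linarith
    · have : √(n : ℝ) * (1 * c⁻¹ * (1 * d⁻¹) * R) = -(√(n : ℝ) * (-R / (c * d))) := by
        field_simp
      linarith
  have h4 : |R| / (c * d) ≤ k :=
    (le_mul_of_one_le_left (by positivity) hn1).trans h3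
  rwa [div_le_iff₀ (by positivity)] at h4

namespace IsGradFlow

variable [T2Space M]

lemma eventually_mem_source (hΦ : S.IsGradFlow f Φ) (p x : M) {t : ℝ}
    (hx : Φ t x ∈ (extChartAt 𝓘(ℝ, E) p).source) :
    ∀ᶠ s in 𝓝 t, Φ s x ∈ (extChartAt 𝓘(ℝ, E) p).source :=
  (hΦ.continuous_time x).continuousAt.preimage_mem_nhds ((isOpen_extChartAt_source p).mem_nhds hx)

/-- The first variation of the metric along the flow. -/
lemma hasDerivAt_conformal (hΦ : S.IsGradFlow f Φ) (hf : S.IsTemporal f) (p x : M) {t : ℝ}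
    (hx : Φ t x ∈ (extChartAt 𝓘(ℝ, E) p).source) (v w : E) :
    HasDerivAt (fun s => (conformal S.g f).at (Φ s x) (flowDeriv Φ s x v) (flowDeriv Φ s x w))
      (2 * (conformal S.g f).at (Φ t x) (chartShape S f p (Φ t x) (flowDeriv Φ t x v))
        (flowDeriv Φ t x w)) t := by
  have h := (isEikonalOn hf p).hasDerivAt_metric (hΦ.hasDerivAt_chart hf p x hx)
    ((extChartAt 𝓘(ℝ, E) p).map_source hx) (hΦ.hasDerivAt_chartDeriv_flowDeriv hf p x hx v)
    (hΦ.hasDerivAt_chartDeriv_flowDeriv hf p x hx w)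
  simp only [← chartDeriv_chartShape p hx] at h
  rw [coordMetric_chartDeriv _ p hx] at h
  refine h.congr_of_eventuallyEq ?_
  filter_upwards [hΦ.eventually_mem_source p x hx] with s hs
  exact (coordMetric_chartDeriv _ p hs _ _).symm

/-- Each side, paired with `w`, is half the time derivative of the metric pulled back by the flow,
which does not refer to a chart. -/
lemma chartShape_eq (hΦ : S.IsGradFlow f Φ) (hf : S.IsTemporal f) (p p' : M) {x : M}
    (hx : x ∈ (extChartAt 𝓘(ℝ, E) p).source) (hx' : x ∈ (extChartAt 𝓘(ℝ, E) p').source) :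
    chartShape S f p x = chartShape S f p' x := by
  ext v
  have h0 : Φ 0 x = x := hΦ.zero x
  have key : ∀ w, (conformal S.g f).at x (chartShape S f p x v) w =
      (conformal S.g f).at x (chartShape S f p' x v) w := by
    intro w
    have h1 := hΦ.hasDerivAt_conformal hf p x (t := 0) (by rwa [h0]) v w
    have h2 := hΦ.hasDerivAt_conformal hf p' x (t := 0) (by rwa [h0]) v w
    have := h1.unique h2
    rw [h0, hΦ.flowDeriv_zero] at this
    exact mul_left_cancel₀ two_ne_zero this
  obtain ⟨e, he⟩ := isInvertible_conformal hf x
  apply e.injective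
  have h3 : ∀ z, e z = (conformal S.g f).at x z := fun z => by rw [← he]; rfl
  rw [h3, h3]
  exact ContinuousLinearMap.ext key

/-- The Riccati equation along the flow. -/
lemma hasDerivAt_shape (hΦ : S.IsGradFlow f Φ) (hf : S.IsTemporal f) (x : M) (t : ℝ) (v : E) :
    HasDerivAt (fun s => (conformal S.g f).at (Φ s x)
        (chartShape S f (Φ s x) (Φ s x) (flowDeriv Φ s x v))
        (chartShape S f (Φ s x) (Φ s x) (flowDeriv Φ s x v)))
      (2 * S.radialCurvature f (Φ t x) (flowDeriv Φ t x v) (chartShape S f (Φ t x) (Φ t x) (flowDeriv Φ t x v))) t := by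
  set p := Φ t x with hp
  have hx : Φ t x ∈ (extChartAt 𝓘(ℝ, E) p).source := mem_extChartAt_source (I := 𝓘(ℝ, E)) p
  have h := (isEikonalOn hf p).hasDerivAt_coordHess (hΦ.hasDerivAt_chart hf p x hx)
    ((extChartAt 𝓘(ℝ, E) p).map_source hx) (hΦ.hasDerivAt_chartDeriv_flowDeriv hf p x hx v)
  rw [← chartDeriv_chartShape p hx, coordGrad_unitGrad hf p hx] at h
  refine (h.congr_deriv rfl).congr_of_eventuallyEq ?_
  filter_upwards [hΦ.eventually_mem_source p x hx] with s hs
  rw [hΦ.chartShape_eq hf (Φ s x) p (mem_extChartAt_source (I := 𝓘(ℝ, E)) _) hs,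
    ← coordMetric_chartDeriv _ p hs, chartDeriv_chartShape p hs]

/-- Growth of the linearized flow against the warping function. -/
lemma sqrt_conformal_flowDeriv_le (hΦ : S.IsGradFlow f Φ) (hf : S.IsTemporal f)
    {a a' k : ℝ → ℝ} {t₀ : ℝ} (ha : ∀ t, t₀ < t → HasDerivAt a (a' t) t)
    (ha' : ∀ t, t₀ < t → HasDerivAt a' (k t * a t) t) (hk : ∀ t, t₀ < t → 0 ≤ k t)
    (hcurv : ∀ q, f q < -t₀ → ∀ v w, dfun f q v = 0 → dfun f q w = 0 →
      |S.radialCurvature f q v w| ≤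
      k (-f q) * (√((conformal S.g f).at q v v) * √((conformal S.g f).at q w w)))
    {x : M} (hx : f x < -t₀) {v : E} (hv : dfun f x v = 0)
    (h1 : √((conformal S.g f).at x v v) < a (-f x))
    (h2 : √((conformal S.g f).at x (chartShape S f x x v) (chartShape S f x x v)) < a' (-f x))
    {s : ℝ} (hs : 0 ≤ s) :
    √((conformal S.g f).at (Φ s x) (flowDeriv Φ s x v) (flowDeriv Φ s x v)) ≤ a (-f (Φ s x)) := by
  have hdf : ∀ s, dfun f (Φ s x) (flowDeriv Φ s x v) = 0 := fun s => by
    rw [hΦ.dfun_flowDeriv hf, hv]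
  have hdS : ∀ s, dfun f (Φ s x) (chartShape S f (Φ s x) (Φ s x) (flowDeriv Φ s x v)) = 0 := fun s =>
    dfun_chartShape hf _ (mem_extChartAt_source (I := 𝓘(ℝ, E)) _) _
  have hfs : ∀ s, f (Φ s x) = f x - s := fun s => hΦ.apply hf s x
  -- The argument of `a` is `-f`, which equals `s - f x` at flow time `s`; hence the shift by `-f
  -- x`.
  have key := sqrt_le_of_jacobi (a := fun s => a (s + -f x)) (a' := fun s => a' (s + -f x))
    (k := fun s => k (s + -f x)) (t₁ := 0)
    (X := fun s => (conformal S.g f).at (Φ s x) (flowDeriv Φ s x v) (flowDeriv Φ s x v))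
    (Z := fun s => (conformal S.g f).at (Φ s x)
        (chartShape S f (Φ s x) (Φ s x) (flowDeriv Φ s x v))
        (chartShape S f (Φ s x) (Φ s x) (flowDeriv Φ s x v)))
    (fun s hs => (ha (s + -f x) (by linarith)).comp_add_const s (-f x))
    (fun s hs => (ha' (s + -f x) (by linarith)).comp_add_const s (-f x))
    (fun s hs => hk _ (by linarith))
    (fun s _ => hΦ.hasDerivAt_conformal hf (Φ s x) x (mem_extChartAt_source (I := 𝓘(ℝ, E)) _) v v)
    (fun s _ => hΦ.hasDerivAt_shape hf x s v)
    (fun s _ => conformal_nonneg hf _ (hdf s))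
    (fun s _ => conformal_nonneg hf _ (hdS s))
    (fun s _ => by
      rw [abs_mul, abs_two, mul_comm (√_)]
      exact mul_le_mul_of_nonneg_left (abs_conformal_le hf _ (hdS s) (hdf s)) zero_le_two)
    (fun s hs => by
      rw [abs_mul, abs_two]
      have := hcurv (Φ s x) (by rw [hfs]; linarith) _ _ (hdf s) (hdS s)
      rw [show -f (Φ s x) = s + -f x by rw [hfs]; ring] at this
      exact mul_le_mul_of_nonneg_left this zero_le_two)
    (by simpa [hΦ.zero, hΦ.flowDeriv_zero] using h1)
    (by simpa [hΦ.zero, hΦ.flowDeriv_zero] using h2) s hs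
  rw [show -f (Φ s x) = s + -f x by rw [hfs]; ring]
  exact key

end IsGradFlow

end Spacetime

end Lorentz

/-! ### Time change, drifting curves and the connection of orbits. -/

namespace Lorentz

/-- If `∫ 1/a = ∞`, the time change with `s' = 1/(2a)` runs from `0` to `1` in finite time. -/
lemma exists_time_change {a : ℝ → ℝ} (ha : ContinuousOn a (Ici 0)) (hpos : ∀ t, 0 ≤ t → 0 < a t)
    (hint : (∫⁻ t in Ici (0 : ℝ), ENNReal.ofReal (1 / a t)) = ⊤) {T : ℝ} (hT : 0 < T) :
    ∃ (s : ℝ → ℝ) (Θ : ℝ), T < Θ ∧ s T = 0 ∧ s Θ = 1 ∧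
      ∀ θ ∈ Icc T Θ, s θ ∈ Icc (0 : ℝ) 1 ∧ HasDerivAt s (1 / (2 * a θ)) θ := by
  have hc : ContinuousOn (fun t => 1 / (2 * a t)) (Ici 0) :=
    continuousOn_const.div (continuousOn_const.mul ha) fun t ht => by
      have := hpos t ht
      positivity
  have hi : ∀ {u v : ℝ}, 0 ≤ u → 0 ≤ v →
      IntervalIntegrable (fun t => 1 / (2 * a t)) volume u v := fun hu hv =>
    (hc.mono fun t ht => (le_min hu hv).trans ht.1).intervalIntegrable
  set s : ℝ → ℝ := fun θ => ∫ t in T..θ, 1 / (2 * a t) with hs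
  have hd : ∀ θ, T ≤ θ → HasDerivAt s (1 / (2 * a θ)) θ := by
    intro θ hθ
    have h0 : 0 < θ := hT.trans_le hθ
    refine intervalIntegral.integral_hasDerivAt_right (hi hT.le h0.le) ?_
      (hc.continuousAt (Ici_mem_nhds h0))
    exact ContinuousOn.stronglyMeasurableAtFilter isOpen_Ioi (hc.mono Ioi_subset_Ici_self) θ h0
  have hsc : ContinuousOn s (Ici T) := fun θ hθ => (hd θ hθ).continuousAt.continuousWithinAt
  have hmono : MonotoneOn s (Ici T) := by
    refine monotoneOn_of_deriv_nonneg (convex_Ici T) hsc (fun θ hθ => ?_) (fun θ hθ => ?_)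
    · rw [interior_Ici] at hθ
      exact (hd θ (le_of_lt hθ)).differentiableAt.differentiableWithinAt
    · rw [interior_Ici] at hθ
      rw [(hd θ (le_of_lt hθ)).deriv]
      have := hpos θ (hT.le.trans (le_of_lt hθ))
      positivity
  have hs0 : s T = 0 := by simp [hs]
  -- If `s` stayed below `1`, then `1/(2a)` would be integrable on `(T, ∞)`, against the divergence
  -- of `∫ 1/a`.
  obtain ⟨Θ₁, hΘ₁, hΘ₁'⟩ : ∃ Θ, T ≤ Θ ∧ 1 ≤ s Θ := by
    by_contra! hcon
    have h1 : IntegrableOn (fun t => 1 / (2 * a t)) (Ioi T) := by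
      refine integrableOn_Ioi_of_intervalIntegral_norm_bounded (l := atTop) (b := fun n : ℕ => T + n)
        1 T (fun n => ?_) (tendsto_atTop_add_const_left _ _ tendsto_natCast_atTop_atTop) ?_
      · have hn : T ≤ T + (n : ℝ) := by simp
        exact (intervalIntegrable_iff_integrableOn_Ioc_of_le hn).mp (hi hT.le (by positivity))
      · refine Eventually.of_forall fun n => ?_
        have hn : T ≤ T + (n : ℝ) := by simp
        have : ∫ t in T..(T + n), ‖1 / (2 * a t)‖ = s (T + n) := by
          refine intervalIntegral.integral_congr fun t ht => ?_
          rw [uIcc_of_le hn] at ht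
          have := hpos t (hT.le.trans ht.1)
          exact abs_of_pos (by positivity)
        rw [this]
        exact (hcon _ hn).le
    have h2 : IntegrableOn (fun t => 1 / (2 * a t)) (Icc 0 T) :=
      (hc.mono Icc_subset_Ici_self).integrableOn_Icc
    have h3 : IntegrableOn (fun t => 1 / a t) (Ici 0) := by
      rw [← Icc_union_Ioi_eq_Ici hT.le]
      refine ((h2.union h1).const_mul 2).congr (Eventually.of_forall fun t => ?_)
      simp only
      ring
    have h4 : ∀ᵐ t ∂volume.restrict (Ici (0 : ℝ)), 0 ≤ 1 / a t :=
      (ae_restrict_iff' measurableSet_Ici).mpr (Eventually.of_forall fun t ht =>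
        (one_div_pos.mpr (hpos t ht)).le)
    rw [← ofReal_integral_eq_lintegral_ofReal h3 h4] at hint
    exact ENNReal.ofReal_ne_top hint
  obtain ⟨Θ, hΘ, hΘ1⟩ := intermediate_value_Icc hΘ₁ (hsc.mono Icc_subset_Ici_self)
    (show (1 : ℝ) ∈ Icc (s T) (s Θ₁) from ⟨by rw [hs0]; norm_num, hΘ₁'⟩)
  have hTΘ : T < Θ := by
    refine lt_of_le_of_ne hΘ.1 fun h => ?_
    rw [← h, hs0] at hΘ1
    norm_num at hΘ1
  refine ⟨s, Θ, hTΘ, hs0, hΘ1, fun θ hθ => ⟨⟨?_, ?_⟩, hd θ hθ.1⟩⟩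
  · rw [← hs0]; exact hmono self_mem_Ici hθ.1 hθ.1
  · rw [← hΘ1]; exact hmono hθ.1 hΘ.1 hθ.2

namespace Spacetime

variable {E : Type*} [NormedAddCommGroup E] [NormedSpace ℝ E] [FiniteDimensional ℝ E]
  {M : Type*} [TopologicalSpace M] [ChartedSpace E M] [IsManifold 𝓘(ℝ, E) ∞ M]
  {S : Spacetime E M} {f : M → ℝ} {Φ : ℝ → M → M}

/-- `a`, with `a'' = k a`, bounds the radial curvature at the points with `f < -t₀`. -/
structure IsWarping (S : Spacetime E M) (f : M → ℝ) (a a' k : ℝ → ℝ) (t₀ : ℝ) : Prop where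
  nonneg : 0 ≤ t₀
  continuousOn : ContinuousOn a (Ici 0)
  pos : ∀ t, 0 ≤ t → 0 < a t
  hasDerivAt : ∀ t, t₀ < t → HasDerivAt a (a' t) t
  hasDerivAt_deriv : ∀ t, t₀ < t → HasDerivAt a' (k t * a t) t
  coeff_nonneg : ∀ t, t₀ < t → 0 ≤ k t
  deriv_pos : ∀ t, t₀ < t → 0 < a' t
  lintegral : (∫⁻ t in Ici (0 : ℝ), ENNReal.ofReal (1 / a t)) = ⊤
  abs_curvature_le : ∀ q, f q < -t₀ → ∀ v w, dfun f q v = 0 → dfun f q w = 0 →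
    |S.radialCurvature f q v w| ≤
      k (-f q) * (√((conformal S.g f).at q v v) * √((conformal S.g f).at q w w))

/-- The level sets of `f` have positive dimension, so the curvature constraint is not vacuous; this
is what forces `a'' ≥ 0`. -/
lemma exists_unit_orthogonal (hf : S.IsTemporal f) (hdim : 2 ≤ Module.finrank ℝ E) (q : M) :
    ∃ v : E, dfun f q v = 0 ∧ (conformal S.g f).at q v v = 1 := by
  have hker : LinearMap.ker (dfun (E := E) f q).toLinearMap ≠ ⊥ :=
    LinearMap.ker_ne_bot_of_finrank_lt (by rw [Module.finrank_self]; omega)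
  obtain ⟨v, hv, hv0⟩ := Submodule.exists_mem_ne_zero_of_ne_bot hker
  have hv : dfun f q v = 0 := hv
  have hp := conformal_pos hf q hv hv0
  refine ⟨(√((conformal S.g f).at q v v))⁻¹ • v, by simp [hv], ?_⟩
  have hs : √((conformal S.g f).at q v v) ≠ 0 := (Real.sqrt_pos.mpr hp).ne'
  have e : (conformal S.g f).at q v v =
    √((conformal S.g f).at q v v) * √((conformal S.g f).at q v v) := (Real.mul_self_sqrt hp.le).symm
  simp only [map_smul, smul_apply, smul_eq_mul]
  generalize √((conformal S.g f).at q v v) = c at *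
  rw [e]
  field_simp

/-- Adding the constraints for `(v, v)` and `(v, -v)` cancels the curvature and leaves `a''/a ≥ 0`
at each `t ≥ t₀`. This uses a point with `f = -t`, whence `hrange`. So `a'` is nondecreasing there
and stays positive. -/
lemma exists_isWarping (hf : S.IsTemporal f) {n : ℕ} (hn : 1 ≤ n)
    (hdim : Module.finrank ℝ E = n + 1) (hrange : ∀ r, ∃ q, f q = r)
    (hcurv : CurvatureConstraint n (conformal S.g f) f) :
    ∃ a a' k t₀, S.IsWarping f a a' k t₀ := by
  obtain ⟨a, t₀, hsm, hpos, ht₀, hder, hint, hR⟩ := hcurv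
  set k : ℝ → ℝ := fun t => iteratedDerivWithin 2 a (Ici 0) t / a t with hk
  have hR' : ∀ t, t₀ ≤ t → ∀ q, f q = -t → ∀ v w : E, dfun f q v = 0 → dfun f q w = 0 →
      (conformal S.g f).at q v v = 1 → (conformal S.g f).at q w w = 1 →
      -k t ≤ √(n : ℝ) * S.radialCurvature f q v w := fun t ht q hq v w hv hw h1 h2 =>
    hR t ht q hq v w ((conformal_unitGrad hf q v).trans hv) ((conformal_unitGrad hf q w).trans hw)
      h1 h2
  have hk0 : ∀ t, t₀ ≤ t → 0 ≤ k t := by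
    intro t ht
    obtain ⟨q, hq⟩ := hrange (-t)
    obtain ⟨v, hv, hv1⟩ := exists_unit_orthogonal hf (by omega : 2 ≤ Module.finrank ℝ E) q
    have h1 := hR' t ht q hq v v hv hv hv1 hv1
    have h2 := hR' t ht q hq ((1 : ℝ) • v) ((-1 : ℝ) • v) (by simp [hv]) (by simp [hv])
      (by simp [hv1]) (by simp [hv1])
    rw [curvature_smul_smul hf] at h2
    linarith
  -- Strict inequality makes `t` interior to `[0, ∞)`, where one-sided and ordinary derivatives
  -- agree; this is needed when `t₀ = 0`.
  have hnhds : ∀ t, t₀ < t → Ici (0 : ℝ) ∈ 𝓝 t := fun t ht => Ici_mem_nhds (ht₀.trans_lt ht)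
  have hd1 : ∀ t, t₀ < t → HasDerivAt a (derivWithin a (Ici 0) t) t := fun t ht =>
    (((hsm.differentiableOn (by simp)) t (ht₀.trans ht.le)).hasDerivWithinAt).hasDerivAt (hnhds t ht)
  have hdsm : ContDiffOn ℝ ∞ (derivWithin a (Ici 0)) (Ici 0) :=
    hsm.derivWithin (uniqueDiffOn_Ici 0) (by simp)
  have hd2' : ∀ t, t₀ < t → HasDerivAt (derivWithin a (Ici 0))
      (derivWithin (derivWithin a (Ici 0)) (Ici 0) t) t := fun t ht =>
    (((hdsm.differentiableOn (by simp)) t (ht₀.trans ht.le)).hasDerivWithinAt).hasDerivAt (hnhds t ht)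
  have hd2 : ∀ t, t₀ < t → HasDerivAt (derivWithin a (Ici 0)) (k t * a t) t := by
    intro t ht
    refine (hd2' t ht).congr_deriv ?_
    have h2 : iteratedDerivWithin 2 a (Ici 0) = derivWithin (derivWithin a (Ici 0)) (Ici 0) := by
      rw [show (2 : ℕ) = 0 + 1 + 1 from rfl, iteratedDerivWithin_succ, iteratedDerivWithin_succ,
        iteratedDerivWithin_zero]
    have := hpos t (ht₀.trans ht.le)
    simp only [hk]
    rw [h2, div_mul_cancel₀ _ this.ne']
  have hmono : MonotoneOn (derivWithin a (Ici 0)) (Ici t₀) := by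
    refine monotoneOn_of_deriv_nonneg (convex_Ici t₀)
      (hdsm.continuousOn.mono (Ici_subset_Ici.mpr ht₀)) (fun t ht => ?_) (fun t ht => ?_)
    · rw [interior_Ici] at ht
      exact (hd2 t ht).differentiableAt.differentiableWithinAt
    · rw [interior_Ici] at ht
      rw [(hd2 t ht).deriv]
      exact mul_nonneg (hk0 t (le_of_lt ht)) (hpos t (ht₀.trans (le_of_lt ht))).le
  exact ⟨a, derivWithin a (Ici 0), k, t₀, ht₀, hsm.continuousOn, fun t ht => hpos t ht, hd1, hd2,
    fun t ht => hk0 t ht.le, fun t ht => hder.trans_le (hmono self_mem_Ici ht.le ht.le), hint,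
    fun q hq v w hv hw => abs_curvature_le hf hn (fun v w hv hw h1 h2 =>
      hR' (-f q) (by linarith) q (by ring) v w hv hw h1 h2) hv hw⟩

namespace IsGradFlow

variable [T2Space M] {a a' k : ℝ → ℝ} {t₀ : ℝ}

lemma exists_apply_eq [Nonempty M] (hΦ : S.IsGradFlow f Φ) (hf : S.IsTemporal f) (r : ℝ) :
    ∃ q, f q = r := by
  obtain ⟨x⟩ := ‹Nonempty M›
  exact ⟨Φ (f x - r) x, by rw [hΦ.apply hf]; ring⟩

/-- Short coordinate vectors near `p` satisfy the initial bounds of the growth estimate. -/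
lemma exists_ball (hΦ : S.IsGradFlow f Φ) (hf : S.IsTemporal f) (hw : S.IsWarping f a a' k t₀)
    {p : M} (hp : f p < -t₀) :
    ∃ ρ > 0, Metric.ball (extChartAt 𝓘(ℝ, E) p p) ρ ⊆ (extChartAt 𝓘(ℝ, E) p).target ∧
      ∀ x ∈ (extChartAt 𝓘(ℝ, E) p).source,
      extChartAt 𝓘(ℝ, E) p x ∈ Metric.ball (extChartAt 𝓘(ℝ, E) p p) ρ → ∀ u : E,
      ‖chartDeriv p x u‖ < ρ → f x < -t₀ ∧ -f x < -f p + 1 ∧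
        √((conformal S.g f).at x (u + dfun f x u • S.unitGrad f x)
          (u + dfun f x u • S.unitGrad f x)) < a (-f x) ∧
        √((conformal S.g f).at x (chartShape S f x x (u + dfun f x u • S.unitGrad f x))
          (chartShape S f x x (u + dfun f x u • S.unitGrad f x))) < a' (-f x) := by
  set y₀ := extChartAt 𝓘(ℝ, E) p p with hy₀
  have hps := mem_extChartAt_source (I := 𝓘(ℝ, E)) p
  have hy₀t : y₀ ∈ (extChartAt 𝓘(ℝ, E) p).target := (extChartAt 𝓘(ℝ, E) p).map_source hps
  set G := coordMetric (conformal S.g f) p with hG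
  set F : E → ℝ := fun z => f ((extChartAt 𝓘(ℝ, E) p).symm z) with hF
  have hE := isEikonalOn hf p
  have htn := (isOpen_target p).mem_nhds hy₀t
  have cF : ContinuousAt F y₀ := (hE.smooth_fun.contDiffAt htn).continuousAt
  have cF' : ContinuousAt (fderiv ℝ F) y₀ := (hE.contDiffOn_fderiv.contDiffAt htn).continuousAt
  have cG : ContinuousAt G y₀ := (hE.smooth.contDiffAt htn).continuousAt
  have cX : ContinuousAt (coordGrad G F) y₀ := (hE.contDiffOn_coordGrad.contDiffAt htn).continuousAt
  have cN : ContinuousAt (coordHess G F) y₀ := (hE.contDiffOn_coordHess.contDiffAt htn).continuousAt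
  have hF0 : F y₀ = f p := by simp only [hF, hy₀, (extChartAt 𝓘(ℝ, E) p).left_inv hps]
  have l1 : ∀ {W : Type _} [TopologicalSpace W] {h : E → W}, ContinuousAt h y₀ →
      ContinuousAt (fun z : E × E => h z.1) (y₀, 0) := fun hc =>
    ContinuousAt.comp (f := Prod.fst) (x := (y₀, (0 : E))) hc continuousAt_fst
  have cF₁ : ContinuousAt (fun z : E × E => F z.1) (y₀, 0) :=
    ContinuousAt.comp (f := Prod.fst) (x := (y₀, (0 : E))) cF continuousAt_fst
  -- The vector `u + df(u) U` is the projection of `u` along `U` onto the kernel of `df`.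
  have cP : ContinuousAt (fun z : E × E => z.2 + fderiv ℝ F z.1 z.2 • coordGrad G F z.1) (y₀, 0) :=
    continuousAt_snd.add (((l1 cF').clm_apply continuousAt_snd).smul (l1 cX))
  have c1 : ContinuousAt (fun z : E × E => √(G z.1 (z.2 + fderiv ℝ F z.1 z.2 • coordGrad G F z.1)
      (z.2 + fderiv ℝ F z.1 z.2 • coordGrad G F z.1))) (y₀, 0) :=
    (((l1 cG).clm_apply cP).clm_apply cP).sqrt
  have cNP := (l1 cN).clm_apply cP
  have c2 : ContinuousAt (fun z : E × E => √(G z.1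
      (coordHess G F z.1 (z.2 + fderiv ℝ F z.1 z.2 • coordGrad G F z.1))
      (coordHess G F z.1 (z.2 + fderiv ℝ F z.1 z.2 • coordGrad G F z.1)))) (y₀, 0) :=
    (((l1 cG).clm_apply cNP).clm_apply cNP).sqrt
  have hnF : t₀ < -F y₀ := by rw [hF0]; linarith
  have ca : ContinuousAt (fun z : E × E => a (-F z.1)) (y₀, 0) :=
    ContinuousAt.comp (g := a) (f := fun z : E × E => -F z.1) (x := (y₀, (0 : E)))
      (hw.hasDerivAt _ hnF).continuousAt cF₁.neg
  have ca' : ContinuousAt (fun z : E × E => a' (-F z.1)) (y₀, 0) :=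
    ContinuousAt.comp (g := a') (f := fun z : E × E => -F z.1) (x := (y₀, (0 : E)))
      (hw.hasDerivAt_deriv _ hnF).continuousAt cF₁.neg
  -- At the zero vector the two bounds read `0 < a` and `0 < a'`; they persist nearby by continuity.
  have e1 := c1.eventually_lt ca (by simpa using hw.pos _ (hw.nonneg.trans hnF.le))
  have e2 := c2.eventually_lt ca' (by simpa using hw.deriv_pos _ hnF)
  have e3 := cF₁.eventually_lt (continuousAt_const (y := -t₀)) (by simp only [hF0]; exact hp)
  have e4 : ∀ᶠ z : E × E in 𝓝 (y₀, 0), -F z.1 < -f p + 1 :=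
    cF₁.neg.eventually_lt (continuousAt_const (y := -f p + 1)) (by
      change -F y₀ < -f p + 1
      rw [hF0]; linarith)
  have e5 : ∀ᶠ z : E × E in 𝓝 (y₀, 0), z.1 ∈ (extChartAt 𝓘(ℝ, E) p).target :=
    continuousAt_fst.preimage_mem_nhds htn
  obtain ⟨ρ, hρ, hall⟩ := Metric.eventually_nhds_iff_ball.mp (e1.and (e2.and (e3.and (e4.and e5))))
  refine ⟨ρ, hρ, fun y hy => (hall (y, 0) (by
    rw [← ball_prod_same]; exact ⟨hy, Metric.mem_ball_self hρ⟩)).2.2.2.2, fun x hx hxρ u hu => ?_⟩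
  obtain ⟨h1, h2, h3, h4, -⟩ := hall (extChartAt 𝓘(ℝ, E) p x, chartDeriv p x u) (by
    rw [← ball_prod_same]; exact ⟨hxρ, by simpa using hu⟩)
  have hFx : F (extChartAt 𝓘(ℝ, E) p x) = f x := by
    simp only [hF, (extChartAt 𝓘(ℝ, E) p).left_inv hx]
  have hP : chartDeriv p x u + fderiv ℝ F (extChartAt 𝓘(ℝ, E) p x) (chartDeriv p x u) •
      coordGrad G F (extChartAt 𝓘(ℝ, E) p x) = chartDeriv p x (u + dfun f x u • S.unitGrad f x) := by
    rw [map_add, map_smul, fderiv_comp_symm_chartDeriv hf.1 p hx, coordGrad_unitGrad hf p hx]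
  simp only [hP, hFx] at h1 h2 h3 h4
  rw [coordMetric_chartDeriv _ p hx] at h1
  rw [← chartDeriv_chartShape p hx, coordMetric_chartDeriv _ p hx,
    hΦ.chartShape_eq hf p x hx (mem_extChartAt_source (I := 𝓘(ℝ, E)) x)] at h2
  exact ⟨h3, h4, h1, h2⟩

/-- A curve that drifts slowly across the integral curves of the unit gradient is timelike. -/
lemma futureTimelike_drift (hΦ : S.IsGradFlow f Φ) (hf : S.IsTemporal f)
    (hfut : ∀ x, S.FutureTimelike x (grad S.g f x)) {σ : ℝ → M} {u : E} {θ c : ℝ}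
    (hσ : HasVelocityAt σ (c • u) θ)
    (hb : |c| * √((conformal S.g f).at (Φ (θ + f (σ θ)) (σ θ))
      (flowDeriv Φ (θ + f (σ θ)) (σ θ) (u + dfun f (σ θ) u • S.unitGrad f (σ θ)))
      (flowDeriv Φ (θ + f (σ θ)) (σ θ) (u + dfun f (σ θ) u • S.unitGrad f (σ θ)))) < 1) :
    ∃ v : E, HasVelocityAt (fun s => Φ (s + f (σ s)) (σ s)) v θ ∧
      S.FutureTimelike (Φ (θ + f (σ θ)) (σ θ)) v := by
  set τ := θ + f (σ θ) with hτ
  set x := σ θ with hx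
  set w := u + dfun f x u • S.unitGrad f x with hw
  have hdw : dfun f x w = 0 := by
    rw [hw, map_add, map_smul, dfun_unitGrad hf, smul_eq_mul]; ring
  -- The flow is split as `Φ τ` with `τ` frozen after a flow whose time vanishes at `θ`, so joint
  -- differentiability at time `0` suffices.
  have hδ : HasDerivAt (fun s => s + f (σ s) - τ) (1 + dfun f x (c • u)) θ :=
    ((hasDerivAt_id θ).add (hσ.comp_function hf.1)).sub_const τ
  have h1 := hΦ.hasVelocityAt_comp hf τ (hΦ.hasVelocityAt_of_time hf hσ hδ (by simp [hτ, hx]))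
  have h0 : Φ (θ + f (σ θ) - τ) (σ θ) = x := by rw [← hx, ← hτ, sub_self, hΦ.zero]
  have hfun : (fun r => Φ τ (Φ (r + f (σ r) - τ) (σ r))) = fun s => Φ (s + f (σ s)) (σ s) := by
    funext r
    rw [← hΦ.add hf]
    congr 1
    ring
  -- The flow time compensates the change of `f` along `σ`: what remains is `U` plus a vector
  -- tangent to the level set of `f`.
  have hvec : c • u + (1 + dfun f x (c • u)) • S.unitGrad f x = S.unitGrad f x + c • w := by
    rw [hw, map_smul, smul_eq_mul, smul_add, add_smul, one_smul, smul_smul]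
    abel
  rw [hfun, h0, ← hx, hvec, map_add, map_smul, hΦ.flowDeriv_unitGrad hf] at h1
  refine ⟨_, h1, ?_⟩
  have hdJ : dfun f (Φ τ x) (flowDeriv Φ τ x w) = 0 := by rw [hΦ.dfun_flowDeriv hf, hdw]
  rw [futureTimelike_iff hf hfut, ← conformal_neg_iff hf]
  set J := flowDeriv Φ τ x w with hJ
  have hJ0 := conformal_nonneg hf _ hdJ
  have hUJ : (conformal S.g f).at (Φ τ x) (S.unitGrad f (Φ τ x)) J = 0 := by
    rw [conformal_unitGrad hf, hdJ]
  constructor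
  · have e : (conformal S.g f).at (Φ τ x) (S.unitGrad f (Φ τ x) + c • J)
        (S.unitGrad f (Φ τ x) + c • J) = -1 + c ^ 2 * (conformal S.g f).at (Φ τ x) J J := by
      simp only [map_add, map_smul, add_apply, smul_apply, smul_eq_mul, hUJ,
        conformal_symm (Φ τ x) J (S.unitGrad f (Φ τ x))]
      rw [conformal_unitGrad hf, dfun_unitGrad hf]
      ring
    rw [e]
    have h2 : (|c| * √((conformal S.g f).at (Φ τ x) J J)) ^ 2 < 1 :=
      pow_lt_one₀ (by positivity) hb two_ne_zero
    rw [mul_pow, sq_abs, Real.sq_sqrt hJ0] at h2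
    linarith
  · rw [map_add, map_smul, hdJ, dfun_unitGrad hf]
    simp

/-- Nearby integral curves of the unit gradient eventually enter each other's past. -/
lemma exists_nhds_chron (hΦ : S.IsGradFlow f Φ) (hf : S.IsTemporal f)
    (hfut : ∀ x, S.FutureTimelike x (grad S.g f x)) (hw : S.IsWarping f a a' k t₀)
    {p : M} (hp : f p < -t₀) :
    ∃ W ∈ 𝓝 p, ∀ x ∈ W, ∀ y ∈ W, ∀ t, ∃ τ, S.Chron (Φ t x) (Φ τ y) := by
  obtain ⟨ρ, hρ, hball, h⟩ := hΦ.exists_ball hf hw hp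
  have hps := mem_extChartAt_source (I := 𝓘(ℝ, E)) p
  refine ⟨_, Filter.inter_mem ((isOpen_extChartAt_source (I := 𝓘(ℝ, E)) p).mem_nhds hps)
    ((continuousAt_extChartAt (I := 𝓘(ℝ, E)) p).preimage_mem_nhds
      (Metric.ball_mem_nhds _ (half_pos hρ))), ?_⟩
  rintro x ⟨hxs, hx⟩ y ⟨hys, hy⟩ t
  set φ := extChartAt 𝓘(ℝ, E) p with hφ
  have hx : φ x ∈ Metric.ball (φ p) (ρ / 2) := hx
  have hy : φ y ∈ Metric.ball (φ p) (ρ / 2) := hy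
  -- The first entry exceeds `-f` on the segment, so that all flow times `θ + f (σ θ)` are
  -- nonnegative. The second puts the starting point of the drift, `Φ (T + f x) x`, later than `Φ t
  -- x`.
  set T := max (-f p + 1) (t - f x + 1) with hT
  have hT0 : 0 < T := lt_of_lt_of_le (by linarith [hw.nonneg]) (le_max_left _ _)
  obtain ⟨s, Θ, hTΘ, hsT, hsΘ, hs⟩ := exists_time_change hw.continuousOn hw.pos hw.lintegral hT0
  set w := φ y - φ x with hwdef
  have hwρ : ‖w‖ < ρ := by
    have h1 := dist_triangle_right (φ y) (φ x) (φ p)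
    rw [dist_eq_norm (φ y) (φ x)] at h1
    linarith [Metric.mem_ball.mp hx, Metric.mem_ball.mp hy]
  have hseg : ∀ r ∈ Icc (0 : ℝ) 1, φ x + r • w ∈ Metric.ball (φ p) ρ := by
    intro r hr
    refine Metric.ball_subset_ball (by linarith) ((convex_ball (φ p) (ρ / 2)).segment_subset hx hy ?_)
    rw [segment_eq_image']
    exact ⟨r, hr, rfl⟩
  set σ : ℝ → M := fun θ => φ.symm (φ x + s θ • w) with hσ
  have hσT : σ T = x := by simp only [hσ, hsT, zero_smul, add_zero]; exact φ.left_inv hxs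
  have hσΘ : σ Θ = y := by
    simp only [hσ, hsΘ, one_smul, hwdef, add_sub_cancel]; exact φ.left_inv hys
  -- The drift reaches the level `f = -θ` at time `θ`, where the growth estimate bounds the carried
  -- vector by `a θ`. Its coefficient is `1/(2 a θ)`.
  have key := chron_of_hasVelocityAt hf hfut (Γ := fun θ => Φ (θ + f (σ θ)) (σ θ)) hTΘ (by
    intro θ hθ
    obtain ⟨hs01, hsd⟩ := hs θ hθ
    have hin := hseg _ hs01
    have hint := hball hin
    have hd : HasDerivAt (fun θ => φ x + s θ • w) ((1 / (2 * a θ)) • w) θ :=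
      (hsd.smul_const w).const_add _
    have hvel := hasVelocityAt_symm_comp (α := fun θ => φ x + s θ • w) p hint hd
    rw [map_smul] at hvel
    have hσs : σ θ ∈ φ.source := φ.map_target hint
    have hφσ : φ (σ θ) = φ x + s θ • w := φ.right_inv hint
    obtain ⟨h1, h2, h3, h4⟩ := h (σ θ) hσs (by rw [hφσ]; exact hin)
      (chartSymmDeriv p (φ x + s θ • w) w) (by
        rw [← hφσ, chartDeriv_chartSymmDeriv' p hσs]; exact hwρ)
    refine hΦ.futureTimelike_drift hf hfut hvel ?_
    have hτ : 0 ≤ θ + f (σ θ) := by linarith [hθ.1, le_max_left (-f p + 1) (t - f x + 1)]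
    have hgrow := hΦ.sqrt_conformal_flowDeriv_le hf hw.hasDerivAt hw.hasDerivAt_deriv
      hw.coeff_nonneg hw.abs_curvature_le h1 (by
        rw [map_add, map_smul, dfun_unitGrad hf, smul_eq_mul]; ring) h3 h4 hτ
    have hfθ : -f (Φ (θ + f (σ θ)) (σ θ)) = θ := by rw [hΦ.apply hf]; ring
    rw [hfθ] at hgrow
    have ha := hw.pos θ (hT0.le.trans hθ.1)
    rw [abs_of_pos (by positivity)]
    calc _ ≤ 1 / (2 * a θ) * a θ := mul_le_mul_of_nonneg_left hgrow (by positivity)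
      _ < 1 := by field_simp; norm_num)
  simp only [hσT, hσΘ] at key
  exact ⟨_, (hΦ.chron hf hfut (s := t) (t := T + f x)
    (by linarith [le_max_right (-f p + 1) (t - f x + 1)]) x).trans key⟩

/-- Every integral curve of the unit gradient enters the future of every point. -/
lemma exists_chron [ConnectedSpace M] (hΦ : S.IsGradFlow f Φ) (hf : S.IsTemporal f)
    (hfut : ∀ x, S.FutureTimelike x (grad S.g f x)) (hw : S.IsWarping f a a' k t₀) (x y : M)
    (t : ℝ) : ∃ τ, S.Chron (Φ t x) (Φ τ y) := by
  have hloc : ∀ p, ∃ W ∈ 𝓝 p, ∀ x ∈ W, ∀ y ∈ W, ∀ t, ∃ τ, S.Chron (Φ t x) (Φ τ y) := by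
    intro p
    -- This flow time carries `p` to the level `-t₀ - 1`, inside the region where the curvature
    -- bound holds.
    set τ₀ := f p + t₀ + 1 with hτ₀
    obtain ⟨W, hW, h⟩ := hΦ.exists_nhds_chron hf hfut hw (p := Φ τ₀ p)
      (by rw [hΦ.apply hf]; linarith)
    refine ⟨_, (hΦ.continuous_space hf τ₀).continuousAt.preimage_mem_nhds hW, fun x hx y hy t => ?_⟩
    obtain ⟨τ, hτ⟩ := h _ hx _ hy (t - τ₀)
    rw [← hΦ.add hf, ← hΦ.add hf, add_sub_cancel] at hτ
    exact ⟨_, hτ⟩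
  have huniv := eq_univ_of_forall_nhds (s := {y | ∀ t, ∃ τ, S.Chron (Φ t x) (Φ τ y)})
    ⟨x, fun t => ⟨t + 1, hΦ.chron hf hfut (by linarith) x⟩⟩ (by
      intro q
      obtain ⟨W, hW, h⟩ := hloc q
      refine ⟨W, hW, fun u hu v hv hxu t => ?_⟩
      obtain ⟨τ, hτ⟩ := hxu t
      obtain ⟨τ', hτ'⟩ := h u hu v hv τ
      exact ⟨τ', hτ.trans hτ'⟩)
  exact (huniv ▸ mem_univ y : y ∈ {y | ∀ t, ∃ τ, S.Chron (Φ t x) (Φ τ y)}) t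

end IsGradFlow

end Spacetime

end Lorentz

/-! ### Leaves of the gradient, inextendible timelike curves and the compact slice. -/

namespace Lorentz

lemma HasVelocityAt.comp_hasDerivAt {E : Type*} [NormedAddCommGroup E] [NormedSpace ℝ E]
    {M : Type*} [TopologicalSpace M] [ChartedSpace E M] {γ : ℝ → M} {v : E} {h : ℝ → ℝ} {h' t : ℝ}
    (hγ : HasVelocityAt γ v (h t)) (hh : HasDerivAt h h' t) :
    HasVelocityAt (fun s => γ (h s)) (h' • v) t := by
  have h1 := HasMFDerivAt.comp t hγ hh.hasFDerivAt.hasMFDerivAt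
  refine h1.congr_mfderiv (ContinuousLinearMap.ext_ring ?_)
  change ((1 : ℝ) • h') • v = (1 : ℝ) • h' • v
  rw [one_smul, one_smul]

namespace Spacetime

variable {E : Type*} [NormedAddCommGroup E] [NormedSpace ℝ E] [FiniteDimensional ℝ E]
  {M : Type*} [TopologicalSpace M] [ChartedSpace E M] [IsManifold 𝓘(ℝ, E) ∞ M]
  {S : Spacetime E M} {f : M → ℝ} {Φ : ℝ → M → M}

lemma continuous_factor (hf : S.IsTemporal f) : Continuous (S.factor f) := by
  rw [continuous_iff_continuousAt]
  intro p
  have hp := mem_extChartAt_source (I := 𝓘(ℝ, E)) p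
  have h1 := (((contDiffOn_factor hf p).contDiffAt ((isOpen_target p).mem_nhds
    ((extChartAt 𝓘(ℝ, E) p).map_source hp))).continuousAt).comp
    (continuousAt_extChartAt (I := 𝓘(ℝ, E)) p)
  refine h1.congr ?_
  filter_upwards [(isOpen_extChartAt_source (I := 𝓘(ℝ, E)) p).mem_nhds hp] with x hx
  simp only [Function.comp, (extChartAt 𝓘(ℝ, E) p).left_inv hx]

lemma grad_eq_smul_unitGrad (hf : S.IsTemporal f) (x : M) :
    S.factor f x • S.unitGrad f x = gradE S.g f x := by
  rw [unitGrad, gradE_conformal hf, smul_smul, mul_inv_cancel₀ (factor_pos hf x).ne', one_smul]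

/-- The integral curves of the unit gradient lie in the leaves of the gradient. -/
lemma IsGradFlow.mem_leaf (hΦ : S.IsGradFlow f Φ) (hf : S.IsTemporal f) (p : M) (τ : ℝ) :
    Φ τ p ∈ leaf (grad S.g f) p := by
  -- Since `∇f` is the conformal factor times `U`, its integral curve uses the parameter `H = ∫ ρ`,
  -- whose inverse has the factor as derivative. The range of `H` is an open interval that contains
  -- the images of all flow times.
  set ρ : ℝ → ℝ := fun t => (S.factor f (Φ t p))⁻¹ with hρ
  have hpos : ∀ t, 0 < ρ t := fun t => inv_pos.mpr (factor_pos hf _)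
  have hρc : Continuous ρ := ((continuous_factor hf).comp (hΦ.continuous_time p)).inv₀
    fun t => (factor_pos hf _).ne'
  set H : ℝ → ℝ := fun t => ∫ r in (0 : ℝ)..t, ρ r with hH
  have hHd : ∀ t, HasStrictDerivAt H (ρ t) t := fun t => hρc.integral_hasStrictDerivAt 0 t
  have hmono : StrictMono H := strictMono_of_deriv_pos fun t => by
    rw [(hHd t).hasDerivAt.deriv]; exact hpos t
  have hopen : IsOpenMap H := isOpenMap_of_hasStrictDerivAt hHd fun t => (hpos t).ne'
  have hc : Continuous H := continuous_iff_continuousAt.mpr fun t => (hHd t).hasDerivAt.continuousAt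
  set h : ℝ → ℝ := Function.invFun H with hh
  have hleft : ∀ t, h (H t) = t := Function.leftInverse_invFun hmono.injective
  have hhd : ∀ t, HasDerivAt h (ρ t)⁻¹ (H t) := by
    intro t
    refine HasDerivAt.of_local_left_inverse (f := H) ?_ (by rw [hleft]; exact (hHd t).hasDerivAt)
      (hpos t).ne' ?_
    · intro V hV
      rw [hleft] at hV
      refine Filter.mem_map.mpr (Filter.mem_of_superset (hopen.image_mem_nhds hV) ?_)
      rintro _ ⟨r, hr, rfl⟩
      simpa [hleft] using hr
    · filter_upwards [hopen.image_mem_nhds (Filter.univ_mem (f := 𝓝 t))]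
      rintro _ ⟨r, -, rfl⟩
      rw [hleft]
  refine ⟨fun s => Φ (h s) p, range H, hopen.isOpen_range, (isPreconnected_range hc).ordConnected,
    ?_, H 0, ⟨0, rfl⟩, H τ, ⟨τ, rfl⟩, by simp only [hleft, hΦ.zero], by simp only [hleft]⟩
  rintro _ ⟨t, rfl⟩
  have h1 := (hΦ.isGradCurveOn p (h (H t)) (mem_univ _)).comp_hasDerivAt (hhd t)
  have e : (ρ t)⁻¹ • S.unitGrad f (Φ (h (H t)) p) = gradE S.g f (Φ (h (H t)) p) := by
    rw [← grad_eq_smul_unitGrad hf, hleft, hρ, inv_inv]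
  rw [e] at h1
  exact HasMFDerivAt.hasMFDerivWithinAt h1

lemma Chron.apply_le (hf : S.IsTemporal f) (hfut : ∀ x, S.FutureTimelike x (grad S.g f x))
    {ε : ℝ} (hε : 0 < ε) (hgrad : ∀ x, ε ≤ √|gradSq S.g f x|) {p q : M} (h : S.Chron p q) :
    f q ≤ f p := by
  obtain ⟨γ, a, b, ⟨hab, N, τ, h0, hN, hτ⟩, rfl, rfl⟩ := h
  exact (length_le hf hfut hε hgrad ⟨hab, N, τ, h0, hN, fun i hi =>
    ⟨(hτ i hi).1, (hτ i hi).2.1, fun t ht =>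
      ⟨((hτ i hi).2.2 t ht).1.le, ((hτ i hi).2.2 t ht).2⟩⟩⟩).1

/-- A chronological sequence along which `f` is bounded below converges. -/
lemma exists_tendsto_of_bddBelow (hf : S.IsTemporal f)
    (hfut : ∀ x, S.FutureTimelike x (grad S.g f x))
    {ε : ℝ} (hε : 0 < ε) (hgrad : ∀ x, ε ≤ √|gradSq S.g f x|) (hS : S.FutureCauchyComplete)
    {x : ℕ → M} (hx : ∀ k, S.Chron (x k) (x (k + 1))) {b : ℝ} (hb : ∀ k, b ≤ f (x k)) :
    ∃ p, Tendsto x atTop (𝓝 p) := by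
  have hanti : Antitone fun k => f (x k) :=
    antitone_nat_of_succ_le fun k => (hx k).apply_le hf hfut hε hgrad
  have hbdd : BddBelow (range fun k => f (x k)) := ⟨b, by rintro _ ⟨k, rfl⟩; exact hb k⟩
  exact exists_tendsto_future hf hfut hε hgrad hS hx (fun k => ciInf_le hbdd k)
    (tendsto_atTop_ciInf hanti hbdd)

end Spacetime

/-- Two cofinal sets of a linear order can be visited alternately. -/
lemma exists_alternating_seq {J : Type*} [Preorder J] [Nonempty J] {A B : J → Prop}
    (hA : ∀ s, ∃ t, s < t ∧ A t) (hB : ∀ s, ∃ t, s < t ∧ B t) :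
    ∃ w : ℕ → J, (∀ k, w k < w (k + 1)) ∧ (∃ᶠ k in atTop, A (w k)) ∧ ∃ᶠ k in atTop, B (w k) := by
  choose nA hA1 hA2 using hA
  choose nB hB1 hB2 using hB
  obtain ⟨s₀⟩ := ‹Nonempty J›
  set w : ℕ → J := fun k => Nat.rec s₀ (fun k s => if Even k then nA s else nB s) k with hw
  have hsucc : ∀ k, w (k + 1) = if Even k then nA (w k) else nB (w k) := fun k => rfl
  refine ⟨w, fun k => ?_, ?_, ?_⟩
  · rw [hsucc]
    split_ifs
    · exact hA1 _
    · exact hB1 _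
  · rw [frequently_atTop]
    intro n
    refine ⟨2 * n + 1, by omega, ?_⟩
    rw [hsucc, if_pos (by simp)]
    exact hA2 _
  · rw [frequently_atTop]
    intro n
    refine ⟨2 * n + 1 + 1, by omega, ?_⟩
    rw [hsucc, if_neg (by simp)]
    exact hB2 _

/-- A map from an interval without maximum has a limit if it has one along all increasing
sequences. -/
lemma exists_tendsto_of_seq {X : Type*} [TopologicalSpace X] [RegularSpace X] {J : Set ℝ}
    [J.OrdConnected] [Nonempty J] [NoMaxOrder J] {γ : J → X}
    (h : ∀ w : ℕ → J, (∀ k, w k < w (k + 1)) → ∃ p, Tendsto (fun k => γ (w k)) atTop (𝓝 p)) :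
    ∃ p, Tendsto γ atTop (𝓝 p) := by
  obtain ⟨c, -, hc⟩ := exists_seq_monotone_tendsto_atTop_atTop J
  have hnext : ∀ (k : ℕ) (s : J), ∃ t, s < t ∧ c k < t := fun k s => by
    obtain ⟨t, ht⟩ := exists_gt (max s (c k))
    exact ⟨t, (le_max_left _ _).trans_lt ht, (le_max_right _ _).trans_lt ht⟩
  choose next hn1 hn2 using hnext
  obtain ⟨s₀⟩ := ‹Nonempty J›
  set u : ℕ → J := fun k => Nat.rec s₀ (fun k s => next k s) k with hu
  have husucc : ∀ k, u (k + 1) = next k (u k) := fun k => rfl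
  have hutop : Tendsto u atTop atTop := by
    rw [← tendsto_add_atTop_iff_nat 1]
    exact tendsto_atTop_mono (fun k => by rw [husucc]; exact (hn2 k _).le) hc
  obtain ⟨q, hq⟩ := h u fun k => by rw [husucc]; exact hn1 k _
  refine ⟨q, fun O hO => Filter.mem_map.mpr ?_⟩
  obtain ⟨O', hO'O, hO'open, hqO'⟩ := mem_nhds_iff.mp hO
  obtain ⟨C, hC, hCclosed, hCO⟩ := exists_mem_nhds_isClosed_subset (hO'open.mem_nhds hqO')
  -- If `γ` does not tend to `q`, an increasing sequence can alternate between the closed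
  -- neighbourhood `C` of `q` and the complement of `O' ⊇ C`. Its limit would lie in both of these
  -- closed sets.
  by_contra hcon
  have hA : ∀ s : J, ∃ t, s < t ∧ γ t ∉ O' := by
    intro s
    by_contra! hall
    refine hcon ?_
    filter_upwards [eventually_gt_atTop s] with t ht using hO'O (hall t ht)
  have hB : ∀ s : J, ∃ t, s < t ∧ γ t ∈ C := by
    intro s
    obtain ⟨k, hk1, hk2⟩ := ((hq.eventually hC).and (hutop.eventually (eventually_gt_atTop s))).exists
    exact ⟨u k, hk2, hk1⟩
  have : Nonempty J := ⟨s₀⟩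
  obtain ⟨w, hw, hwA, hwB⟩ := exists_alternating_seq hA hB
  obtain ⟨q', hq'⟩ := h w hw
  have h1 : q' ∈ O'ᶜ := hO'open.isClosed_compl.mem_of_frequently_of_tendsto hwA hq'
  have h2 : q' ∈ C := hCclosed.mem_of_frequently_of_tendsto hwB hq'
  exact h1 (hCO h2)

namespace Spacetime

variable {E : Type*} [NormedAddCommGroup E] [NormedSpace ℝ E] [FiniteDimensional ℝ E]
  {M : Type*} [TopologicalSpace M] [ChartedSpace E M] [IsManifold 𝓘(ℝ, E) ∞ M]
  {S : Spacetime E M} {f : M → ℝ} {Φ : ℝ → M → M}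

/-- Along a future-inextendible timelike curve `f` is unbounded below. -/
lemma IsFutureInextendibleTimelike.exists_apply_lt [T2Space M] (hf : S.IsTemporal f)
    (hfut : ∀ x, S.FutureTimelike x (grad S.g f x))
    {ε : ℝ} (hε : 0 < ε) (hgrad : ∀ x, ε ≤ √|gradSq S.g f x|) (hS : S.FutureCauchyComplete)
    {γ : ℝ → M} {J : Set ℝ} (h : S.IsFutureInextendibleTimelike γ J) (b : ℝ) :
    ∃ t ∈ J, f (γ t) < b := by
  obtain ⟨hne, hord, hsm, hlim⟩ := h
  by_contra! hcon
  have hne' : Nonempty J := hne.to_subtype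
  -- At a greatest element `atTop` is principal, and the curve would converge to its value there.
  have hnomax : NoMaxOrder J := by
    constructor
    intro m
    by_contra! hmax
    refine hlim ⟨γ m, fun O hO => Filter.mem_map.mpr ?_⟩
    filter_upwards [eventually_ge_atTop m] with t ht
    rw [le_antisymm (hmax t) ht]
    exact mem_preimage.mpr (mem_of_mem_nhds hO)
  have : LocallyCompactSpace M := ChartedSpace.locallyCompactSpace E M
  refine hlim (exists_tendsto_of_seq (γ := fun t : J => γ t) fun w hw =>
    exists_tendsto_of_bddBelow hf hfut hε hgrad hS
      (fun k => ⟨γ, _, _, hsm _ (w k).2 _ (w (k + 1)).2 (hw k), rfl, rfl⟩)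
      (fun k => hcon _ (w k).2))

/-- If `f⁻¹(0)` is compact, the integral curves of the unit gradient enter the future of a given
point uniformly. -/
lemma IsGradFlow.exists_forall_chron [T2Space M] (hΦ : S.IsGradFlow f Φ) (hf : S.IsTemporal f)
    (hfut : ∀ x, S.FutureTimelike x (grad S.g f x))
    (hchron : ∀ x y : M, ∀ t, ∃ τ, S.Chron (Φ t x) (Φ τ y)) {K : Set M} (hK : IsCompact K) (p : M) :
    ∃ T, ∀ x ∈ K, ∀ θ, T < θ → S.Chron p (Φ θ x) := by
  refine hK.induction_on (p := fun K => ∃ T, ∀ x ∈ K, ∀ θ, T < θ → S.Chron p (Φ θ x))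
    ⟨0, by simp⟩ (fun s t hst ⟨T, hT⟩ => ⟨T, fun x hx => hT x (hst hx)⟩) ?_ ?_
  · rintro s t ⟨T, hT⟩ ⟨T', hT'⟩
    refine ⟨max T T', fun x hx θ hθ => ?_⟩
    rcases hx with hx | hx
    · exact hT x hx θ ((le_max_left _ _).trans_lt hθ)
    · exact hT' x hx θ ((le_max_right _ _).trans_lt hθ)
  · intro x hx
    obtain ⟨τ, hτ⟩ := hchron p x 0
    rw [hΦ.zero] at hτ
    -- Moving slightly later on the orbit makes the point interior to the future of `Φ τ x`.
    -- Continuity of `Φ s` then gives the same time `s` for all starting points near `x`.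
    obtain ⟨s, hs⟩ := (eventually_chron_nhds hf hfut (hΦ.isGradCurveOn x τ (mem_univ τ))
      (futureTimelike_unitGrad hf hfut _)).exists
    refine ⟨_, mem_nhdsWithin_of_mem_nhds ((hΦ.continuous_space hf s).continuousAt.eventually hs),
      s, fun x' hx' θ hθ => ?_⟩
    exact (hτ.trans hx').trans (hΦ.chron hf hfut hθ x')

end Spacetime

end Lorentz

theorem theorem4p11 {E : Type*} [NormedAddCommGroup E] [NormedSpace ℝ E] [FiniteDimensional ℝ E]
    {M : Type*} [TopologicalSpace M] [ChartedSpace E M] [IsManifold 𝓘(ℝ, E) ∞ M]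
    [T2Space M] [SecondCountableTopology M] [ConnectedSpace M]
    (n : ℕ) (hn : 1 ≤ n) (hdim : Module.finrank ℝ E = n + 1)
    (S : Lorentz.Spacetime E M) (hS : S.TimelikeCauchyComplete)
    (f : M → ℝ) (hf : S.IsTemporal f) (hfut : ∀ x, S.FutureTimelike x (Lorentz.grad S.g f x))
    (ε : ℝ) (hε : 0 < ε) (hgrad : ∀ x, ε ≤ √|Lorentz.gradSq S.g f x|)
    (heik : Lorentz.SolvesEikonal (Lorentz.conformal S.g f) f)
    (hcurv : Lorentz.CurvatureConstraint n (Lorentz.conformal S.g f) f) :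
    Set.range f = Set.univ ∧ S.FutureOmniscient (Lorentz.grad S.g f) ∧
      (IsCompact (f ⁻¹' {0}) → S.FutureNOH) := by
  obtain ⟨Φ, hΦ⟩ := Lorentz.Spacetime.exists_isGradFlow hf hfut hε hgrad hS
  have hrange := hΦ.exists_apply_eq hf
  obtain ⟨a, a', k, t₀, hw⟩ := Lorentz.Spacetime.exists_isWarping hf hn hdim hrange hcurv
  have hchron := hΦ.exists_chron hf hfut hw
  refine ⟨eq_univ_of_forall hrange, ⟨hfut, fun p => eq_univ_of_forall fun x => ?_⟩,
    fun hK γ J hγ => eq_univ_of_forall fun p => ?_⟩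
  · obtain ⟨τ, hτ⟩ := hchron x p 0
    rw [hΦ.zero] at hτ
    exact ⟨_, hΦ.mem_leaf hf p τ, hτ⟩
  · obtain ⟨T, hT⟩ := hΦ.exists_forall_chron hf hfut hchron hK p
    obtain ⟨t, ht, hlt⟩ := hγ.exists_apply_lt hf hfut hε hgrad hS.1 (-T)
    -- The point `γ t` is flowed back to the slice `f = 0`; the time needed to return, `-f (γ t)`,
    -- exceeds `T`.
    have h1 := hT (Φ (f (γ t)) (γ t)) (by simp [hΦ.apply hf]) (-f (γ t)) (by linarith)
    rw [← hΦ.add hf, add_neg_cancel, hΦ.zero] at h1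
    exact ⟨_, ⟨t, ht, rfl⟩, h1⟩
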